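/- **Theorem 3.** Conventions. For a real number $r=m+\alpha\ge 0$ with $m=\lfloor r\rfloor$, $0\le\alpha<1$, a map is of class $C^{(r)}$ if it is $m$ times continuously differentiable and its $m$-th derivative is locally Hölder continuous of exponent $\alpha$ (for $\alpha=0$: $C^{(m)}=C^m$); $C^{(\infty)}$ means $C^{(r)}$ for all finite $r$. A $C^{(k)}$-manifold is a manifold without boundary whose transition maps are of class $C^{(k)}$, and for $k\ge r$ the algebra $C^{(r)}(M)\subset C(M)$ consists of the complex functions on $M$ that are of class $C^{(r)}$ in all charts. Let $H$ be a complex Hilbert space. A *Fréchet operator ideal* $\mathcal K_\tau$ is a two-sided ideal of $\mathcal L(H)$ that consists of compact operators and contains all operators of finite rank, with a Fréchet space topology $\tau$ (complete, given by an increasing sequence of seminorms) that is finer than the operator norm topology and for which the multiplication $\mathcal L(H)\times\mathcal K_\tau\times\mathcal L(H)\to\mathcal K_\tau$ is continuous. A *$\tau$-smooth extension* of $(A^\infty,A)$ by $\mathcal K_\tau$ is a pair $(\pi,P)$ of a representation ($*$-homomorphism) $\pi:A\to\mathcal L(H)$ and an orthogonal projection $P\in\mathcal L(H)$ such that $[\pi(a),P]\in\mathcal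 K_\tau$ for all $a\in A^\infty$ and $P\pi(A)P\cap\mathcal K(H)=\{0\}$, where $\mathcal K(H)$ is the ideal of compact operators; the completely positive map that defines it is $\phi(a)=P\pi(a)P$, $a\in A$. A completely positive map $\phi:A\to\mathcal L(H)$ is *$\tau$-smooth* with respect to a dense $*$-subalgebra $A_0^\infty\subset A^\infty$ that is countably generated as a vector space if, for every completely positive map $\phi_0:A\to\mathcal L(H)$, $$(\phi-\phi_0)(A_0^\infty)\subset\mathcal K_\tau\quad\text{implies}\quad(\phi-\phi_0)(A^\infty)\subset\mathcal K_\tau .$$ Statement. Let $n\ge 0$ be an integer, $\varepsilon>0$ a real number, $n+2+\varepsilon\le k\le\infty$, and let $M$ be a compact Hausdorff $C^{(k)}$-manifold of dimension $n$. Let $A=C(M)$ and $A^\infty=C^{(n+2+\varepsilon)}(M)$. Then, for every Fréchet operator ideal $\mathcal K_\tau$ on every complex Hilbert space $H$, every completely positive map $\phi:C(M)\to\mathcal L(H)$ that defines a $\tau$-smooth extension of $(C^{(n+2+\varepsilon)}(M),C(M))$ by $\mathcal K_\tau$ is $\tau$-smooth with respect to every $*$-subalgebra $A_0^\infty\subset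 C^{(n+2+\varepsilon)}(M)$ (with or without unit) that is countably generated as a vector space and dense in $C^{(n+2+\varepsilon)}(M)$ for the topology of uniform convergence, on compact subsets of the charts, of the derivatives of order at most $\lfloor n+2+\varepsilon\rfloor$. (For integral $n+2+\varepsilon$ this is the Fréchet topology of $C^{(n+2+\varepsilon)}(M)$; otherwise it is coarser than the Hölder topology.) -/

import Mathlib

open scoped NNReal ENNReal ComplexOrder CStarAlgebra Topology

noncomputable section

namespace SmoothExt

/-! ### Functions and manifolds of class `C^(r)` for real `r` -/

/-- A function `f` between real normed spaces is of class `C^(r)` on the open set `U`, for a real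
order `r = m + α` with `m = ⌊r⌋` and `0 ≤ α < 1`: it is `m` times continuously differentiable on
`U` and its `m`-th derivative is locally Hölder continuous of exponent `α` on `U`. (For `α = 0`
the second condition is local boundedness of the continuous `m`-th derivative, so `C^(m)` is the
usual class `C^m`.) -/
def IsClassOn {E F : Type*} [NormedAddCommGroup E] [NormedSpace ℝ E]
    [NormedAddCommGroup F] [NormedSpace ℝ F] (r : ℝ≥0) (f : E → F) (U : Set E) : Prop :=
  ContDiffOn ℝ (⌊r⌋₊ : ℕ) f U ∧
    ∀ x ∈ U, ∃ V ∈ 𝓝 x, ∃ C : ℝ≥0,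
      HolderOnWith C (r - (⌊r⌋₊ : ℝ≥0)) (iteratedFDeriv ℝ ⌊r⌋₊ f) V

/-- The atlas of `M` makes it a manifold of dimension `n` (without boundary) of class `C^(k)`,
`0 ≤ k ≤ ∞`: all transition maps are of class `C^(s)` for every real `s ≤ k`. For a natural number
`k` or `k = ∞` this is the usual notion. -/
def IsClassManifold (n : ℕ) (k : ℝ≥0∞) (M : Type*) [TopologicalSpace M]
    [ChartedSpace (EuclideanSpace ℝ (Fin n)) M] : Prop :=
  ∀ e ∈ atlas (EuclideanSpace ℝ (Fin n)) M, ∀ e' ∈ atlas (EuclideanSpace ℝ (Fin n)) M,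
    ∀ s : ℝ≥0, (s : ℝ≥0∞) ≤ k → IsClassOn s (e.symm.trans e') (e.symm.trans e').source

section FunctionAlgebra

variable (n : ℕ) {M : Type*} [TopologicalSpace M] [ChartedSpace (EuclideanSpace ℝ (Fin n)) M]

/-- `C^(r)(M)`, as a set of complex continuous functions on `M`: the functions that are of class
`C^(r)` in every chart. -/
def classFunctions (r : ℝ≥0) : Set C(M, ℂ) :=
  {f | ∀ e ∈ atlas (EuclideanSpace ℝ (Fin n)) M, IsClassOn r (f ∘ e.symm) e.target}

/-- Convergence of a sequence in the `C^m` topology: in every chart, all derivatives of order at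
most `m` converge uniformly on compact sets. -/
def ConvergesInCm (m : ℕ) (u : ℕ → C(M, ℂ)) (f : C(M, ℂ)) : Prop :=
  ∀ e ∈ atlas (EuclideanSpace ℝ (Fin n)) M, ∀ S ⊆ e.target, IsCompact S → ∀ j ≤ m,
    TendstoUniformlyOn (fun i x => iteratedFDeriv ℝ j (u i ∘ e.symm) x)
      (iteratedFDeriv ℝ j (f ∘ e.symm)) Filter.atTop S

/-- `A₀` is a dense `*`-subalgebra of `C^(r)(M)`, countably generated as a vector space (and not
necessarily containing the constants). Density is with respect to the `C^⌊r⌋` topology: for an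
integer `r` this is the Fréchet topology of `C^(r)(M)`; for other `r` it is coarser than the Hölder
topology, for which `C^(r)(M)` is not separable, so that it asks less of `A₀`. -/
structure IsDenseSubalgebra (r : ℝ≥0) (A₀ : NonUnitalStarSubalgebra ℂ C(M, ℂ)) : Prop where
  subset : (A₀ : Set C(M, ℂ)) ⊆ classFunctions n r
  countable : ∃ S : Set C(M, ℂ), S.Countable ∧
    (Submodule.span ℂ S : Set C(M, ℂ)) = (A₀ : Set C(M, ℂ))
  dense : ∀ f ∈ classFunctions (M := M) n r, ∃ u : ℕ → C(M, ℂ),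
    (∀ i, u i ∈ A₀) ∧ ConvergesInCm n ⌊r⌋₊ u f

end FunctionAlgebra

/-! ### Fréchet operator ideals -/

section Operators

variable (H : Type*) [NormedAddCommGroup H] [InnerProductSpace ℂ H] [CompleteSpace H]

/-- A Fréchet operator ideal `K_τ` on the Hilbert space `H`: a two-sided ideal of bounded
operators, consisting of compact operators and containing those of finite rank, with a Fréchet
space topology `τ` (given by an increasing sequence of seminorms) that is finer than the operator
norm topology (in particular Hausdorff) and for which multiplication
`L(H) × K_τ × L(H) → K_τ` is continuous. -/
structure FrechetOperatorIdeal where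
  carrier : Submodule ℂ (H →L[ℂ] H)
  mul_mem : ∀ (x a y : H →L[ℂ] H), a ∈ carrier → x * a * y ∈ carrier
  compact : ∀ a ∈ carrier, IsCompactOperator a
  finiteRank : ∀ a : H →L[ℂ] H,
    FiniteDimensional ℂ (LinearMap.range (a : H →ₗ[ℂ] H)) → a ∈ carrier
  p : ℕ → Seminorm ℂ carrier
  mono : Monotone p
  norm_le : ∃ (i : ℕ) (C : ℝ), ∀ a : carrier, ‖(a : H →L[ℂ] H)‖ ≤ C * p i a
  mul_le : ∀ i : ℕ, ∃ (j : ℕ) (C : ℝ), ∀ (x y : H →L[ℂ] H) (a : carrier),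
    p i ⟨x * a * y, mul_mem x a y a.2⟩ ≤ C * ‖x‖ * p j a * ‖y‖
  complete : ∀ u : ℕ → carrier,
    (∀ i : ℕ, ∀ δ > 0, ∃ N : ℕ, ∀ s ≥ N, ∀ t ≥ N, p i (u s - u t) < δ) →
    ∃ a : carrier, ∀ i : ℕ, Filter.Tendsto (fun s => p i (u s - a)) Filter.atTop (𝓝 0)

variable {H}

/-! ### Extensions and smoothness of completely positive maps -/

variable {A : Type*} [CStarAlgebra A]

/-- A `τ`-smooth extension of `(A^∞, A)` by `K_τ`: a representation `π` of `A` on `H` and a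
projection `P` on `H` with `[π(a), P] ∈ K_τ` for `a ∈ A^∞` and `P π(A) P ∩ K(H) = {0}`. -/
structure SmoothExtension (K : FrechetOperatorIdeal H) (Ainf : Set A) where
  π : A →⋆ₙₐ[ℂ] (H →L[ℂ] H)
  P : H →L[ℂ] H
  isStarProjection : IsStarProjection P
  commutator_mem : ∀ a ∈ Ainf, π a * P - P * π a ∈ K.carrier
  inter_compact : ∀ a : A, IsCompactOperator (P * π a * P) → P * π a * P = 0

variable [PartialOrder A] [StarOrderedRing A]

/-- A completely positive map `φ : A → L(H)` is `τ`-smooth on `A^∞` with respect to `A₀ ⊆ A^∞`: if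
a completely positive map `φ₀ : A → L(H)` agrees with `φ` modulo `K_τ` on `A₀`, then it does so
on `A^∞`. -/
def IsTauSmooth (K : FrechetOperatorIdeal H) (Ainf A₀ : Set A) (φ : A →CP (H →L[ℂ] H)) : Prop :=
  ∀ φ₀ : A →CP (H →L[ℂ] H), (∀ a ∈ A₀, φ a - φ₀ a ∈ K.carrier) →
    ∀ a ∈ Ainf, φ a - φ₀ a ∈ K.carrier

end Operators

end SmoothExt

end

/-! Let `φ₀` be a completely positive map that agrees with `φ = P π P` modulo the ideal on `A₀`, and
write `φ₀ (star a * b) = V(a)† V(b)` (Kolmogorov). Two quantities measure how far `φ₀` is from `P π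
P` at `a`: the commutator `X(a) = V(a) P - V(1) P π(a)`, which obeys a first-order Leibniz rule, and
the defect `d(a) = P φ₀(a) P - π(a) P`, which obeys a second-order one with cross term `X(star a)†
X(b)`. The commutator is measured through `X(a)† X(a)`, so that it lies in a "square root" of the
ideal, where a triangle inequality and a Cauchy–Schwarz inequality hold.

The elements for which `X(a)† X(a)`, `X(star a)† X(star a)` and `d(a)` lie in the ideal form an
algebra with countably many submultiplicative seminorms. It contains `A₀`: positivity of `V` and an
element of `A₀` that is invertible in `C(M)` replace the possibly missing unit. Conversely, if `f`
belongs to this algebra and `[π(f), P]` lies in the ideal, then so does `φ(f) - φ₀(f)`; here the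
corners of `φ₀(f)` off the range of `P` are controlled by Cauchy–Schwarz (`compression_sub_mem`).

It remains to see that the algebra contains every function of class `C^(n+2)`. By the two Leibniz
rules the seminorms of `exp (i ∑ k_j a_j)`, for real `a_j` in the algebra, grow only quadratically
in `k`. A periodic function of class `C^(N+2)` of `N` variables has Fourier coefficients that are
summable against `|k|²`. Hence the algebra is closed under `C^(N+2)` functions of `sin (2π a_1), …,
sin (2π a_N)` (`mem_smooth_of_eq_sin`). With `N = 1` this turns uniform approximations of bump
functions into genuine cut-off functions, so that membership is a local question. With `N = n`,
approximation of first derivatives yields elements of `A₀` that form local coordinates, and the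
inverse function theorem writes `f` locally as a `C^(n+2)` function of them. -/

noncomputable section

namespace SmoothExt

set_option linter.unusedSectionVars false

open Filter

/-! ### Order and factorization of positive operators -/

section OperatorOrder

variable {H : Type*} [NormedAddCommGroup H] [InnerProductSpace ℂ H] [CompleteSpace H]

/-- Douglas' lemma: domination `‖S x‖ ≤ ‖T x‖` factorizes `S` through `T` by a contraction. -/
theorem exists_contraction_comp {S T : H →L[ℂ] H} (h : ∀ x, ‖S x‖ ≤ ‖T x‖) :
    ∃ c : H →L[ℂ] H, ‖c‖ ≤ 1 ∧ S = c * T := by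
  set R : Submodule ℂ H := (LinearMap.range (T : H →ₗ[ℂ] H)).topologicalClosure with hR
  have hmem : ∀ x, (T : H →ₗ[ℂ] H) x ∈ R := fun x =>
    Submodule.le_topologicalClosure _ (LinearMap.mem_range_self _ x)
  have : CompleteSpace R := (Submodule.isClosed_topologicalClosure _).completeSpace_coe
  let e : H →ₗ[ℂ] R := (T : H →ₗ[ℂ] H).codRestrict R hmem
  have hd : DenseRange e := by
    rintro ⟨y, hy⟩
    rw [Metric.mem_closure_iff]
    intro δ hδ
    have hy' : y ∈ closure (LinearMap.range (T : H →ₗ[ℂ] H) : Set H) := hy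
    obtain ⟨_, ⟨x, rfl⟩, hx⟩ := Metric.mem_closure_iff.1 hy' δ hδ
    exact ⟨e x, ⟨x, rfl⟩, hx⟩
  have hn : ∀ x, ‖(S : H →ₗ[ℂ] H) x‖ ≤ 1 * ‖e x‖ := fun x => by
    rw [one_mul]; exact h x
  refine ⟨((S : H →ₗ[ℂ] H).extendOfNorm e) ∘L R.orthogonalProjectionOnto, ?_, ?_⟩
  · refine ContinuousLinearMap.opNorm_le_bound _ zero_le_one fun x => ?_
    refine (LinearMap.norm_extendOfNorm_apply_le hd 1 hn _).trans ?_
    rw [one_mul, one_mul]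
    exact Submodule.norm_orthogonalProjectionOnto_apply_le R x
  · ext x
    have h1 : R.orthogonalProjectionOnto (T x) = e x :=
      Submodule.orthogonalProjectionOnto_mem_subspace_eq_self (K := R) (e x)
    change S x = ((S : H →ₗ[ℂ] H).extendOfNorm e) (R.orthogonalProjectionOnto (T x))
    rw [h1]
    exact (LinearMap.extendOfNorm_eq hd ⟨1, hn⟩ x).symm

/-- An operator dominated by a positive operator is a two-sided compression of it. -/
theorem exists_contraction_mul_mul_star {a b : H →L[ℂ] H} (ha : 0 ≤ a) (hab : a ≤ b) :
    ∃ c : H →L[ℂ] H, ‖c‖ ≤ 1 ∧ a = c * b * star c := by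
  have hb : 0 ≤ b := ha.trans hab
  set s := CFC.sqrt a
  set t := CFC.sqrt b
  have hs : s * s = a := CFC.sqrt_mul_sqrt_self a ha
  have ht : t * t = b := CFC.sqrt_mul_sqrt_self b hb
  have hss : star s = s := (CFC.sqrt_nonneg a).isSelfAdjoint.star_eq
  have hts : star t = t := (CFC.sqrt_nonneg b).isSelfAdjoint.star_eq
  have key : ∀ (u v : H →L[ℂ] H), star u = u → u * u = v → ∀ x, ‖u x‖ ^ 2 = (inner ℂ (v x) x).re := by
    intro u v hu huv x
    rw [← huv]
    change _ = (inner ℂ (u (u x)) x).re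
    conv_rhs => rw [← hu]
    rw [ContinuousLinearMap.star_eq_adjoint, ContinuousLinearMap.adjoint_inner_left,
      ← ContinuousLinearMap.star_eq_adjoint, hu]
    exact (inner_self_eq_norm_sq (𝕜 := ℂ) (u x)).symm
  obtain ⟨c, hc, hsc⟩ := exists_contraction_comp (S := s) (T := t) (fun x => by
    have h1 := (((ContinuousLinearMap.le_def a b).1 hab).re_inner_nonneg_left x)
    rw [sub_apply, inner_sub_left, map_sub] at h1
    have h2 := key s a hss hs x
    have h3 := key t b hts ht x
    refine (sq_le_sq₀ (norm_nonneg _) (norm_nonneg _)).1 ?_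
    rw [h2, h3]
    simpa using h1)
  refine ⟨c, hc, ?_⟩
  have : s = t * star c := by rw [← hss, hsc, star_mul, hts]
  calc a = s * s := hs.symm
    _ = c * t * (t * star c) := by rw [← this, ← hsc]
    _ = c * b * star c := by rw [← ht]; simp only [mul_assoc]

end OperatorOrder

/-! ### Gauges of a Fréchet operator ideal -/

namespace FrechetOperatorIdeal

variable {H : Type*} [NormedAddCommGroup H] [InnerProductSpace ℂ H] [CompleteSpace H]
variable (K : FrechetOperatorIdeal H)

open Classical in
/-- The `i`-th seminorm of a Fréchet operator ideal, extended by `∞` to all operators. -/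
def eseminorm (i : ℕ) (b : H →L[ℂ] H) : ℝ≥0∞ :=
  if h : b ∈ K.carrier then ENNReal.ofReal (K.p i ⟨b, h⟩) else ⊤

theorem eseminorm_of_mem (i : ℕ) {b : H →L[ℂ] H} (h : b ∈ K.carrier) :
    K.eseminorm i b = ENNReal.ofReal (K.p i ⟨b, h⟩) := dif_pos h

theorem mem_of_eseminorm_ne_top {i : ℕ} {b : H →L[ℂ] H} (h : K.eseminorm i b ≠ ⊤) :
    b ∈ K.carrier := by
  by_contra hb
  exact h (dif_neg hb)

theorem eseminorm_zero (i : ℕ) : K.eseminorm i 0 = 0 := by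
  rw [K.eseminorm_of_mem i K.carrier.zero_mem]
  have : (⟨0, K.carrier.zero_mem⟩ : K.carrier) = 0 := rfl
  rw [this, map_zero, ENNReal.ofReal_zero]

theorem eseminorm_add_le (i : ℕ) (b c : H →L[ℂ] H) :
    K.eseminorm i (b + c) ≤ K.eseminorm i b + K.eseminorm i c := by
  by_cases hb : b ∈ K.carrier
  · by_cases hc : c ∈ K.carrier
    · rw [K.eseminorm_of_mem i hb, K.eseminorm_of_mem i hc,
        K.eseminorm_of_mem i (K.carrier.add_mem hb hc),
        ← ENNReal.ofReal_add (apply_nonneg _ _) (apply_nonneg _ _)]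
      exact ENNReal.ofReal_le_ofReal (map_add_le_add (K.p i) ⟨b, hb⟩ ⟨c, hc⟩)
    · simp [eseminorm, hc]
  · simp [eseminorm, hb]

theorem eseminorm_smul_le (i : ℕ) (z : ℂ) (b : H →L[ℂ] H) :
    K.eseminorm i (z • b) ≤ ‖z‖ₑ * K.eseminorm i b := by
  by_cases hb : b ∈ K.carrier
  · rw [K.eseminorm_of_mem i hb, K.eseminorm_of_mem i (K.carrier.smul_mem z hb),
      ← ofReal_norm, ← ENNReal.ofReal_mul (norm_nonneg _)]
    exact ENNReal.ofReal_le_ofReal (map_smul_eq_mul (K.p i) z ⟨b, hb⟩).le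
  · rcases eq_or_ne z 0 with rfl | hz
    · simp [eseminorm_zero]
    · have : K.eseminorm i b = ⊤ := dif_neg hb
      rw [this, ENNReal.mul_top (by simpa using hz)]
      exact le_top

/-- The gauge of an operator: a version of the `i`-th seminorm that is contractive under
multiplication by contractions, with the value `∞` outside the ideal. -/
def gauge (i : ℕ) (b : H →L[ℂ] H) : ℝ≥0∞ :=
  ⨆ (x : H →L[ℂ] H) (y : H →L[ℂ] H) (_ : ‖x‖ ≤ 1) (_ : ‖y‖ ≤ 1), K.eseminorm i (x * b * y)

theorem eseminorm_le_gauge (i : ℕ) (b : H →L[ℂ] H) {x y : H →L[ℂ] H} (hx : ‖x‖ ≤ 1)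
    (hy : ‖y‖ ≤ 1) : K.eseminorm i (x * b * y) ≤ K.gauge i b :=
  le_iSup₂_of_le x y (le_iSup₂_of_le hx hy le_rfl)

theorem gauge_le {i : ℕ} {b : H →L[ℂ] H} {C : ℝ≥0∞}
    (h : ∀ x y : H →L[ℂ] H, ‖x‖ ≤ 1 → ‖y‖ ≤ 1 → K.eseminorm i (x * b * y) ≤ C) :
    K.gauge i b ≤ C :=
  iSup₂_le fun x y => iSup₂_le fun hx hy => h x y hx hy

theorem norm_one_le : ‖(1 : H →L[ℂ] H)‖ ≤ 1 := ContinuousLinearMap.norm_id_le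

theorem mem_of_gauge_ne_top {i : ℕ} {b : H →L[ℂ] H} (h : K.gauge i b ≠ ⊤) : b ∈ K.carrier := by
  refine K.mem_of_eseminorm_ne_top (i := i) (ne_top_of_le_ne_top h ?_)
  simpa using K.eseminorm_le_gauge i b norm_one_le norm_one_le

/-- Continuity of the two-sided multiplication bounds the supremum over contractions by one of the
defining seminorms. -/
theorem gauge_ne_top (i : ℕ) {b : H →L[ℂ] H} (h : b ∈ K.carrier) : K.gauge i b ≠ ⊤ := by
  obtain ⟨j, C, hC⟩ := K.mul_le i
  refine ne_top_of_le_ne_top (b := ENNReal.ofReal (|C| * K.p j ⟨b, h⟩)) ENNReal.ofReal_ne_top ?_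
  refine K.gauge_le fun x y hx hy => ?_
  rw [K.eseminorm_of_mem i (K.mul_mem x b y h)]
  refine ENNReal.ofReal_le_ofReal ((hC x y ⟨b, h⟩).trans ?_)
  have hp : 0 ≤ K.p j ⟨b, h⟩ := apply_nonneg _ _
  calc C * ‖x‖ * K.p j ⟨b, h⟩ * ‖y‖ ≤ |C| * 1 * K.p j ⟨b, h⟩ * 1 := by
        gcongr
        exact le_abs_self C
    _ = _ := by ring

theorem gauge_add_le (i : ℕ) (b c : H →L[ℂ] H) :
    K.gauge i (b + c) ≤ K.gauge i b + K.gauge i c := by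
  refine K.gauge_le fun x y hx hy => ?_
  rw [mul_add, add_mul]
  exact (K.eseminorm_add_le i _ _).trans
    (add_le_add (K.eseminorm_le_gauge i b hx hy) (K.eseminorm_le_gauge i c hx hy))

theorem gauge_smul_le (i : ℕ) (z : ℂ) (b : H →L[ℂ] H) :
    K.gauge i (z • b) ≤ ‖z‖ₑ * K.gauge i b := by
  refine K.gauge_le fun x y hx hy => ?_
  rw [mul_smul_comm, smul_mul_assoc]
  exact (K.eseminorm_smul_le i _ _).trans (by gcongr; exact K.eseminorm_le_gauge i b hx hy)

theorem gauge_zero (i : ℕ) : K.gauge i 0 = 0 :=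
  le_antisymm (K.gauge_le fun x y _ _ => by simp [eseminorm_zero]) bot_le

theorem gauge_neg_le (i : ℕ) (b : H →L[ℂ] H) : K.gauge i (-b) ≤ K.gauge i b := by
  simpa using K.gauge_smul_le i (-1) b

theorem gauge_sub_le (i : ℕ) (b c : H →L[ℂ] H) :
    K.gauge i (b - c) ≤ K.gauge i b + K.gauge i c := by
  rw [sub_eq_add_neg]
  exact (K.gauge_add_le i _ _).trans (by gcongr; exact K.gauge_neg_le i c)

theorem gauge_mul_mul_le_of_norm_le_one (i : ℕ) (b : H →L[ℂ] H) {x y : H →L[ℂ] H} (hx : ‖x‖ ≤ 1)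
    (hy : ‖y‖ ≤ 1) : K.gauge i (x * b * y) ≤ K.gauge i b := by
  refine K.gauge_le fun x' y' hx' hy' => ?_
  have : x' * (x * b * y) * y' = (x' * x) * b * (y * y') := by simp only [mul_assoc]
  rw [this]
  exact K.eseminorm_le_gauge i b ((norm_mul_le _ _).trans (mul_le_one₀ hx' (norm_nonneg _) hx))
    ((norm_mul_le _ _).trans (mul_le_one₀ hy (norm_nonneg _) hy'))

theorem gauge_mul_mul_le (i : ℕ) (x b y : H →L[ℂ] H) :
    K.gauge i (x * b * y) ≤ ‖x‖ₑ * K.gauge i b * ‖y‖ₑ := by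
  have key : ∀ z : H →L[ℂ] H, ∃ w : H →L[ℂ] H, ‖w‖ ≤ 1 ∧ z = ((‖z‖ : ℝ) : ℂ) • w := by
    intro z
    rcases eq_or_ne z 0 with rfl | hz
    · exact ⟨0, by simp, by simp⟩
    · have hz' : ‖z‖ ≠ 0 := norm_ne_zero_iff.2 hz
      refine ⟨((‖z‖ : ℝ) : ℂ)⁻¹ • z, ?_, ?_⟩
      · rw [norm_smul, norm_inv, Complex.norm_real, norm_norm, inv_mul_cancel₀ hz']
      · rw [smul_smul, mul_inv_cancel₀ (by exact_mod_cast hz'), one_smul]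
  obtain ⟨u, hu, hxu⟩ := key x
  obtain ⟨v, hv, hyv⟩ := key y
  have h1 : x * b * y = ((‖x‖ : ℝ) : ℂ) • (((‖y‖ : ℝ) : ℂ) • (u * b * v)) := by
    conv_lhs => rw [hxu, hyv]
    rw [smul_mul_assoc, smul_mul_assoc, mul_smul_comm]
  have h2 : ∀ z : H →L[ℂ] H, ‖((‖z‖ : ℝ) : ℂ)‖ₑ = ‖z‖ₑ := fun z => by
    rw [← ofReal_norm, ← ofReal_norm, Complex.norm_real, norm_norm]
  rw [h1]
  refine (K.gauge_smul_le i _ _).trans ?_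
  rw [h2, mul_assoc ‖x‖ₑ, mul_comm (K.gauge i b)]
  gcongr
  refine (K.gauge_smul_le i _ _).trans ?_
  rw [h2]
  gcongr
  exact K.gauge_mul_mul_le_of_norm_le_one i b hu hv

theorem gauge_mul_right_le (i : ℕ) (b y : H →L[ℂ] H) :
    K.gauge i (b * y) ≤ K.gauge i b * ‖y‖ₑ := by
  have := K.gauge_mul_mul_le i 1 b y
  rw [one_mul] at this
  refine this.trans ?_
  gcongr
  have h1 : ‖(1 : H →L[ℂ] H)‖ₑ ≤ 1 := by
    rw [← ofReal_norm, ← ENNReal.ofReal_one]; exact ENNReal.ofReal_le_ofReal norm_one_le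
  calc _ ≤ 1 * K.gauge i b := by gcongr
    _ = _ := one_mul _

theorem gauge_mul_left_le (i : ℕ) (x b : H →L[ℂ] H) :
    K.gauge i (x * b) ≤ ‖x‖ₑ * K.gauge i b := by
  have := K.gauge_mul_mul_le i x b 1
  rw [mul_one] at this
  refine this.trans ?_
  have h1 : ‖(1 : H →L[ℂ] H)‖ₑ ≤ 1 := by
    rw [← ofReal_norm, ← ENNReal.ofReal_one]; exact ENNReal.ofReal_le_ofReal norm_one_le
  calc _ ≤ ‖x‖ₑ * K.gauge i b * 1 := by gcongr
    _ = _ := mul_one _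

/-- By Douglas' lemma the smaller operator is `c * b * star c` with a contraction `c`. This is what
the supremum over contractions on both sides is for: the original seminorms need not be monotone. -/
theorem gauge_mono {a b : H →L[ℂ] H} (i : ℕ) (ha : 0 ≤ a) (hab : a ≤ b) :
    K.gauge i a ≤ K.gauge i b := by
  obtain ⟨c, hc, rfl⟩ := exists_contraction_mul_mul_star ha hab
  exact K.gauge_mul_mul_le_of_norm_le_one i b hc (by rwa [norm_star])

/-- Completeness of the ideal: an absolutely convergent series converges in the ideal. -/
theorem eseminorm_le_tsum {b : ℕ → H →L[ℂ] H} {B : H →L[ℂ] H}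
    (hs : ∀ j, ∑' m, K.eseminorm j (b m) ≠ ⊤)
    (hB : Tendsto (fun N => ∑ m ∈ Finset.range N, b m) atTop (𝓝 B)) (i : ℕ) :
    K.eseminorm i B ≤ ∑' m, K.eseminorm i (b m) := by
  have hmem : ∀ m, b m ∈ K.carrier := fun m =>
    K.mem_of_eseminorm_ne_top (ENNReal.ne_top_of_tsum_ne_top (hs 0) m)
  set c : ℕ → K.carrier := fun m => ⟨b m, hmem m⟩ with hc
  have hce : ∀ j m, K.eseminorm j (b m) = ENNReal.ofReal (K.p j (c m)) := fun j m =>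
    K.eseminorm_of_mem j (hmem m)
  have hsum : ∀ j, Summable fun m => K.p j (c m) := by
    intro j
    have h1 := hs j
    simp only [hce] at h1
    have := ENNReal.summable_toReal h1
    refine this.congr fun m => ENNReal.toReal_ofReal (apply_nonneg _ _)
  have hsumle : ∀ j (s : Finset ℕ), K.p j (∑ m ∈ s, c m) ≤ ∑ m ∈ s, K.p j (c m) := fun j s =>
    Finset.le_sum_of_subadditive (K.p j) (map_zero _).le (map_add_le_add _) s c
  set u : ℕ → K.carrier := fun N => ∑ m ∈ Finset.range N, c m with hu
  -- Completeness asks for the Cauchy property in every seminorm at once; hence the hypothesis on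
  -- all `j`, although the conclusion concerns a single `i`.
  have hcauchy : ∀ j : ℕ, ∀ δ > 0, ∃ N : ℕ, ∀ s ≥ N, ∀ t ≥ N, K.p j (u s - u t) < δ := by
    intro j δ hδ
    have hcs := (hsum j).hasSum.tendsto_sum_nat.cauchySeq
    obtain ⟨N, hN⟩ := Metric.cauchySeq_iff.1 hcs δ hδ
    have aux : ∀ s t, N ≤ t → t ≤ s → K.p j (u s - u t) < δ := by
      intro s t ht hts
      have h1 : u s - u t = ∑ m ∈ Finset.Ico t s, c m := by
        rw [Finset.sum_Ico_eq_sub _ hts]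
      rw [h1]
      refine (hsumle j _).trans_lt ?_
      rw [Finset.sum_Ico_eq_sub _ hts]
      exact (le_abs_self _).trans_lt (hN s (ht.trans hts) t ht)
    refine ⟨N, fun s hs' t ht => ?_⟩
    rcases le_total t s with h | h
    · exact aux s t ht h
    · rw [map_sub_rev]; exact aux t s hs' h
  obtain ⟨a, ha⟩ := K.complete u hcauchy
  obtain ⟨i₀, C, hC⟩ := K.norm_le
  -- The topology of the ideal is finer than that of the operator norm, so the limit in the ideal is
  -- the norm limit.
  have haB : (a : H →L[ℂ] H) = B := by
    refine tendsto_nhds_unique (f := fun N => ((u N : K.carrier) : H →L[ℂ] H)) (l := atTop) ?_ ?_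
    · rw [tendsto_iff_norm_sub_tendsto_zero]
      refine squeeze_zero (fun _ => norm_nonneg _) (fun N => hC (u N - a)) ?_
      simpa using (ha i₀).const_mul C
    · refine hB.congr fun N => ?_
      simp [hu, hc]
  have hBmem : B ∈ K.carrier := haB ▸ a.2
  rw [K.eseminorm_of_mem i hBmem]
  have haB' : (⟨B, hBmem⟩ : K.carrier) = a := Subtype.ext haB.symm
  rw [haB']
  simp only [hce]
  rw [← ENNReal.ofReal_tsum_of_nonneg (fun _ => apply_nonneg _ _) (hsum i)]
  refine ENNReal.ofReal_le_ofReal ?_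
  have h2 : ∀ N, K.p i a ≤ (∑' m, K.p i (c m)) + K.p i (u N - a) := by
    intro N
    have h3 : K.p i a ≤ K.p i (u N) + K.p i (u N - a) := by
      have h4 : a = u N - (u N - a) := by abel
      calc K.p i a = K.p i (u N - (u N - a)) := by rw [← h4]
        _ ≤ _ := map_sub_le_add _ _ _
    exact h3.trans (by
      gcongr
      exact (hsumle i _).trans ((hsum i).sum_le_tsum _ fun _ _ => apply_nonneg _ _))
  have h5 := (ha i).const_add (∑' m, K.p i (c m))
  rw [add_zero] at h5
  exact ge_of_tendsto' h5 h2

theorem gauge_le_tsum {b : ℕ → H →L[ℂ] H} {B : H →L[ℂ] H}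
    (hs : ∀ j, ∑' m, K.gauge j (b m) ≠ ⊤)
    (hB : Tendsto (fun N => ∑ m ∈ Finset.range N, b m) atTop (𝓝 B)) (i : ℕ) :
    K.gauge i B ≤ ∑' m, K.gauge i (b m) := by
  refine K.gauge_le fun x y hx hy => ?_
  have hle : ∀ j m, K.eseminorm j (x * b m * y) ≤ K.gauge j (b m) := fun j m =>
    K.eseminorm_le_gauge j (b m) hx hy
  refine (K.eseminorm_le_tsum (b := fun m => x * b m * y) (fun j => ?_) ?_ i).trans
    (ENNReal.tsum_le_tsum (hle i))
  · exact ne_top_of_le_ne_top (hs j) (ENNReal.tsum_le_tsum (hle j))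
  · have := (hB.const_mul x).mul_const y
    refine this.congr fun N => ?_
    rw [Finset.mul_sum, Finset.sum_mul]

end FrechetOperatorIdeal

/-! ### The square root of the ideal: triangle and Cauchy–Schwarz inequalities -/

namespace FrechetOperatorIdeal

variable {H : Type*} [NormedAddCommGroup H] [InnerProductSpace ℂ H] [CompleteSpace H]
variable {E : Type*} [NormedAddCommGroup E] [InnerProductSpace ℂ E] [CompleteSpace E]
variable (K : FrechetOperatorIdeal H)

/-- The `i`-th seminorm of an operator `ξ` whose square `ξ† ξ` is measured in the ideal. -/
def rootGauge (i : ℕ) (ξ : H →L[ℂ] E) : ℝ≥0∞ := K.gauge i (ξ.adjoint ∘L ξ) ^ (1 / 2 : ℝ)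

theorem rootGauge_sq (i : ℕ) (ξ : H →L[ℂ] E) :
    K.rootGauge i ξ ^ 2 = K.gauge i (ξ.adjoint ∘L ξ) := by
  rw [rootGauge, ← ENNReal.rpow_natCast, ← ENNReal.rpow_mul]
  norm_num

theorem rootGauge_le_iff {i : ℕ} {ξ : H →L[ℂ] E} {S : ℝ≥0∞} :
    K.rootGauge i ξ ≤ S ↔ K.gauge i (ξ.adjoint ∘L ξ) ≤ S ^ 2 := by
  rw [← rootGauge_sq]
  exact (ENNReal.pow_le_pow_left_iff two_ne_zero).symm

theorem rootGauge_ne_top_iff {i : ℕ} {ξ : H →L[ℂ] E} :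
    K.rootGauge i ξ ≠ ⊤ ↔ ξ.adjoint ∘L ξ ∈ K.carrier := by
  constructor
  · intro h
    refine K.mem_of_gauge_ne_top (i := i) ?_
    rw [← rootGauge_sq]
    exact ENNReal.pow_ne_top h
  · intro h h'
    have := K.rootGauge_sq i ξ
    rw [h'] at this
    exact K.gauge_ne_top i h (by rw [← this]; simp)

theorem rootGauge_le_of_le {E' : Type*} [NormedAddCommGroup E'] [InnerProductSpace ℂ E']
    [CompleteSpace E'] (i : ℕ) {ξ : H →L[ℂ] E} {η : H →L[ℂ] E'} {c : ℝ} (hc : 0 ≤ c)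
    (h : ξ.adjoint ∘L ξ ≤ ((c ^ 2 : ℝ) : ℂ) • (η.adjoint ∘L η)) :
    K.rootGauge i ξ ≤ ENNReal.ofReal c * K.rootGauge i η := by
  rw [rootGauge_le_iff, mul_pow, rootGauge_sq, ← ENNReal.ofReal_pow hc]
  refine (K.gauge_mono i ((ContinuousLinearMap.nonneg_iff_isPositive _).2
    (ContinuousLinearMap.isPositive_adjoint_comp_self ξ)) h).trans ?_
  refine (K.gauge_smul_le i _ _).trans (le_of_eq ?_)
  rw [← ofReal_norm, Complex.norm_real, Real.norm_of_nonneg (sq_nonneg c)]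

theorem rootGauge_smul_le (i : ℕ) (z : ℂ) (ξ : H →L[ℂ] E) :
    K.rootGauge i (z • ξ) ≤ ‖z‖ₑ * K.rootGauge i ξ := by
  rw [← ofReal_norm]
  refine K.rootGauge_le_of_le i (norm_nonneg z) (le_of_eq ?_)
  rw [map_smulₛₗ, ContinuousLinearMap.smul_comp, ContinuousLinearMap.comp_smul, smul_smul]
  congr 1
  rw [mul_comm, starRingEnd_apply, ← starRingEnd_apply, Complex.mul_conj, Complex.normSq_eq_norm_sq]

theorem rootGauge_comp_le (i : ℕ) (ξ : H →L[ℂ] E) (y : H →L[ℂ] H) :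
    K.rootGauge i (ξ ∘L y) ≤ K.rootGauge i ξ * ‖y‖ₑ := by
  rw [rootGauge_le_iff, mul_pow, rootGauge_sq]
  have : (ξ ∘L y).adjoint ∘L (ξ ∘L y) = y.adjoint * (ξ.adjoint ∘L ξ) * y := by
    rw [ContinuousLinearMap.adjoint_comp]
    rfl
  rw [this]
  refine (K.gauge_mul_mul_le i _ _ _).trans (le_of_eq ?_)
  have h : ‖y.adjoint‖ₑ = ‖y‖ₑ := by
    rw [← ofReal_norm, ← ofReal_norm, LinearIsometryEquiv.norm_map]
  rw [h]
  ring

/-- Convexity of the square: `(S + T) (S u†u + T v†v) - (S u + T v)† (S u + T v) = S T (u - v)† (u -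
v)` is positive, and the gauge is monotone. This is the triangle inequality for vectors `S u`, `T v`
with normalized `u`, `v`. -/
theorem gauge_real_smul_add_le (i : ℕ) {u v : H →L[ℂ] E} (hu : K.gauge i (u.adjoint ∘L u) ≤ 1)
    (hv : K.gauge i (v.adjoint ∘L v) ≤ 1) {S T : ℝ} (hS : 0 ≤ S) (hT : 0 ≤ T) :
    K.rootGauge i ((S : ℂ) • u + (T : ℂ) • v) ≤ ENNReal.ofReal (S + T) := by
  rw [rootGauge_le_iff, ← ENNReal.ofReal_pow (by positivity)]
  have hle : ((S : ℂ) • u + (T : ℂ) • v).adjoint ∘L ((S : ℂ) • u + (T : ℂ) • v) ≤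
      (((S + T) * S : ℝ) : ℂ) • (u.adjoint ∘L u) + (((S + T) * T : ℝ) : ℂ) • (v.adjoint ∘L v) := by
    rw [← sub_nonneg]
    have h1 : (((S + T) * S : ℝ) : ℂ) • (u.adjoint ∘L u) +
        (((S + T) * T : ℝ) : ℂ) • (v.adjoint ∘L v) -
        ((S : ℂ) • u + (T : ℂ) • v).adjoint ∘L ((S : ℂ) • u + (T : ℂ) • v) =
        ((S * T : ℝ) : ℂ) • ((u - v).adjoint ∘L (u - v)) := by
      simp only [map_add, map_smulₛₗ, map_sub, ContinuousLinearMap.add_comp,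
        ContinuousLinearMap.comp_add, ContinuousLinearMap.smul_comp, ContinuousLinearMap.comp_smul,
        ContinuousLinearMap.sub_comp, ContinuousLinearMap.comp_sub, Complex.conj_ofReal]
      push_cast
      module
    rw [h1]
    have h2 : (0 : H →L[ℂ] H) ≤ (u - v).adjoint ∘L (u - v) :=
      (ContinuousLinearMap.nonneg_iff_isPositive _).2
        (ContinuousLinearMap.isPositive_adjoint_comp_self (u - v))
    exact smul_nonneg (by exact_mod_cast mul_nonneg hS hT) h2
  refine (K.gauge_mono i ((ContinuousLinearMap.nonneg_iff_isPositive _).2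
    (ContinuousLinearMap.isPositive_adjoint_comp_self _)) hle).trans ?_
  have hn : ∀ {r : ℝ}, 0 ≤ r → ‖(r : ℂ)‖ₑ = ENNReal.ofReal r := fun hr => by
    rw [← ofReal_norm, Complex.norm_real, Real.norm_of_nonneg hr]
  calc _ ≤ _ := K.gauge_add_le i _ _
    _ ≤ ENNReal.ofReal ((S + T) * S) * 1 + ENNReal.ofReal ((S + T) * T) * 1 := by
        refine add_le_add ((K.gauge_smul_le i _ _).trans ?_) ((K.gauge_smul_le i _ _).trans ?_)
        · rw [hn (by positivity)]; gcongr
        · rw [hn (by positivity)]; gcongr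
    _ = _ := by
        rw [mul_one, mul_one, ← ENNReal.ofReal_add (by positivity) (by positivity)]
        congr 1; ring

/-- The margin `δ` allows division when the gauge vanishes; it is sent to zero where the lemma is
used. -/
theorem exists_normalized {i : ℕ} {ξ : H →L[ℂ] E} (h : K.rootGauge i ξ ≠ ⊤) {δ : ℝ} (hδ : 0 < δ) :
    ∃ u : H →L[ℂ] E, K.gauge i (u.adjoint ∘L u) ≤ 1 ∧
      ξ = (((K.rootGauge i ξ).toReal + δ : ℝ) : ℂ) • u := by
  set S : ℝ := (K.rootGauge i ξ).toReal + δ with hS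
  have hSpos : 0 < S := by positivity
  have hSc : (S : ℂ) ≠ 0 := by exact_mod_cast hSpos.ne'
  refine ⟨(S : ℂ)⁻¹ • ξ, ?_, by rw [smul_smul, mul_inv_cancel₀ hSc, one_smul]⟩
  have h1 : K.rootGauge i ((S : ℂ)⁻¹ • ξ) ≤ 1 := by
    refine (K.rootGauge_smul_le i _ _).trans ?_
    rw [← ENNReal.ofReal_toReal h, ← ofReal_norm, norm_inv, Complex.norm_real,
      Real.norm_of_nonneg hSpos.le, ← ENNReal.ofReal_mul (by positivity), ← ENNReal.ofReal_one]
    refine ENNReal.ofReal_le_ofReal ?_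
    rw [inv_mul_le_iff₀ hSpos]
    linarith
  simpa using K.rootGauge_le_iff.1 h1

theorem rootGauge_add_le (i : ℕ) (ξ η : H →L[ℂ] E) :
    K.rootGauge i (ξ + η) ≤ K.rootGauge i ξ + K.rootGauge i η := by
  by_cases hξ : K.rootGauge i ξ = ⊤
  · simp [hξ]
  by_cases hη : K.rootGauge i η = ⊤
  · simp [hη]
  set x := (K.rootGauge i ξ).toReal
  set y := (K.rootGauge i η).toReal
  have key : ∀ δ > (0 : ℝ), K.rootGauge i (ξ + η) ≤ ENNReal.ofReal ((x + δ) + (y + δ)) := by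
    intro δ hδ
    obtain ⟨u, hu, hξu⟩ := K.exists_normalized hξ hδ
    obtain ⟨v, hv, hηv⟩ := K.exists_normalized hη hδ
    conv_lhs => rw [hξu, hηv]
    exact K.gauge_real_smul_add_le i hu hv (by positivity) (by positivity)
  have hlim : Tendsto (fun δ : ℝ => ENNReal.ofReal ((x + δ) + (y + δ))) (𝓝[>] 0)
      (𝓝 (ENNReal.ofReal ((x + 0) + (y + 0)))) :=
    (ENNReal.continuous_ofReal.comp (by fun_prop : Continuous fun δ : ℝ => (x + δ) + (y + δ))
      ).continuousAt.tendsto.mono_left nhdsWithin_le_nhds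
  have := ge_of_tendsto hlim (eventually_mem_nhdsWithin.mono fun δ hδ => key δ hδ)
  rwa [add_zero, add_zero, ENNReal.ofReal_add (by positivity) (by positivity),
    ENNReal.ofReal_toReal hξ, ENNReal.ofReal_toReal hη] at this

/-- Polarization: `u†v` is a sum of four squares `(u + z v)† (u + z v)` with coefficients of modulus
`1/4`. Each square has gauge at most `(1 + 1)² = 4`, so each summand contributes at most `1`. -/
theorem gauge_adjoint_comp_le_of_normalized (i : ℕ) {u v : H →L[ℂ] E}
    (hu : K.gauge i (u.adjoint ∘L u) ≤ 1) (hv : K.gauge i (v.adjoint ∘L v) ≤ 1) :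
    K.gauge i (u.adjoint ∘L v) ≤ 4 := by
  have hz : ∀ z : ℂ, ‖z‖ = 1 →
      K.gauge i ((u + z • v).adjoint ∘L (u + z • v)) ≤ 4 := by
    intro z hz
    rw [← rootGauge_sq]
    have h2 : ∀ {w : H →L[ℂ] E}, K.gauge i (w.adjoint ∘L w) ≤ 1 → K.rootGauge i w ≤ 1 :=
      fun h => K.rootGauge_le_iff.2 (by simpa using h)
    have h1 : K.rootGauge i (u + z • v) ≤ 1 + 1 := by
      refine (K.rootGauge_add_le i _ _).trans (add_le_add (h2 hu) ?_)
      refine (K.rootGauge_smul_le i _ _).trans ?_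
      rw [← ofReal_norm, hz, ENNReal.ofReal_one, one_mul]
      exact h2 hv
    calc _ ≤ (1 + 1 : ℝ≥0∞) ^ 2 := by gcongr
      _ = 4 := by norm_num
  have hpol : u.adjoint ∘L v = (1 / 4 : ℂ) •
      ((u + (1 : ℂ) • v).adjoint ∘L (u + (1 : ℂ) • v)) +
      ((-1 / 4 : ℂ) • ((u + (-1 : ℂ) • v).adjoint ∘L (u + (-1 : ℂ) • v)) +
      ((-Complex.I / 4 : ℂ) • ((u + Complex.I • v).adjoint ∘L (u + Complex.I • v)) +
      (Complex.I / 4 : ℂ) • ((u + (-Complex.I) • v).adjoint ∘L (u + (-Complex.I) • v)))) := by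
    simp only [map_add, map_smulₛₗ, ContinuousLinearMap.add_comp,
        ContinuousLinearMap.comp_add, ContinuousLinearMap.smul_comp, ContinuousLinearMap.comp_smul,
        map_one, map_neg, Complex.conj_I, smul_add, smul_smul]
    have hI : Complex.I * Complex.I = -1 := Complex.I_mul_I
    match_scalars <;> ring_nf <;> simp [Complex.I_sq] <;> norm_num
  have hq : ∀ c : ℂ, ‖c‖ = 1 / 4 → ∀ z : ℂ, ‖z‖ = 1 →
      K.gauge i (c • ((u + z • v).adjoint ∘L (u + z • v))) ≤ 1 := by
    intro c hc z hz'
    refine (K.gauge_smul_le i _ _).trans ?_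
    rw [← ofReal_norm, hc]
    calc _ ≤ ENNReal.ofReal (1 / 4) * ENNReal.ofReal 4 := by
          gcongr
          exact (hz z hz').trans (by simp)
      _ = 1 := by rw [← ENNReal.ofReal_mul (by norm_num)]; norm_num
  rw [hpol]
  calc _ ≤ (1 : ℝ≥0∞) + (1 + (1 + 1)) := by
        refine (K.gauge_add_le i _ _).trans (add_le_add (hq _ (by norm_num) _ (by simp)) ?_)
        refine (K.gauge_add_le i _ _).trans (add_le_add (hq _ (by norm_num) _ (by simp)) ?_)
        exact (K.gauge_add_le i _ _).trans (add_le_add (hq _ (by simp) _ (by simp))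
          (hq _ (by simp) _ (by simp)))
    _ = 4 := by norm_num

theorem gauge_adjoint_comp_le {i : ℕ} {ξ η : H →L[ℂ] E} (hξ : K.rootGauge i ξ ≠ ⊤)
    (hη : K.rootGauge i η ≠ ⊤) :
    K.gauge i (ξ.adjoint ∘L η) ≤ 4 * K.rootGauge i ξ * K.rootGauge i η := by
  set x := (K.rootGauge i ξ).toReal
  set y := (K.rootGauge i η).toReal
  have key : ∀ δ > (0 : ℝ), K.gauge i (ξ.adjoint ∘L η) ≤ ENNReal.ofReal ((x + δ) * (y + δ) * 4) := by
    intro δ hδ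
    obtain ⟨u, hu, hξu⟩ := K.exists_normalized hξ hδ
    obtain ⟨v, hv, hηv⟩ := K.exists_normalized hη hδ
    conv_lhs => rw [hξu, hηv]
    rw [map_smulₛₗ, ContinuousLinearMap.smul_comp, ContinuousLinearMap.comp_smul, smul_smul,
      Complex.conj_ofReal, ← Complex.ofReal_mul]
    refine (K.gauge_smul_le i _ _).trans ?_
    rw [← ofReal_norm, Complex.norm_real, Real.norm_of_nonneg (by positivity),
      ENNReal.ofReal_mul (p := _ * _) (by positivity)]
    gcongr
    exact (K.gauge_adjoint_comp_le_of_normalized i hu hv).trans (by simp)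
  have hlim : Tendsto (fun δ : ℝ => ENNReal.ofReal ((x + δ) * (y + δ) * 4)) (𝓝[>] 0)
      (𝓝 (ENNReal.ofReal ((x + 0) * (y + 0) * 4))) :=
    (ENNReal.continuous_ofReal.comp (by fun_prop : Continuous fun δ : ℝ => (x + δ) * (y + δ) * 4)
      ).continuousAt.tendsto.mono_left nhdsWithin_le_nhds
  have := ge_of_tendsto hlim (eventually_mem_nhdsWithin.mono fun δ hδ => key δ hδ)
  rw [add_zero, add_zero, ENNReal.ofReal_mul (by positivity), ENNReal.ofReal_mul (by positivity),
    ENNReal.ofReal_toReal hξ, ENNReal.ofReal_toReal hη] at this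
  refine this.trans (le_of_eq ?_)
  rw [show ENNReal.ofReal 4 = 4 by simp]
  ring

theorem rootGauge_sum_le (i : ℕ) (ξ : ℕ → H →L[ℂ] E) (s : Finset ℕ) :
    K.rootGauge i (∑ m ∈ s, ξ m) ≤ ∑ m ∈ s, K.rootGauge i (ξ m) := by
  refine Finset.le_sum_of_subadditive _ ?_ (K.rootGauge_add_le i) s ξ
  rw [rootGauge_le_iff]
  simp [gauge_zero]

/-- Completeness of the ideal applies to the squares of the partial sums `ζ`, written as telescoping
sums. With `S = ∑ rootGauge (ξ m)`, the increment `(ξ m)† ζ (m + 1) + (ζ m)† ξ m` has gauge at most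
`8 S * rootGauge (ξ m)` by Cauchy–Schwarz; the total `8 S²` is at most `(3 S)²`. -/
theorem rootGauge_le_tsum {ξ : ℕ → H →L[ℂ] E} {Ξ : H →L[ℂ] E}
    (hs : ∀ j, ∑' m, K.rootGauge j (ξ m) ≠ ⊤)
    (hΞ : Tendsto (fun N => ∑ m ∈ Finset.range N, ξ m) atTop (𝓝 Ξ)) (i : ℕ) :
    K.rootGauge i Ξ ≤ 3 * ∑' m, K.rootGauge i (ξ m) := by
  set ζ : ℕ → H →L[ℂ] E := fun N => ∑ m ∈ Finset.range N, ξ m with hζ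
  have hξ : ∀ j m, K.rootGauge j (ξ m) ≠ ⊤ := fun j m => ENNReal.ne_top_of_tsum_ne_top (hs j) m
  have hζle : ∀ j N, K.rootGauge j (ζ N) ≤ ∑' m, K.rootGauge j (ξ m) := fun j N =>
    (K.rootGauge_sum_le j ξ _).trans (ENNReal.sum_le_tsum _)
  have hζt : ∀ j N, K.rootGauge j (ζ N) ≠ ⊤ := fun j N => ne_top_of_le_ne_top (hs j) (hζle j N)
  set b : ℕ → H →L[ℂ] H := fun m =>
    (ζ (m + 1)).adjoint ∘L ζ (m + 1) - (ζ m).adjoint ∘L ζ m with hb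
  have hble : ∀ j m, K.gauge j (b m) ≤
      8 * (∑' m, K.rootGauge j (ξ m)) * K.rootGauge j (ξ m) := by
    intro j m
    have h1 : b m = (ξ m).adjoint ∘L ζ (m + 1) + (ζ m).adjoint ∘L ξ m := by
      simp only [hb]
      have : ζ (m + 1) = ζ m + ξ m := Finset.sum_range_succ _ _
      rw [this]
      simp only [map_add, ContinuousLinearMap.add_comp, ContinuousLinearMap.comp_add]
      abel
    rw [h1]
    refine (K.gauge_add_le j _ _).trans ((add_le_add (K.gauge_adjoint_comp_le (hξ j m) (hζt j _))
      (K.gauge_adjoint_comp_le (hζt j m) (hξ j m))).trans ?_)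
    calc _ ≤ 4 * K.rootGauge j (ξ m) * (∑' m, K.rootGauge j (ξ m)) +
          4 * (∑' m, K.rootGauge j (ξ m)) * K.rootGauge j (ξ m) := by
          gcongr
          · exact hζle j _
          · exact hζle j _
      _ = _ := by ring
  have hbsum : ∀ j, ∑' m, K.gauge j (b m) ≤ 8 * (∑' m, K.rootGauge j (ξ m)) ^ 2 := by
    intro j
    refine (ENNReal.tsum_le_tsum (hble j)).trans (le_of_eq ?_)
    rw [ENNReal.tsum_mul_left]
    ring
  have hlim : Tendsto (fun N => ∑ m ∈ Finset.range N, b m) atTop (𝓝 (Ξ.adjoint ∘L Ξ)) := by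
    have h1 : ∀ N, ∑ m ∈ Finset.range N, b m = (ζ N).adjoint ∘L ζ N := by
      intro N
      rw [Finset.sum_range_sub (fun m => (ζ m).adjoint ∘L ζ m)]
      simp [hζ]
    simp_rw [h1]
    have h2 : Continuous fun w : H →L[ℂ] E => w.adjoint ∘L w :=
      (ContinuousLinearMap.adjoint.continuous).clm_comp continuous_id
    exact (h2.tendsto Ξ).comp hΞ
  rw [rootGauge_le_iff]
  refine (K.gauge_le_tsum (fun j => ?_) hlim i).trans ((hbsum i).trans ?_)
  · exact ne_top_of_le_ne_top (ENNReal.mul_ne_top (by simp) (ENNReal.pow_ne_top (hs j))) (hbsum j)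
  · rw [mul_pow]
    gcongr
    norm_num

end FrechetOperatorIdeal

/-! ### Kolmogorov decomposition of completely positive maps -/

section Kolmogorov

/-- Positive matrices are generated by the products `star Q * Q`, for which the form is a sum of
squares `star (Q y)_k * (Q y)_k`. -/
theorem CStarMatrix.sum_star_mul_mul_nonneg {n : Type*} [Fintype n] {B : Type*} [CStarAlgebra B]
    [PartialOrder B] [StarOrderedRing B] {M : CStarMatrix n n B} (hM : 0 ≤ M) (y : n → B) :
    0 ≤ ∑ i, ∑ j, star (y i) * M i j * y j := by
  rw [StarOrderedRing.nonneg_iff] at hM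
  induction hM using AddSubmonoid.closure_induction with
  | zero => simp
  | add P Q _ _ hP hQ =>
    have h : ∑ i, ∑ j, star (y i) * (P + Q) i j * y j =
        ∑ i, ∑ j, star (y i) * P i j * y j + ∑ i, ∑ j, star (y i) * Q i j * y j := by
      simp_rw [← Finset.sum_add_distrib, CStarMatrix.add_apply, mul_add, add_mul]
    rw [h]
    exact add_nonneg hP hQ
  | mem P hP =>
    obtain ⟨Q, rfl⟩ := hP
    have h : ∑ i, ∑ j, star (y i) * (star Q * Q) i j * y j =
        ∑ k, star (∑ i, Q k i * y i) * ∑ j, Q k j * y j := by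
      have h1 : ∀ i j, (star Q * Q) i j = ∑ k, star (Q k i) * Q k j := fun i j => rfl
      simp_rw [h1, star_sum, Finset.sum_mul_sum, Finset.mul_sum, Finset.sum_mul, star_mul]
      conv_lhs => enter [2, i]; rw [Finset.sum_comm]
      rw [Finset.sum_comm]
      refine Finset.sum_congr rfl fun k _ => Finset.sum_congr rfl fun i _ =>
        Finset.sum_congr rfl fun j _ => ?_
      simp only [mul_assoc]
    rw [h]
    exact Finset.sum_nonneg fun k _ => star_mul_self_nonneg _

variable {A : Type*} [CStarAlgebra A] [PartialOrder A] [StarOrderedRing A]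

theorem CompletelyPositiveMap.sum_star_mul_mul_nonneg {B : Type*} [CStarAlgebra B]
    [PartialOrder B] [StarOrderedRing B] (φ : A →CP B) {n : Type*} [Fintype n]
    (a : n → A) (y : n → B) :
    0 ≤ ∑ i, ∑ j, star (y i) * φ (star (a i) * a j) * y j := by
  classical
  -- The matrix `star (a i) * a j` is `star N * N` for the row `a`. The extra index `none` makes
  -- room for this row in a square matrix, all of whose other rows vanish.
  let N : CStarMatrix (Option n) (Option n) A :=
    CStarMatrix.ofMatrix fun k l => if k = none then l.elim 0 a else 0
  have h1 := φ.map_cstarMatrix_nonneg (star N * N) (star_mul_self_nonneg N)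
  have h2 := CStarMatrix.sum_star_mul_mul_nonneg h1 (fun k => k.elim 0 y)
  have h3 : ∀ k l : n, (star N * N) (some k) (some l) = star (a k) * a l := by
    intro k l
    have : (star N * N) (some k) (some l) = ∑ m, star (N m (some k)) * N m (some l) := rfl
    rw [this, Fintype.sum_option]
    have hs : ∀ m l, N (some m) l = 0 := fun m l => rfl
    have hn : ∀ l, N none (some l) = a l := fun l => rfl
    simp [hs, hn]
  simpa [Fintype.sum_option, CStarMatrix.map_apply, h3] using h2

/-- The Kolmogorov decomposition of a completely positive map. -/
theorem CompletelyPositiveMap.exists_kolmogorov.{u, v} {A : Type u} [CStarAlgebra A] [PartialOrder A]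
    [StarOrderedRing A] {H : Type v} [NormedAddCommGroup H] [InnerProductSpace ℂ H] [CompleteSpace H] (φ : A →CP (H →L[ℂ] H)) :
    ∃ (E : Type (max u v)) (_ : NormedAddCommGroup E) (_ : InnerProductSpace ℂ E) (_ : CompleteSpace E)
      (V : A →ₗ[ℂ] H →L[ℂ] E), ∀ a b, (V a).adjoint ∘L V b = φ (star a * b) := by
  let k : Matrix A A (H →L[ℂ] H) := Matrix.of fun a b => φ (star a * b)
  have hk : k.PosSemidef := by
    refine ⟨?_, fun f => ?_⟩
    · ext1 a b
      change star (φ (star b * a)) = φ (star a * b)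
      rw [← map_star, star_mul, star_star]
    · have h := CompletelyPositiveMap.sum_star_mul_mul_nonneg φ
        (fun a : f.support => (a : A)) (fun a => f a)
      simp only [Finsupp.sum]
      rw [← Finset.sum_coe_sort f.support]
      simp_rw [← Finset.sum_coe_sort f.support]
      exact h
  have : Fact k.PosSemidef := ⟨hk⟩
  have hker : ∀ a b, (RKHS.kerFun (RKHS.OfKernel k) a).adjoint ∘L RKHS.kerFun (RKHS.OfKernel k) b =
      φ (star a * b) := fun a b => by
    rw [← RKHS.kernel_apply, RKHS.OfKernel.kernel_ofKernel]
    rfl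
  -- The kernel functions are merely indexed by `A`. They depend linearly on the index because the
  -- deviation `ξ` from linearity satisfies `ξ†ξ = 0`, a consequence of the linearity of `φ`.
  have hzero : ∀ ξ : H →L[ℂ] RKHS.OfKernel k, ξ.adjoint ∘L ξ = 0 → ξ = 0 := fun ξ h => by
    have := ContinuousLinearMap.norm_adjoint_comp_self ξ
    rw [h, norm_zero, eq_comm, mul_self_eq_zero, norm_eq_zero] at this
    exact this
  refine ⟨RKHS.OfKernel k, inferInstance, inferInstance, inferInstance,
    { toFun := RKHS.kerFun (RKHS.OfKernel k), map_add' := fun a b => ?_, map_smul' := fun z a => ?_ },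
    hker⟩
  · rw [← sub_eq_zero]
    apply hzero
    simp only [map_add, map_sub, ContinuousLinearMap.add_comp, ContinuousLinearMap.comp_add,
      ContinuousLinearMap.sub_comp, ContinuousLinearMap.comp_sub, hker, star_add, add_mul, mul_add]
    abel
  · rw [← sub_eq_zero]
    apply hzero
    simp only [map_sub, map_smulₛₗ, ContinuousLinearMap.smul_comp, ContinuousLinearMap.comp_smul,
      ContinuousLinearMap.sub_comp, ContinuousLinearMap.comp_sub, hker, star_smul, smul_mul_assoc,
      mul_smul_comm, RingHom.id_apply, starRingEnd_apply]
    module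

end Kolmogorov

/-! ### Membership modulo the ideal -/

namespace FrechetOperatorIdeal

variable {H : Type*} [NormedAddCommGroup H] [InnerProductSpace ℂ H] [CompleteSpace H]
variable {E : Type*} [NormedAddCommGroup E] [InnerProductSpace ℂ E] [CompleteSpace E]
variable (K : FrechetOperatorIdeal H)

/-- Calculus modulo a Fréchet operator ideal. -/
theorem exists_quotient_hom.{u} {H : Type u} [NormedAddCommGroup H] [InnerProductSpace ℂ H]
    [CompleteSpace H] (K : FrechetOperatorIdeal H) :
    ∃ (R : Type u) (_ : Ring R) (q : (H →L[ℂ] H) →+* R), ∀ x, q x = 0 ↔ x ∈ K.carrier := by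
  let I : TwoSidedIdeal (H →L[ℂ] H) := TwoSidedIdeal.mk' (K.carrier : Set (H →L[ℂ] H))
    K.carrier.zero_mem (fun h h' => K.carrier.add_mem h h') (fun h => K.carrier.neg_mem h)
    (fun {x y} h => by simpa using K.mul_mem x y 1 h)
    (fun {x y} h => by simpa using K.mul_mem 1 x y h)
  refine ⟨I.ringCon.Quotient, inferInstance, I.ringCon.mk', fun x => ?_⟩
  have h1 : I.ringCon.mk' x = 0 ↔ I.ringCon x 0 := by
    rw [← map_zero I.ringCon.mk']
    exact RingCon.eq I.ringCon
  rw [h1, ← TwoSidedIdeal.mem_iff]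
  exact TwoSidedIdeal.mem_mk' _ _ _ _ _ _ _

theorem adjoint_comp_mem {ξ η : H →L[ℂ] E} (hξ : ξ.adjoint ∘L ξ ∈ K.carrier)
    (hη : η.adjoint ∘L η ∈ K.carrier) : ξ.adjoint ∘L η ∈ K.carrier := by
  have h1 := (K.rootGauge_ne_top_iff (i := 0)).2 hξ
  have h2 := (K.rootGauge_ne_top_iff (i := 0)).2 hη
  exact K.mem_of_gauge_ne_top (i := 0) (ne_top_of_le_ne_top
    (ENNReal.mul_ne_top (ENNReal.mul_ne_top (by simp) h1) h2) (K.gauge_adjoint_comp_le h1 h2))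

theorem mem_of_nonneg_of_le {a b : H →L[ℂ] H} (ha : 0 ≤ a) (hab : a ≤ b) (hb : b ∈ K.carrier) :
    a ∈ K.carrier :=
  K.mem_of_gauge_ne_top (i := 0) (ne_top_of_le_ne_top (K.gauge_ne_top 0 hb) (K.gauge_mono 0 ha hab))

end FrechetOperatorIdeal

/-- A representation `π` with a projection `P`, and a dilation `V` of a positive map `φ`. -/
structure DilatedPair (A H E : Type*) [CStarAlgebra A] [NormedAddCommGroup H]
    [InnerProductSpace ℂ H] [CompleteSpace H] [NormedAddCommGroup E] [InnerProductSpace ℂ E]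
    [CompleteSpace E] where
  V : A →ₗ[ℂ] H →L[ℂ] E
  φ : A →ₗ[ℂ] H →L[ℂ] H
  adjoint_comp : ∀ a b, (V a).adjoint ∘L V b = φ (star a * b)
  π : A →⋆ₙₐ[ℂ] (H →L[ℂ] H)
  P : H →L[ℂ] H
  isStarProjection : IsStarProjection P

/-! ### Leibniz rules for commutators and defects -/

namespace DilatedPair

variable {A H E : Type*} [CStarAlgebra A] [NormedAddCommGroup H]
    [InnerProductSpace ℂ H] [CompleteSpace H] [NormedAddCommGroup E] [InnerProductSpace ℂ E]
    [CompleteSpace E] (D : DilatedPair A H E)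

theorem adjoint_P : D.P.adjoint = D.P := D.isStarProjection.isSelfAdjoint.star_eq

theorem P_mul_P : D.P * D.P = D.P := D.isStarProjection.isIdempotentElem

theorem adjoint_π (a : A) : (D.π a).adjoint = D.π (star a) := (map_star D.π a).symm

/-- The failure `V a P - V 1 P π(b)` with a left factor `c` applied through the dilation. -/
def intertwiner (c a : A) : H →L[ℂ] E := D.V (c * a) ∘L D.P - D.V c ∘L D.P ∘L D.π a

/-- The failure of the dilation to intertwine the representation on the range of the
projection. -/
abbrev commutator (a : A) : H →L[ℂ] E := D.intertwiner 1 a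

/-- The defect `P φ(a) P - π(a) P`. -/
def defect (a : A) : H →L[ℂ] H := D.P * D.φ a * D.P - D.π a * D.P

/-- A Leibniz rule: in a Stinespring picture with representation `ρ`, the first summand would be
`ρ(a) X(b)`. Only the order estimate `intertwiner_le` is needed of it, so no `ρ` is constructed. -/
theorem commutator_mul (a b : A) :
    D.commutator (a * b) = D.intertwiner a b + D.commutator a ∘L D.π b := by
  simp only [intertwiner, one_mul, ContinuousLinearMap.sub_comp, map_mul]
  rw [ContinuousLinearMap.mul_def]
  simp only [ContinuousLinearMap.comp_assoc]
  abel

/-- The point of the expansion is that `c` and `c'` enter only through `star c * c'`, and linearly.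
-/
theorem adjoint_comp_intertwiner (c a c' b : A) :
    (D.intertwiner c a).adjoint ∘L D.intertwiner c' b =
      D.P * D.φ (star a * (star c * c') * b) * D.P - D.P * D.φ (star a * (star c * c')) * D.P * D.π b
        - D.π (star a) * D.P * D.φ ((star c * c') * b) * D.P
        + D.π (star a) * D.P * D.φ (star c * c') * D.P * D.π b := by
  have h : ∀ a b, D.φ (star a * b) = (D.V a).adjoint ∘L D.V b := fun a b =>
    (D.adjoint_comp a b).symm
  have h1 : star a * (star c * c') * b = star (c * a) * (c' * b) := by
    simp only [star_mul, mul_assoc]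
  have h2 : star a * (star c * c') = star (c * a) * c' := by simp only [star_mul, mul_assoc]
  have h3 : star c * c' * b = star c * (c' * b) := mul_assoc _ _ _
  rw [h1, h2, h3, h, h, h, h]
  simp only [intertwiner, map_sub, ContinuousLinearMap.adjoint_comp, ContinuousLinearMap.sub_comp,
    ContinuousLinearMap.comp_sub, D.adjoint_P, D.adjoint_π, ContinuousLinearMap.mul_def,
    ContinuousLinearMap.comp_assoc]
  abel

variable [PartialOrder A] [StarOrderedRing A]

/-- If `z • star c' * c' - star c * c = star m * m`, then by linearity in `star c * c` the
difference of the two sides is the square of the intertwiner of `m`. -/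
theorem intertwiner_le {c c' a : A} {z : ℂ} (h : star c * c ≤ z • (star c' * c')) :
    (D.intertwiner c a).adjoint ∘L D.intertwiner c a ≤
      z • ((D.intertwiner c' a).adjoint ∘L D.intertwiner c' a) := by
  obtain ⟨m, hm⟩ := CStarAlgebra.nonneg_iff_eq_star_mul_self.1 (sub_nonneg.2 h)
  rw [← sub_nonneg]
  have : z • ((D.intertwiner c' a).adjoint ∘L D.intertwiner c' a) -
      (D.intertwiner c a).adjoint ∘L D.intertwiner c a =
      (D.intertwiner m a).adjoint ∘L D.intertwiner m a := by
    simp only [adjoint_comp_intertwiner, ← hm, mul_sub, sub_mul, map_sub, mul_smul_comm,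
      smul_mul_assoc, map_smul, smul_sub, smul_add]
    abel
  rw [this]
  exact (ContinuousLinearMap.nonneg_iff_isPositive _).2
    (ContinuousLinearMap.isPositive_adjoint_comp_self _)

theorem φ_le {c c' : A} {z : ℂ} (h : star c * c ≤ z • (star c' * c')) (Q : H →L[ℂ] H) :
    (D.V c ∘L Q).adjoint ∘L (D.V c ∘L Q) ≤ z • ((D.V c' ∘L Q).adjoint ∘L (D.V c' ∘L Q)) := by
  obtain ⟨m, hm⟩ := CStarAlgebra.nonneg_iff_eq_star_mul_self.1 (sub_nonneg.2 h)
  rw [← sub_nonneg]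
  have h1 : ∀ c, (D.V c ∘L Q).adjoint ∘L (D.V c ∘L Q) = Q.adjoint ∘L D.φ (star c * c) ∘L Q := by
    intro c
    rw [ContinuousLinearMap.adjoint_comp, ← D.adjoint_comp]
    rfl
  have : z • ((D.V c' ∘L Q).adjoint ∘L (D.V c' ∘L Q)) - (D.V c ∘L Q).adjoint ∘L (D.V c ∘L Q) =
      (D.V m ∘L Q).adjoint ∘L (D.V m ∘L Q) := by
    rw [h1, h1, h1, ← hm, map_sub, map_smul, ContinuousLinearMap.sub_comp,
      ContinuousLinearMap.comp_sub, ContinuousLinearMap.smul_comp, ContinuousLinearMap.comp_smul]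
  rw [this]
  exact (ContinuousLinearMap.nonneg_iff_isPositive _).2
    (ContinuousLinearMap.isPositive_adjoint_comp_self _)

theorem star_mul_self_le_norm_sq (a : A) :
    star a * a ≤ ((‖a‖ ^ 2 : ℝ) : ℂ) • (star (1 : A) * 1) := by
  refine CStarAlgebra.star_mul_le_algebraMap_norm_sq.trans (le_of_eq ?_)
  rw [star_one, one_mul, Algebra.algebraMap_eq_smul_one, Complex.coe_smul]

theorem rootGauge_intertwiner_le (K : FrechetOperatorIdeal H) (i : ℕ) (a b : A) :
    K.rootGauge i (D.intertwiner a b) ≤ ‖a‖ₑ * K.rootGauge i (D.commutator b) := by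
  rw [← ofReal_norm]
  exact K.rootGauge_le_of_le i (norm_nonneg a) (D.intertwiner_le (star_mul_self_le_norm_sq a))

theorem enorm_π_le (a : A) : ‖D.π a‖ₑ ≤ ‖a‖ₑ := by
  rw [← ofReal_norm, ← ofReal_norm]
  exact ENNReal.ofReal_le_ofReal (NonUnitalStarAlgHom.norm_apply_le D.π a)

theorem rootGauge_commutator_mul_le (K : FrechetOperatorIdeal H) (i : ℕ) (a b : A) :
    K.rootGauge i (D.commutator (a * b)) ≤
      ‖a‖ₑ * K.rootGauge i (D.commutator b) + K.rootGauge i (D.commutator a) * ‖b‖ₑ := by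
  rw [commutator_mul]
  refine (K.rootGauge_add_le i _ _).trans (add_le_add (D.rootGauge_intertwiner_le K i a b) ?_)
  refine (K.rootGauge_comp_le i _ _).trans ?_
  gcongr
  exact D.enorm_π_le b

/-- The second-order Leibniz rule, with the commutators as first derivatives. The last term corrects
for `φ 1`, which need not act as `π 1` on the range of `P`. -/
theorem defect_mul (a b : A) :
    D.defect (a * b) = D.defect a * D.π b + D.π a * D.defect b
      + (D.commutator (star a)).adjoint ∘L D.commutator b - D.π a * D.defect 1 * D.π b := by
  rw [adjoint_comp_intertwiner]
  simp only [defect, star_one, one_mul, mul_one, star_star, mul_sub, sub_mul, map_mul, mul_assoc]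
  -- The representation need not be unital, but `π 1` is absorbed by `π a`.
  have h1 : D.π a * (D.π 1 * (D.P * D.π b)) = D.π a * (D.P * D.π b) := by
    rw [← mul_assoc, ← map_mul, mul_one]
  rw [h1]
  abel

theorem gauge_defect_mul_le (K : FrechetOperatorIdeal H) (i : ℕ) {a b : A}
    (ha : K.rootGauge i (D.commutator (star a)) ≠ ⊤) (hb : K.rootGauge i (D.commutator b) ≠ ⊤) :
    K.gauge i (D.defect (a * b)) ≤
      K.gauge i (D.defect a) * ‖b‖ₑ + ‖a‖ₑ * K.gauge i (D.defect b)
      + 4 * K.rootGauge i (D.commutator (star a)) * K.rootGauge i (D.commutator b)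
      + K.gauge i (D.defect 1) * (‖a‖ₑ * ‖b‖ₑ) := by
  rw [defect_mul]
  refine (K.gauge_sub_le i _ _).trans (add_le_add ((K.gauge_add_le i _ _).trans (add_le_add
    ((K.gauge_add_le i _ _).trans (add_le_add ?_ ?_)) (K.gauge_adjoint_comp_le ha hb))) ?_)
  · refine (K.gauge_mul_right_le i _ _).trans ?_
    gcongr
    exact D.enorm_π_le b
  · refine (K.gauge_mul_left_le i _ _).trans ?_
    gcongr
    exact D.enorm_π_le a
  · refine (K.gauge_mul_mul_le i _ _ _).trans ?_
    calc _ ≤ ‖a‖ₑ * K.gauge i (D.defect 1) * ‖b‖ₑ := by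
          gcongr
          · exact D.enorm_π_le a
          · exact D.enorm_π_le b
      _ = _ := by ring

theorem norm_V_le (a : A) : ‖D.V a‖ ≤ ‖a‖ * ‖D.V 1‖ := by
  have h := D.φ_le (star_mul_self_le_norm_sq a) (ContinuousLinearMap.id ℂ H)
  simp only [ContinuousLinearMap.comp_id] at h
  have h1 := CStarAlgebra.norm_le_norm_of_nonneg_of_le
    ((ContinuousLinearMap.nonneg_iff_isPositive _).2
      (ContinuousLinearMap.isPositive_adjoint_comp_self (D.V a))) h
  rw [norm_smul, ContinuousLinearMap.norm_adjoint_comp_self,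
    ContinuousLinearMap.norm_adjoint_comp_self, Complex.norm_real,
    Real.norm_of_nonneg (by positivity)] at h1
  refine abs_le_of_sq_le_sq' ?_ (by positivity) |>.2
  nlinarith [h1]

theorem continuous_V : Continuous D.V :=
  AddMonoidHomClass.continuous_of_bound D.V ‖D.V 1‖ fun a => by
    rw [mul_comm]; exact D.norm_V_le a

theorem continuous_π : Continuous D.π :=
  AddMonoidHomClass.continuous_of_bound D.π 1 fun a => by
    rw [one_mul]; exact NonUnitalStarAlgHom.norm_apply_le D.π a

theorem φ_eq (a : A) : D.φ a = (D.V 1).adjoint ∘L D.V a := by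
  rw [D.adjoint_comp, star_one, one_mul]

theorem continuous_φ : Continuous D.φ := by
  have : ⇑D.φ = fun a => (D.V 1).adjoint ∘L D.V a := funext D.φ_eq
  rw [this]
  exact continuous_const.clm_comp D.continuous_V

/-- The commutator as a linear map. -/
def commutatorₗ : A →ₗ[ℂ] H →L[ℂ] E where
  toFun := D.commutator
  map_add' a b := by
    simp only [intertwiner, mul_add, map_add, ContinuousLinearMap.add_comp,
      ContinuousLinearMap.comp_add]
    abel
  map_smul' z a := by
    simp only [intertwiner, mul_smul_comm, map_smul, ContinuousLinearMap.smul_comp,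
      ContinuousLinearMap.comp_smul, smul_sub, RingHom.id_apply]

/-- The defect as a linear map. -/
def defectₗ : A →ₗ[ℂ] H →L[ℂ] H where
  toFun := D.defect
  map_add' a b := by
    simp only [defect, map_add, mul_add, add_mul]
    abel
  map_smul' z a := by
    simp only [defect, map_smul, mul_smul_comm, smul_mul_assoc, smul_sub, RingHom.id_apply]

theorem continuous_commutatorₗ : Continuous D.commutatorₗ := by
  have h1 := D.continuous_V
  have h2 := D.continuous_π
  change Continuous fun a => D.V (1 * a) ∘L D.P - D.V 1 ∘L D.P ∘L D.π a
  simp only [one_mul]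
  exact (h1.clm_comp continuous_const).sub
    (continuous_const.clm_comp (continuous_const.clm_comp h2))

theorem continuous_defectₗ : Continuous D.defectₗ := by
  have h1 := D.continuous_φ
  have h2 := D.continuous_π
  change Continuous fun a => D.P * D.φ a * D.P - D.π a * D.P
  fun_prop

end DilatedPair

/-! ### Consequences of agreement modulo the ideal -/

namespace DilatedPair

variable {A H E : Type*} [CStarAlgebra A] [NormedAddCommGroup H]
    [InnerProductSpace ℂ H] [CompleteSpace H] [NormedAddCommGroup E] [InnerProductSpace ℂ E]
    [CompleteSpace E]

/-- The positive map of the dilated pair agrees modulo `K` with the compression `P π P` on a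
subalgebra `A₀`, which contains an element that is invertible in `A`. -/
structure AgreesOn (D : DilatedPair A H E) [PartialOrder A] (K : FrechetOperatorIdeal H)
    (A₀ : NonUnitalStarSubalgebra ℂ A) (e g : A) : Prop where
  commutator_mem : ∀ a ∈ A₀, D.π a * D.P - D.P * D.π a ∈ K.carrier
  commutator_one_mem : D.π 1 * D.P - D.P * D.π 1 ∈ K.carrier
  sub_mem : ∀ a ∈ A₀, D.P * D.π a * D.P - D.φ a ∈ K.carrier
  mem : e ∈ A₀
  mul_inv : e * g = 1
  inv_mul : g * e = 1
  le : star (1 : A) * 1 ≤ (2 : ℂ) • (star e * e)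

variable {D : DilatedPair A H E} [PartialOrder A] [StarOrderedRing A]
  {K : FrechetOperatorIdeal H} {A₀ : NonUnitalStarSubalgebra ℂ A} {e g : A}

/-- In the application `p, k, T, u, G, F, t` are the classes of `P, φ 1, π e, π 1, π g, φ f, π f`.
Since `T` commutes with `p`, `m2` says that `(1 - p) k p` is killed by `T`, hence by `u = T G` and
by `t = u t`; then `m1` kills the corner `(1 - p) F p`. The other off-diagonal corner is symmetric,
so `F = p F p = t p = p t p`. -/
theorem _root_.compression_sub_eq_zero {R : Type*} [Ring R] {p k T u G F t : R}
    (hpp : p * p = p) (cT : T * p = p * T) (hTG : T * G = u) (hGT : G * T = u)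
    (hut : u * t = t) (htu : t * u = t)
    (m1 : (1 - p) * F * p - (1 - p) * k * p * t = 0)
    (m2 : (1 - p) * (T * p) * p - (1 - p) * k * p * T = 0)
    (m3 : p * F * (1 - p) - t * p * k * (1 - p) = 0)
    (m4 : p * (T * p) * (1 - p) - T * p * k * (1 - p) = 0)
    (m5 : (1 - p) * F * (1 - p) = 0) (m6 : p * F * p - t * p = 0) (m7 : t * p - p * t = 0) :
    p * t * p - F = 0 := by
  have a1 : (1 - p) * (T * p) * p = 0 := by
    rw [cT, ← mul_assoc, sub_mul, one_mul, hpp, sub_self, zero_mul, zero_mul]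
  have a2 : p * (T * p) * (1 - p) = 0 := by
    rw [mul_assoc, mul_assoc, mul_sub p, mul_one, hpp, sub_self, mul_zero, mul_zero]
  rw [a1, zero_sub, neg_eq_zero] at m2
  rw [a2, zero_sub, neg_eq_zero] at m4
  have b1 : (1 - p) * k * p * t = 0 := by
    rw [← hut, ← hTG, ← mul_assoc, ← mul_assoc, m2, zero_mul, zero_mul]
  have b2 : t * p * k * (1 - p) = 0 := by
    rw [← htu, ← hGT, mul_assoc t, mul_assoc G, mul_assoc t, mul_assoc t, mul_assoc G, mul_assoc G,
      m4, mul_zero, mul_zero]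
  rw [b1, sub_zero] at m1
  rw [b2, sub_zero] at m3
  have hF : F = p * F * p + (1 - p) * F * p + p * F * (1 - p) + (1 - p) * F * (1 - p) := by
    noncomm_ring
  rw [m1, m3, m5, add_zero, add_zero, add_zero] at hF
  rw [sub_eq_zero] at m6 m7
  rw [hF, m6, ← m7, mul_assoc, hpp, sub_self]

section Quotient

variable {R : Type*} [Ring R] {q : (H →L[ℂ] H) →+* R} (hq : ∀ x, q x = 0 ↔ x ∈ K.carrier)
  (h : D.AgreesOn K A₀ e g)

include hq h

theorem AgreesOn.map_P_mul_map_P : q D.P * q D.P = q D.P := by rw [← map_mul, D.P_mul_P]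

theorem AgreesOn.map_π_mul_map_P {a : A} (ha : a ∈ A₀ ∨ a = 1) :
    q (D.π a) * q D.P = q D.P * q (D.π a) := by
  rw [← sub_eq_zero, ← map_mul, ← map_mul, ← map_sub, hq]
  rcases ha with ha | rfl
  · exact h.commutator_mem a ha
  · exact h.commutator_one_mem

theorem AgreesOn.map_φ {a : A} (ha : a ∈ A₀) : q (D.φ a) = q (D.π a) * q D.P := by
  have h1 := (hq _).2 (h.sub_mem a ha)
  rw [map_sub, map_mul, map_mul, sub_eq_zero] at h1
  rw [← h1, ← h.map_π_mul_map_P hq (Or.inl ha), mul_assoc, h.map_P_mul_map_P hq]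

end Quotient

/-- For `a = 1` the expansion of `X(a)† X(a)` would involve `φ 1`, about which nothing is assumed.
Since `1 ≤ 2 star e * e`, it is dominated by twice the square of the intertwiner of `e` and `a`, in
which `φ` is evaluated on `A₀` only. There `φ` is `π P` modulo the ideal, `P` commutes with the
representation, and all terms cancel. -/
theorem AgreesOn.commutator_sq_mem (h : D.AgreesOn K A₀ e g) {a : A} (ha : a ∈ A₀ ∨ a = 1) :
    (D.commutator a).adjoint ∘L D.commutator a ∈ K.carrier := by
  obtain ⟨R, _, q, hq⟩ := K.exists_quotient_hom
  have he : star e * e ∈ A₀ := mul_mem (star_mem h.mem) h.mem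
  have hle := D.intertwiner_le (a := a) h.le
  have hae : star a * (star e * e) ∈ A₀ := by
    rcases ha with ha | rfl
    · exact mul_mem (star_mem ha) he
    · simpa using he
  have hea : (star e * e) * a ∈ A₀ := by
    rcases ha with ha | rfl
    · exact mul_mem he ha
    · simpa using he
  have haea : star a * (star e * e) * a ∈ A₀ := by
    rcases ha with ha | rfl
    · exact mul_mem hae ha
    · simpa using he
  refine K.mem_of_nonneg_of_le ((ContinuousLinearMap.nonneg_iff_isPositive _).2
    (ContinuousLinearMap.isPositive_adjoint_comp_self _)) hle (K.carrier.smul_mem _ ?_)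
  have hsa : star a ∈ A₀ ∨ star a = 1 := ha.imp star_mem (by rintro rfl; exact star_one A)
  rw [← hq, adjoint_comp_intertwiner]
  simp only [map_add, map_sub, map_mul q]
  rw [h.map_φ hq haea, h.map_φ hq hae, h.map_φ hq hea, h.map_φ hq he]
  simp only [map_mul D.π _ a, map_mul D.π (star a), map_mul q]
  have hpp := h.map_P_mul_map_P hq
  have c1 := h.map_π_mul_map_P hq ha
  have c2 := h.map_π_mul_map_P hq hsa
  have c3 := h.map_π_mul_map_P hq (Or.inl he)
  have c1' : ∀ y, q D.P * (q (D.π a) * y) = q (D.π a) * (q D.P * y) := fun y => by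
    rw [← mul_assoc, ← c1, mul_assoc]
  have c2' : ∀ y, q D.P * (q (D.π (star a)) * y) = q (D.π (star a)) * (q D.P * y) := fun y => by
    rw [← mul_assoc, ← c2, mul_assoc]
  have c3' : ∀ y, q D.P * (q (D.π (star e * e)) * y) = q (D.π (star e * e)) * (q D.P * y) :=
    fun y => by rw [← mul_assoc, ← c3, mul_assoc]
  have hpp' : ∀ y, q D.P * (q D.P * y) = q D.P * y := fun y => by rw [← mul_assoc, hpp]
  simp only [mul_assoc, c1', c2', c3', ← c1, hpp]
  abel

theorem AgreesOn.commutator_mem_of_star (h : D.AgreesOn K A₀ e g) {a b : A} (ha : a ∈ A₀ ∨ a = 1)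
    (hb : b ∈ A₀ ∨ b = 1) : (D.commutator (star a)).adjoint ∘L D.commutator b ∈ K.carrier :=
  K.adjoint_comp_mem (h.commutator_sq_mem (ha.imp star_mem (by rintro rfl; exact star_one A)))
    (h.commutator_sq_mem hb)

theorem AgreesOn.map_adjoint_comp {R : Type*} [Ring R] {q : (H →L[ℂ] H) →+* R}
    (hq : ∀ x, q x = 0 ↔ x ∈ K.carrier) (h : D.AgreesOn K A₀ e g) {a b : A} (ha : a ∈ A₀ ∨ a = 1)
    (hb : b ∈ A₀ ∨ b = 1) :
    q D.P * q (D.φ (a * b)) * q D.P - q D.P * q (D.φ a) * q D.P * q (D.π b) -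
      q (D.π a) * (q D.P * q (D.φ b) * q D.P) +
      q (D.π a) * (q D.P * q (D.φ 1) * q D.P) * q (D.π b) = 0 := by
  have h1 := (hq _).2 (h.commutator_mem_of_star ha hb)
  rw [adjoint_comp_intertwiner] at h1
  simp only [star_star, star_one, mul_one, one_mul, map_add, map_sub, map_mul q] at h1
  rw [← h1]
  simp only [mul_assoc]

/-- Determines the class `k` of `P φ(1) P` when `1` may be missing from `A₀`. Multiplication by `G`,
the class of `π g`, turns the relation `hee` into `u k u = u p`, and `h1e`, `he1` into `k u = u k u
= u k`; then `h11` gives `k = u k u`. -/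
theorem _root_.eq_mul_of_compression_relations {R : Type*} [Ring R] {p k T u G : R}
    (hpp : p * p = p) (cT : T * p = p * T) (cu : u * p = p * u) (hTG : T * G = u) (hGT : G * T = u)
    (huT : u * T = T) (hTu : T * u = T)
    (hee : p * (T * T * p) * p - p * (T * p) * p * T - T * (p * (T * p) * p) + T * k * T = 0)
    (h1e : p * (T * p) * p - k * T - u * (p * (T * p) * p) + u * k * T = 0)
    (he1 : p * (T * p) * p - p * (T * p) * p * u - T * k + T * k * u = 0)
    (h11 : k - k * u - u * k + u * k * u = 0) : k = u * p := by
  have a1 : p * (T * p) * p = T * p := by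
    rw [cT, ← mul_assoc, hpp, ← cT, mul_assoc, hpp]
  have a2 : p * (T * T * p) * p = T * T * p := by
    rw [mul_assoc p, mul_assoc (T * T), hpp, ← mul_assoc, ← mul_assoc, ← cT, mul_assoc T, ← cT,
      mul_assoc, mul_assoc, hpp, mul_assoc]
  rw [a1] at hee h1e he1
  rw [a2, mul_assoc T p T, ← cT, ← mul_assoc] at hee
  rw [← mul_assoc u, huT] at h1e
  rw [mul_assoc T p u, ← cu, ← mul_assoc, hTu] at he1
  have e1 : T * k * T = T * T * p := by rw [← sub_eq_zero, ← hee]; abel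
  have e2 : k * T = u * k * T := by rw [eq_comm, ← sub_eq_zero, ← h1e]; abel
  have e3 : T * k = T * k * u := by rw [eq_comm, ← sub_eq_zero, ← he1]; abel
  have f1 : u * k * u = u * p := by
    calc u * k * u = G * (T * k * T) * G := by
          rw [← mul_assoc, ← mul_assoc, hGT, mul_assoc (u * k), hTG]
      _ = u * p := by
          rw [e1, ← mul_assoc, ← mul_assoc, hGT, huT, cT, mul_assoc, hTG, cu]
  have f2 : k * u = u * k * u := by
    calc k * u = k * T * G := by rw [mul_assoc, hTG]
      _ = _ := by rw [e2, mul_assoc, hTG]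
  have f3 : u * k = u * k * u := by
    calc u * k = G * (T * k) := by rw [← mul_assoc, hGT]
      _ = _ := by rw [e3, ← mul_assoc, ← mul_assoc, hGT]
  have f4 : k = k * u + u * k - u * k * u := by
    rw [← sub_eq_zero, ← h11]; abel
  calc k = k * u + u * k - u * k * u := f4
    _ = u * k * u + u * k * u - u * k * u := congrArg₂ (fun a b => a + b - u * k * u) f2 f3
    _ = u * p := by rw [add_sub_cancel_right, f1]

section Quotient

variable {R : Type*} [Ring R] {q : (H →L[ℂ] H) →+* R} (hq : ∀ x, q x = 0 ↔ x ∈ K.carrier)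
  (h : D.AgreesOn K A₀ e g)

include hq h

theorem AgreesOn.map_π_mul_map_π_inv : q (D.π e) * q (D.π g) = q (D.π 1) := by
  rw [← map_mul, ← map_mul, h.mul_inv]

theorem AgreesOn.map_π_inv_mul_map_π : q (D.π g) * q (D.π e) = q (D.π 1) := by
  rw [← map_mul, ← map_mul, h.inv_mul]

theorem AgreesOn.map_φ_one : q D.P * q (D.φ 1) * q D.P = q (D.π 1) * q D.P := by
  have hee := h.map_adjoint_comp hq (Or.inl h.mem) (Or.inl h.mem)
  have h1e := h.map_adjoint_comp hq (Or.inr rfl) (Or.inl h.mem)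
  have he1 := h.map_adjoint_comp hq (Or.inl h.mem) (Or.inr rfl)
  have h11 := h.map_adjoint_comp hq (Or.inr rfl) (Or.inr rfl)
  simp only [one_mul, mul_one] at h1e he1 h11
  rw [h.map_φ hq (mul_mem h.mem h.mem), h.map_φ hq h.mem, map_mul D.π, map_mul q] at hee
  rw [h.map_φ hq h.mem] at h1e he1
  exact eq_mul_of_compression_relations (h.map_P_mul_map_P hq)
    (h.map_π_mul_map_P hq (Or.inl h.mem)) (h.map_π_mul_map_P hq (Or.inr rfl))
    (h.map_π_mul_map_π_inv hq) (h.map_π_inv_mul_map_π hq)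
    (by rw [← map_mul, ← map_mul, one_mul]) (by rw [← map_mul, ← map_mul, mul_one])
    hee h1e he1 h11

end Quotient

theorem AgreesOn.defect_one_mem (h : D.AgreesOn K A₀ e g) : D.defect 1 ∈ K.carrier := by
  obtain ⟨R, _, q, hq⟩ := K.exists_quotient_hom
  rw [← hq, defect]
  simp only [map_sub, map_mul, h.map_φ_one hq, sub_self]

theorem AgreesOn.defect_mem (h : D.AgreesOn K A₀ e g) {a : A} (ha : a ∈ A₀) :
    D.defect a ∈ K.carrier := by
  obtain ⟨R, _, q, hq⟩ := K.exists_quotient_hom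
  rw [← hq, defect]
  simp only [map_sub, map_mul, h.map_φ hq ha, mul_assoc, h.map_P_mul_map_P hq]
  rw [h.map_π_mul_map_P hq (Or.inl ha), ← mul_assoc, h.map_P_mul_map_P hq, sub_self]

/-- Elements whose commutators and defects lie in the ideal are mapped into the ideal by the
difference of the two positive maps. -/
theorem AgreesOn.compression_sub_mem (h : D.AgreesOn K A₀ e g) {f : A}
    (hf : D.π f * D.P - D.P * D.π f ∈ K.carrier)
    (h1 : (D.commutator f).adjoint ∘L D.commutator f ∈ K.carrier)
    (h2 : (D.commutator (star f)).adjoint ∘L D.commutator (star f) ∈ K.carrier)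
    (h3 : D.defect f ∈ K.carrier) : D.P * D.π f * D.P - D.φ f ∈ K.carrier := by
  obtain ⟨R, _, q, hq⟩ := K.exists_quotient_hom
  have hpp := h.map_P_mul_map_P hq
  have hfe := h.map_φ hq h.mem
  have cT := h.map_π_mul_map_P hq (Or.inl h.mem)
  have hP' : (1 - D.P).adjoint = 1 - D.P := by
    rw [map_sub, D.adjoint_P]
    congr 1
    exact star_one _
  have hmul : ∀ x y : H →L[ℂ] H, x ∘L y = x * y := fun _ _ => rfl
  have hZZ : ∀ a b, (D.V a ∘L (1 - D.P)).adjoint ∘L (D.V b ∘L (1 - D.P)) =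
      (1 - D.P) * D.φ (star a * b) * (1 - D.P) := fun a b => by
    rw [ContinuousLinearMap.adjoint_comp, hP', ← D.adjoint_comp]
    rfl
  have hpos : ∀ ξ : H →L[ℂ] E, 0 ≤ ξ.adjoint ∘L ξ := fun ξ =>
    (ContinuousLinearMap.nonneg_iff_isPositive _).2
      (ContinuousLinearMap.isPositive_adjoint_comp_self _)
  -- Off the range of `P` the whole map `φ` is small: modulo the ideal, `(1 - P) φ (star e * e) (1 -
  -- P)` contains the factor `P (1 - P) = 0`. Domination carries this from `e` to `1` and from `1`
  -- to `f`.
  have hZe : (D.V e ∘L (1 - D.P)).adjoint ∘L (D.V e ∘L (1 - D.P)) ∈ K.carrier := by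
    rw [hZZ, ← hq]
    simp only [map_mul q, map_sub, map_one, h.map_φ hq (mul_mem (star_mem h.mem) h.mem), mul_assoc]
    rw [mul_sub (q D.P), mul_one, hpp, sub_self, mul_zero, mul_zero]
  have hZ1 : (D.V 1 ∘L (1 - D.P)).adjoint ∘L (D.V 1 ∘L (1 - D.P)) ∈ K.carrier :=
    K.mem_of_nonneg_of_le (hpos _) (D.φ_le h.le _) (K.carrier.smul_mem _ hZe)
  have hZf : (D.V f ∘L (1 - D.P)).adjoint ∘L (D.V f ∘L (1 - D.P)) ∈ K.carrier :=
    K.mem_of_nonneg_of_le (hpos _) (D.φ_le (star_mul_self_le_norm_sq f) _)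
      (K.carrier.smul_mem _ hZ1)
  have hXe := h.commutator_sq_mem (Or.inl h.mem)
  have hXe' := h.commutator_sq_mem (Or.inl (star_mem h.mem))
  have hZX : ∀ a, (D.V 1 ∘L (1 - D.P)).adjoint ∘L D.commutator a =
      (1 - D.P) * D.φ a * D.P - (1 - D.P) * D.φ 1 * D.P * D.π a := fun a => by
    have h1 : ∀ b, D.φ b = (D.V 1).adjoint ∘L D.V b := D.φ_eq
    rw [h1, h1]
    rw [ContinuousLinearMap.adjoint_comp, hP']
    simp only [intertwiner, ContinuousLinearMap.comp_sub, one_mul, ContinuousLinearMap.mul_def, ContinuousLinearMap.comp_assoc]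
  have hXZ : ∀ a, (D.commutator (star a)).adjoint ∘L (D.V 1 ∘L (1 - D.P)) =
      D.P * D.φ a * (1 - D.P) - D.π a * D.P * D.φ 1 * (1 - D.P) := fun a => by
    have h1 : D.φ a = (D.V (star a)).adjoint ∘L D.V 1 := by
      rw [D.adjoint_comp, star_star, mul_one]
    rw [h1, D.φ_eq 1]
    simp only [intertwiner, ContinuousLinearMap.adjoint_comp, map_sub, D.adjoint_P, D.adjoint_π,
      star_star, ContinuousLinearMap.sub_comp, one_mul, ContinuousLinearMap.mul_def,
      ContinuousLinearMap.comp_assoc]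
  -- Cauchy–Schwarz between `V 1 (1 - P)` and commutators gives the off-diagonal corners, first for
  -- `f` and then for `e`; the `e` version disposes of the unknown corner of `φ 1`.
  have m1 := (hq _).2 (K.adjoint_comp_mem hZ1 h1)
  have m2 := (hq _).2 (K.adjoint_comp_mem hZ1 hXe)
  have m3 := (hq _).2 (K.adjoint_comp_mem h2 hZ1)
  have m4 := (hq _).2 (K.adjoint_comp_mem hXe' hZ1)
  have m5 := (hq _).2 (K.adjoint_comp_mem hZ1 hZf)
  have m6 := (hq _).2 h3
  have m7 := (hq _).2 hf
  rw [hZX] at m1 m2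
  rw [hXZ] at m3 m4
  rw [hZZ, star_one, one_mul] at m5
  rw [defect] at m6
  simp only [map_sub, map_mul q, map_one q] at m1 m2 m3 m4 m5 m6 m7
  rw [hfe] at m2 m4
  have hTG := h.map_π_mul_map_π_inv hq
  have hGT := h.map_π_inv_mul_map_π hq
  have huf : q (D.π 1) * q (D.π f) = q (D.π f) := by rw [← map_mul, ← map_mul, one_mul]
  have hfu : q (D.π f) * q (D.π 1) = q (D.π f) := by rw [← map_mul, ← map_mul, mul_one]
  rw [← hq]
  simp only [map_sub, map_mul q]
  exact compression_sub_eq_zero hpp cT hTG hGT huf hfu m1 m2 m3 m4 m5 m6 m7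

end DilatedPair

/-- A countable family of pairs of extended seminorms on a normed algebra, the first of which obey
the Leibniz rule of a first derivative, and the second of which that of a second derivative.
Both are countably subadditive. -/
structure JetGauge (A : Type*) [NormedRing A] [NormedAlgebra ℂ A] where
  x : ℕ → A → ℝ≥0∞
  d : ℕ → A → ℝ≥0∞
  r : ℕ → ℝ≥0∞
  r_ne_top : ∀ i, r i ≠ ⊤
  x_one_ne_top : ∀ i, x i 1 ≠ ⊤
  d_one_ne_top : ∀ i, d i 1 ≠ ⊤
  x_mul_le : ∀ i a b, x i (a * b) ≤ ‖a‖ₑ * x i b + x i a * ‖b‖ₑ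
  d_mul_le : ∀ i a b, x i a ≠ ⊤ → x i b ≠ ⊤ → d i (a * b) ≤
    d i a * ‖b‖ₑ + ‖a‖ₑ * d i b + 4 * x i a * x i b + r i * (‖a‖ₑ * ‖b‖ₑ)
  x_add_le : ∀ i a b, x i (a + b) ≤ x i a + x i b
  d_add_le : ∀ i a b, d i (a + b) ≤ d i a + d i b
  x_smul_le : ∀ i (z : ℂ) a, x i (z • a) ≤ ‖z‖ₑ * x i a
  d_smul_le : ∀ i (z : ℂ) a, d i (z • a) ≤ ‖z‖ₑ * d i a
  x_le_tsum : ∀ {a : ℕ → A} {b : A}, (∀ j, ∑' m, x j (a m) ≠ ⊤) →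
    Tendsto (fun N => ∑ m ∈ Finset.range N, a m) atTop (𝓝 b) → ∀ i, x i b ≤ 3 * ∑' m, x i (a m)
  d_le_tsum : ∀ {a : ℕ → A} {b : A}, (∀ j, ∑' m, d j (a m) ≠ ⊤) →
    Tendsto (fun N => ∑ m ∈ Finset.range N, a m) atTop (𝓝 b) → ∀ i, d i b ≤ ∑' m, d i (a m)

/-! ### Submultiplicative seminorms and the growth of exponentials -/

namespace JetGauge

variable {A : Type*} [NormedRing A] [NormedAlgebra ℂ A] (W : JetGauge A)

/-- The submultiplicative extended seminorms assembled from a jet gauge. -/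
def N (i : ℕ) (a : A) : ℝ≥0∞ := (1 + W.r i) * ‖a‖ₑ + 2 * W.x i a + W.d i a

theorem x_le_N (i : ℕ) (a : A) : W.x i a ≤ W.N i a := by
  calc W.x i a ≤ 2 * W.x i a := by
        rw [two_mul]; exact le_self_add
    _ ≤ _ := le_add_self
    _ ≤ _ := le_self_add

theorem d_le_N (i : ℕ) (a : A) : W.d i a ≤ W.N i a := le_add_self

theorem enorm_le_N (i : ℕ) (a : A) : ‖a‖ₑ ≤ W.N i a := by
  calc ‖a‖ₑ = 1 * ‖a‖ₑ := (one_mul _).symm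
    _ ≤ (1 + W.r i) * ‖a‖ₑ := by gcongr; exact le_self_add
    _ ≤ _ := le_self_add
    _ ≤ _ := le_self_add

theorem N_ne_top {i : ℕ} {a : A} (hx : W.x i a ≠ ⊤) (hd : W.d i a ≠ ⊤) : W.N i a ≠ ⊤ := by
  have h1 := W.r_ne_top i
  have h2 : ‖a‖ₑ ≠ ⊤ := enorm_ne_top
  exact ENNReal.add_ne_top.2 ⟨ENNReal.add_ne_top.2 ⟨ENNReal.mul_ne_top (by simp [h1]) h2,
    ENNReal.mul_ne_top (by simp) hx⟩, hd⟩

theorem N_one_ne_top (i : ℕ) : W.N i 1 ≠ ⊤ := W.N_ne_top (W.x_one_ne_top i) (W.d_one_ne_top i)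

theorem N_add_le (i : ℕ) (a b : A) : W.N i (a + b) ≤ W.N i a + W.N i b := by
  calc _ ≤ (1 + W.r i) * (‖a‖ₑ + ‖b‖ₑ) + 2 * (W.x i a + W.x i b) + (W.d i a + W.d i b) := by
        unfold N
        gcongr
        · exact enorm_add_le a b
        · exact W.x_add_le i a b
        · exact W.d_add_le i a b
    _ = _ := by unfold N; ring

theorem N_smul_le (i : ℕ) (z : ℂ) (a : A) : W.N i (z • a) ≤ ‖z‖ₑ * W.N i a := by
  calc _ ≤ (1 + W.r i) * (‖z‖ₑ * ‖a‖ₑ) + 2 * (‖z‖ₑ * W.x i a) + ‖z‖ₑ * W.d i a := by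
        unfold N
        gcongr
        · rw [enorm_smul]
        · exact W.x_smul_le i z a
        · exact W.d_smul_le i z a
    _ = _ := by unfold N; ring

theorem N_zero (i : ℕ) : W.N i 0 = 0 := by
  have := W.N_smul_le i 0 1
  simpa using this

/-- The weights in `N` are chosen for this: `(2 x a) (2 x b)` absorbs the cross term `4 x a x b`,
and `(1 + r)²` dominates `(1 + r) + r`. Zero and infinite values are treated first because of `0 * ⊤
= 0` and because `d_mul_le` requires finite `x`. -/
theorem N_mul_le (i : ℕ) (a b : A) : W.N i (a * b) ≤ W.N i a * W.N i b := by
  rcases eq_or_ne (W.N i a) 0 with ha | ha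
  · have h1 : ‖a‖ₑ = 0 := le_antisymm (ha ▸ W.enorm_le_N i a) bot_le
    rw [enorm_eq_zero.1 h1, zero_mul, N_zero]
    exact bot_le
  rcases eq_or_ne (W.N i b) 0 with hb | hb
  · have h1 : ‖b‖ₑ = 0 := le_antisymm (hb ▸ W.enorm_le_N i b) bot_le
    rw [enorm_eq_zero.1 h1, mul_zero, N_zero]
    exact bot_le
  by_cases ha' : W.N i a = ⊤
  · rw [ha', ENNReal.top_mul hb]; exact le_top
  by_cases hb' : W.N i b = ⊤
  · rw [hb', ENNReal.mul_top ha]; exact le_top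
  have hxa := ne_top_of_le_ne_top ha' (W.x_le_N i a)
  have hxb := ne_top_of_le_ne_top hb' (W.x_le_N i b)
  have hab : ‖a * b‖ₑ ≤ ‖a‖ₑ * ‖b‖ₑ := by
    rw [← ofReal_norm, ← ofReal_norm, ← ofReal_norm, ← ENNReal.ofReal_mul (norm_nonneg _)]
    exact ENNReal.ofReal_le_ofReal (norm_mul_le a b)
  calc W.N i (a * b) ≤ (1 + W.r i) * (‖a‖ₑ * ‖b‖ₑ) + 2 * (‖a‖ₑ * W.x i b + W.x i a * ‖b‖ₑ) +
        (W.d i a * ‖b‖ₑ + ‖a‖ₑ * W.d i b + 4 * W.x i a * W.x i b + W.r i * (‖a‖ₑ * ‖b‖ₑ)) := by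
        unfold N
        gcongr
        · exact W.x_mul_le i a b
        · exact W.d_mul_le i a b hxa hxb
    _ ≤ _ := by
        refine le_iff_exists_add.2 ⟨W.r i * W.r i * (‖a‖ₑ * ‖b‖ₑ) +
          W.r i * (2 * (‖a‖ₑ * W.x i b + W.x i a * ‖b‖ₑ)) +
          W.r i * (W.d i a * ‖b‖ₑ + ‖a‖ₑ * W.d i b) + 2 * W.x i a * W.d i b +
          2 * W.d i a * W.x i b + W.d i a * W.d i b, ?_⟩
        unfold N
        ring

theorem N_le_tsum {a : ℕ → A} {b : A} (hs : ∀ j, ∑' m, W.N j (a m) ≠ ⊤)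
    (hb : Tendsto (fun N => ∑ m ∈ Finset.range N, a m) atTop (𝓝 b)) (i : ℕ) :
    W.N i b ≤ 3 * ∑' m, W.N i (a m) := by
  have hx := W.x_le_tsum (fun j => ne_top_of_le_ne_top (hs j)
    (ENNReal.tsum_le_tsum fun m => W.x_le_N j (a m))) hb i
  have hd := W.d_le_tsum (fun j => ne_top_of_le_ne_top (hs j)
    (ENNReal.tsum_le_tsum fun m => W.d_le_N j (a m))) hb i
  have hn : ‖b‖ₑ ≤ ∑' m, ‖a m‖ₑ := by
    refine le_of_tendsto' ((continuous_enorm.tendsto b).comp hb) fun N => ?_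
    exact (enorm_sum_le _ _).trans (ENNReal.sum_le_tsum _)
  have htop : ∑' m, W.N i (a m) =
      (1 + W.r i) * ∑' m, ‖a m‖ₑ + 2 * ∑' m, W.x i (a m) + ∑' m, W.d i (a m) := by
    unfold N
    rw [ENNReal.tsum_add, ENNReal.tsum_add, ENNReal.tsum_mul_left, ENNReal.tsum_mul_left]
  rw [htop]
  calc W.N i b ≤ (1 + W.r i) * ∑' m, ‖a m‖ₑ + 2 * (3 * ∑' m, W.x i (a m)) + ∑' m, W.d i (a m) := by
        unfold N
        gcongr
    _ ≤ _ := by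
        refine le_iff_exists_add.2 ⟨2 * ((1 + W.r i) * ∑' m, ‖a m‖ₑ) + 2 * ∑' m, W.d i (a m), ?_⟩
        ring

/-- The algebra of elements on which a jet gauge is finite. -/
def smooth : Subalgebra ℂ A where
  carrier := {a | ∀ i, W.N i a ≠ ⊤}
  mul_mem' ha hb i := ne_top_of_le_ne_top (ENNReal.mul_ne_top (ha i) (hb i)) (W.N_mul_le i _ _)
  add_mem' ha hb i := ne_top_of_le_ne_top (ENNReal.add_ne_top.2 ⟨ha i, hb i⟩) (W.N_add_le i _ _)
  algebraMap_mem' z i := by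
    rw [Algebra.algebraMap_eq_smul_one]
    exact ne_top_of_le_ne_top (ENNReal.mul_ne_top enorm_ne_top (W.N_one_ne_top i))
      (W.N_smul_le i z 1)

theorem mem_smooth {a : A} : a ∈ W.smooth ↔ ∀ i, W.N i a ≠ ⊤ := Iff.rfl

theorem mem_smooth_of_tendsto {a : ℕ → A} {b : A} (hs : ∀ j, ∑' m, W.N j (a m) ≠ ⊤)
    (hb : Tendsto (fun N => ∑ m ∈ Finset.range N, a m) atTop (𝓝 b)) : b ∈ W.smooth := fun i =>
  ne_top_of_le_ne_top (ENNReal.mul_ne_top (by simp) (hs i)) (W.N_le_tsum hs hb i)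

theorem N_pow_le (i : ℕ) (a : A) (m : ℕ) : W.N i (a ^ m) ≤ W.N i 1 * W.N i a ^ m := by
  induction m with
  | zero => simp
  | succ m ih =>
    rw [pow_succ, pow_succ, ← mul_assoc]
    exact (W.N_mul_le i _ _).trans (by gcongr)

theorem N_exp_le [CompleteSpace A] {a : A} (ha : a ∈ W.smooth) {i : ℕ} {S : ℝ} (hS : 0 ≤ S)
    (h : W.N i a ≤ ENNReal.ofReal S) :
    W.N i (NormedSpace.exp a) ≤ 3 * (W.N i 1 * ENNReal.ofReal (Real.exp S)) := by
  have hterm : ∀ j m (T : ℝ), 0 ≤ T → W.N j a ≤ ENNReal.ofReal T →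
      W.N j (((m.factorial : ℂ)⁻¹) • a ^ m) ≤ W.N j 1 * ENNReal.ofReal (T ^ m / m.factorial) := by
    intro j m T hT hj
    refine (W.N_smul_le j _ _).trans ?_
    have h1 : ‖((m.factorial : ℂ)⁻¹)‖ₑ = ENNReal.ofReal ((m.factorial : ℝ)⁻¹) := by
      rw [← ofReal_norm, norm_inv, Complex.norm_natCast]
    calc _ ≤ ENNReal.ofReal ((m.factorial : ℝ)⁻¹) * (W.N j 1 * ENNReal.ofReal T ^ m) := by
          rw [h1]
          gcongr
          exact (W.N_pow_le j a m).trans (by gcongr)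
      _ = _ := by
          rw [← ENNReal.ofReal_pow hT, div_eq_mul_inv, ENNReal.ofReal_mul (by positivity)]
          ring
  have hsum : ∀ T : ℝ, 0 ≤ T → ∑' m : ℕ, ENNReal.ofReal (T ^ m / m.factorial) =
      ENNReal.ofReal (Real.exp T) := by
    intro T hT
    have h1 : HasSum (fun m : ℕ => T ^ m / m.factorial) (Real.exp T) := by
      rw [Real.exp_eq_exp_ℝ]
      exact NormedSpace.expSeries_div_hasSum_exp T
    rw [← h1.tsum_eq]
    exact (ENNReal.ofReal_tsum_of_nonneg (fun m => by positivity) h1.summable).symm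
  have hle : ∀ j (T : ℝ), 0 ≤ T → W.N j a ≤ ENNReal.ofReal T →
      ∑' m : ℕ, W.N j (((m.factorial : ℂ)⁻¹) • a ^ m) ≤ W.N j 1 * ENNReal.ofReal (Real.exp T) := by
    intro j T hT hj
    refine (ENNReal.tsum_le_tsum fun m => hterm j m T hT hj).trans ?_
    rw [ENNReal.tsum_mul_left, hsum T hT]
  refine (W.N_le_tsum (fun j => ?_) (NormedSpace.exp_series_hasSum_exp' (𝕂 := ℂ) a
    ).tendsto_sum_nat i).trans (by gcongr; exact hle i S hS h)
  refine ne_top_of_le_ne_top (ENNReal.mul_ne_top (W.N_one_ne_top j) ENNReal.ofReal_ne_top)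
    (hle j (W.N j a).toReal ENNReal.toReal_nonneg ?_)
  rw [ENNReal.ofReal_toReal (ha j)]

/-- Submultiplicativity alone would allow exponential growth in `L`. When `‖u‖ ≤ 1` the Leibniz
rules give growth of order `L` for the first derivative `x` and of order `L²` for the second
derivative `d`, as for the derivatives of a power. -/
theorem N_pow_succ_le_of_norm_le_one {i : ℕ} {u : A} (hu : ‖u‖ ≤ 1) (hN : W.N i u ≠ ⊤) (L : ℕ) :
    W.N i (u ^ (L + 1)) ≤
      (1 + 2 * W.r i + 3 * W.N i u + 4 * W.N i u ^ 2) * ((L + 1 : ℕ) : ℝ≥0∞) ^ 2 := by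
  have hu' : ‖u‖ₑ ≤ 1 := by
    rw [← ofReal_norm]; exact ENNReal.ofReal_le_one.2 hu
  have hpow : ∀ L, ‖u ^ (L + 1)‖ₑ ≤ 1 := fun L => by
    rw [← ofReal_norm]
    exact ENNReal.ofReal_le_one.2
      ((norm_pow_le' u L.succ_pos).trans (pow_le_one₀ (norm_nonneg _) hu))
  have hxN := W.x_le_N i u
  have hxtop := ne_top_of_le_ne_top hN hxN
  have hx : ∀ L : ℕ, W.x i (u ^ (L + 1)) ≤ ((L + 1 : ℕ) : ℝ≥0∞) * W.x i u := by
    intro L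
    induction L with
    | zero => simp
    | succ L ih =>
      rw [pow_succ]
      calc _ ≤ ‖u ^ (L + 1)‖ₑ * W.x i u + W.x i (u ^ (L + 1)) * ‖u‖ₑ := W.x_mul_le i _ _
        _ ≤ 1 * W.x i u + (((L + 1 : ℕ) : ℝ≥0∞) * W.x i u) * 1 := by
            gcongr
            exact hpow L
        _ = _ := by push_cast; ring
  have hxt : ∀ L : ℕ, W.x i (u ^ (L + 1)) ≠ ⊤ := fun L =>
    ne_top_of_le_ne_top (ENNReal.mul_ne_top (by simp) hxtop) (hx L)
  have hd : ∀ L : ℕ, W.d i (u ^ (L + 1)) ≤ ((L + 1 : ℕ) : ℝ≥0∞) * (W.d i u + W.r i) +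
      4 * ((L + 1 : ℕ) : ℝ≥0∞) ^ 2 * W.x i u ^ 2 := by
    intro L
    induction L with
    | zero =>
      simp only [zero_add, pow_one, Nat.cast_one, one_mul]
      exact le_self_add.trans le_self_add
    | succ L ih =>
      rw [pow_succ]
      calc _ ≤ _ := W.d_mul_le i _ _ (hxt L) hxtop
        _ ≤ (((L + 1 : ℕ) : ℝ≥0∞) * (W.d i u + W.r i) +
              4 * ((L + 1 : ℕ) : ℝ≥0∞) ^ 2 * W.x i u ^ 2) * 1 + 1 * W.d i u +
            4 * (((L + 1 : ℕ) : ℝ≥0∞) * W.x i u) * W.x i u + W.r i * (1 * 1) := by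
            gcongr
            · exact hpow L
            · exact hx L
            · exact hpow L
        _ ≤ _ := by
            -- The slack is `(L + 2)² - (L + 1)² - (L + 1) = L + 2`, times `4 x²`.
            refine le_iff_exists_add.2 ⟨4 * W.x i u ^ 2 * (L + 2), ?_⟩
            push_cast
            ring
  have h1 : (1 : ℝ≥0∞) ≤ ((L + 1 : ℕ) : ℝ≥0∞) := by exact_mod_cast Nat.succ_le_succ (Nat.zero_le L)
  have h2 : ((L + 1 : ℕ) : ℝ≥0∞) ≤ ((L + 1 : ℕ) : ℝ≥0∞) ^ 2 := by
    calc _ = ((L + 1 : ℕ) : ℝ≥0∞) * 1 := (mul_one _).symm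
      _ ≤ _ := by rw [pow_two]; gcongr
  calc W.N i (u ^ (L + 1)) ≤ (1 + W.r i) * 1 + 2 * (((L + 1 : ℕ) : ℝ≥0∞) * W.x i u) +
        (((L + 1 : ℕ) : ℝ≥0∞) * (W.d i u + W.r i) +
          4 * ((L + 1 : ℕ) : ℝ≥0∞) ^ 2 * W.x i u ^ 2) := by
        unfold N
        gcongr
        · exact hpow L
        · exact hx L
        · exact hd L
    _ ≤ (1 + W.r i) * ((L + 1 : ℕ) : ℝ≥0∞) ^ 2 + 2 * (((L + 1 : ℕ) : ℝ≥0∞) ^ 2 * W.N i u) +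
        (((L + 1 : ℕ) : ℝ≥0∞) ^ 2 * (W.N i u + W.r i) +
          4 * ((L + 1 : ℕ) : ℝ≥0∞) ^ 2 * W.N i u ^ 2) := by
        gcongr
        · exact h1.trans h2
        · exact W.d_le_N i u
    _ = _ := by ring

/-- Exponentials grow quadratically along an algebra element as long as they stay bounded. -/
theorem exists_N_exp_le [CompleteSpace A] (i : ℕ) {S : ℝ} (hS : 0 ≤ S) :
    ∃ C : ℝ≥0∞, C ≠ ⊤ ∧ ∀ (L : ℕ) (a : A), a ∈ W.smooth →
      W.N i a ≤ ENNReal.ofReal S → ‖NormedSpace.exp a‖ ≤ 1 →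
      W.N i (NormedSpace.exp (((L + 1 : ℕ) : ℂ) • a)) ≤ C * ((L + 1 : ℕ) : ℝ≥0∞) ^ 2 := by
  set B : ℝ≥0∞ := 3 * (W.N i 1 * ENNReal.ofReal (Real.exp S)) with hB
  have hBtop : B ≠ ⊤ := ENNReal.mul_ne_top (by simp)
    (ENNReal.mul_ne_top (W.N_one_ne_top i) ENNReal.ofReal_ne_top)
  have hr := W.r_ne_top i
  refine ⟨1 + 2 * W.r i + 3 * B + 4 * B ^ 2, ?_, fun L a ha h hn => ?_⟩
  · have h2 : 2 * W.r i ≠ ⊤ := ENNReal.mul_ne_top (by simp) hr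
    have h3 : 3 * B ≠ ⊤ := ENNReal.mul_ne_top (by simp) hBtop
    have h4 : 4 * B ^ 2 ≠ ⊤ := ENNReal.mul_ne_top (by simp) (ENNReal.pow_ne_top hBtop)
    simp [h2, h3, h4]
  · have hE := W.N_exp_le ha hS h
    -- The large exponential is a power of one whose seminorm is bounded in terms of `S` alone,
    -- which makes the constant independent of `a` and `L`.
    have hexp : NormedSpace.exp (((L + 1 : ℕ) : ℂ) • a) = NormedSpace.exp a ^ (L + 1) := by
      have : NormedAlgebra ℚ A := NormedAlgebra.restrictScalars ℚ ℂ A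
      rw [Nat.cast_smul_eq_nsmul, NormedSpace.exp_nsmul]
    rw [hexp]
    refine (W.N_pow_succ_le_of_norm_le_one hn (ne_top_of_le_ne_top hBtop hE) L).trans ?_
    gcongr

end JetGauge

/-! ### The jet gauge of an extension -/

namespace DilatedPair

variable {A H E : Type*} [CStarAlgebra A] [NormedAddCommGroup H]
    [InnerProductSpace ℂ H] [CompleteSpace H] [NormedAddCommGroup E] [InnerProductSpace ℂ E]
    [CompleteSpace E] {D : DilatedPair A H E} [PartialOrder A] [StarOrderedRing A]
  {K : FrechetOperatorIdeal H} {A₀ : NonUnitalStarSubalgebra ℂ A} {e g : A}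

/-- The jet gauge measuring commutators and defects in the operator ideal. -/
def AgreesOn.jetGauge (h : D.AgreesOn K A₀ e g) : JetGauge A where
  -- Symmetrized under `star` because the cross term in the product rule for defects is `X(star a)†
  -- X(b)`.
  x i a := K.rootGauge i (D.commutator a) + K.rootGauge i (D.commutator (star a))
  d i a := K.gauge i (D.defect a)
  r i := K.gauge i (D.defect 1)
  r_ne_top i := K.gauge_ne_top i h.defect_one_mem
  x_one_ne_top i := by
    have := K.rootGauge_ne_top_iff (i := i).2 (h.commutator_sq_mem (Or.inr rfl))
    rw [star_one]
    exact ENNReal.add_ne_top.2 ⟨this, this⟩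
  d_one_ne_top i := K.gauge_ne_top i h.defect_one_mem
  x_mul_le i a b := by
    have hs : ∀ a : A, ‖star a‖ₑ = ‖a‖ₑ := fun a => by
      rw [← ofReal_norm, ← ofReal_norm, norm_star]
    have h1 := D.rootGauge_commutator_mul_le K i a b
    have h2 := D.rootGauge_commutator_mul_le K i (star b) (star a)
    rw [hs, hs] at h2
    rw [star_mul]
    refine (add_le_add h1 h2).trans (le_of_eq ?_)
    ring
  d_mul_le i a b ha hb := by
    refine (D.gauge_defect_mul_le K i (ENNReal.add_ne_top.1 ha).2 (ENNReal.add_ne_top.1 hb).1).trans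
      ?_
    gcongr
    · exact le_add_self
    · exact le_self_add
  x_add_le i a b := by
    have h1 := K.rootGauge_add_le i (D.commutatorₗ a) (D.commutatorₗ b)
    have h2 := K.rootGauge_add_le i (D.commutatorₗ (star a)) (D.commutatorₗ (star b))
    rw [← map_add] at h1 h2
    rw [star_add]
    refine (add_le_add h1 h2).trans (le_of_eq ?_)
    exact add_add_add_comm _ _ _ _
  d_add_le i a b := by
    have h1 := K.gauge_add_le i (D.defectₗ a) (D.defectₗ b)
    rwa [← map_add] at h1
  x_smul_le i z a := by
    have h1 := K.rootGauge_smul_le i z (D.commutatorₗ a)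
    have h2 := K.rootGauge_smul_le i (star z) (D.commutatorₗ (star a))
    rw [← map_smul] at h1 h2
    have h3 : ‖star z‖ₑ = ‖z‖ₑ := by rw [← ofReal_norm, ← ofReal_norm, norm_star]
    rw [h3] at h2
    rw [star_smul, mul_add]
    exact add_le_add h1 h2
  d_smul_le i z a := by
    have h1 := K.gauge_smul_le i z (D.defectₗ a)
    rwa [← map_smul] at h1
  x_le_tsum {a b} hs hb i := by
    have hlim : ∀ {a : ℕ → A} {b : A},
        Tendsto (fun N => ∑ m ∈ Finset.range N, a m) atTop (𝓝 b) →
        Tendsto (fun N => ∑ m ∈ Finset.range N, D.commutatorₗ (a m)) atTop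
          (𝓝 (D.commutatorₗ b)) := fun hb => by
      simpa [Function.comp_def] using (D.continuous_commutatorₗ.tendsto _).comp hb
    have hbs : Tendsto (fun N => ∑ m ∈ Finset.range N, star (a m)) atTop (𝓝 (star b)) := by
      simpa [Function.comp_def] using (continuous_star.tendsto _).comp hb
    have h1 := K.rootGauge_le_tsum (fun j => ne_top_of_le_ne_top (hs j)
      (ENNReal.tsum_le_tsum fun m => le_self_add)) (hlim hb) i
    have h2 := K.rootGauge_le_tsum (fun j => ne_top_of_le_ne_top (hs j)
      (ENNReal.tsum_le_tsum fun m => le_add_self)) (hlim hbs) i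
    rw [ENNReal.tsum_add, mul_add]
    exact add_le_add h1 h2
  d_le_tsum {a b} hs hb i := by
    refine K.gauge_le_tsum (b := fun m => D.defectₗ (a m)) (B := D.defectₗ b) hs ?_ i
    simpa [Function.comp_def] using (D.continuous_defectₗ.tendsto _).comp hb

theorem AgreesOn.mem_smooth (h : D.AgreesOn K A₀ e g) {a : A} (ha : a ∈ A₀) :
    a ∈ h.jetGauge.smooth := fun i => by
  refine h.jetGauge.N_ne_top (ENNReal.add_ne_top.2 ⟨?_, ?_⟩) (K.gauge_ne_top i (h.defect_mem ha))
  · exact K.rootGauge_ne_top_iff.2 (h.commutator_sq_mem (Or.inl ha))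
  · exact K.rootGauge_ne_top_iff.2 (h.commutator_sq_mem (Or.inl (star_mem ha)))

theorem AgreesOn.compression_sub_mem_of_mem_smooth (h : D.AgreesOn K A₀ e g) {f : A}
    (hf : D.π f * D.P - D.P * D.π f ∈ K.carrier) (hs : f ∈ h.jetGauge.smooth) :
    D.P * D.π f * D.P - D.φ f ∈ K.carrier := by
  have hx := ENNReal.add_ne_top.1 (ne_top_of_le_ne_top (hs 0) (h.jetGauge.x_le_N 0 f))
  have hd := ne_top_of_le_ne_top (hs 0) (h.jetGauge.d_le_N 0 f)
  exact h.compression_sub_mem hf (K.rootGauge_ne_top_iff.1 hx.1) (K.rootGauge_ne_top_iff.1 hx.2)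
    (K.mem_of_gauge_ne_top hd)

end DilatedPair

/-! ### Fourier coefficients of differentiable functions on the torus -/

section Fourier

open MeasureTheory UnitAddTorus

attribute [local instance] instMeasureSpaceUnitAddCircle

local instance : Measure.IsAddHaarMeasure (volume : Measure UnitAddCircle) :=
  inferInstanceAs (Measure.IsAddHaarMeasure AddCircle.haarAddCircle)

local instance : IsProbabilityMeasure (volume : Measure UnitAddCircle) :=
  inferInstanceAs (IsProbabilityMeasure AddCircle.haarAddCircle)

variable {N : ℕ}

/-- The quotient map onto the torus. -/
def torusMk (x : Fin N → ℝ) : UnitAddTorus (Fin N) := fun j => (x j : UnitAddCircle)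

theorem isOpenQuotientMap_torusMk : IsOpenQuotientMap (torusMk (N := N)) :=
  IsOpenQuotientMap.piMap fun _ => QuotientAddGroup.isOpenQuotientMap_mk

theorem continuous_of_comp_torusMk {G : UnitAddTorus (Fin N) → ℂ} (h : Continuous (G ∘ torusMk)) :
    Continuous G :=
  isOpenQuotientMap_torusMk.isQuotientMap.continuous_iff.2 h

theorem torusMk_add_single (x : Fin N → ℝ) (j : Fin N) (t : ℝ) :
    torusMk x + Pi.single j (t : UnitAddCircle) = torusMk (x + t • Pi.single j 1) := by
  ext i
  rcases eq_or_ne i j with rfl | h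
  · simp [torusMk]
  · simp [torusMk, h]

/-- The partial derivative of a function on the torus. -/
def torusDeriv (j : Fin N) (G : UnitAddTorus (Fin N) → ℂ) (y : UnitAddTorus (Fin N)) : ℂ :=
  deriv (fun t : ℝ => G (y + Pi.single j (t : UnitAddCircle))) 0

theorem hasDerivAt_torus {G : UnitAddTorus (Fin N) → ℂ} (hG : Differentiable ℝ (G ∘ torusMk))
    (x : Fin N → ℝ) (j : Fin N) :
    HasDerivAt (fun t : ℝ => G (torusMk x + Pi.single j (t : UnitAddCircle)))
      (fderiv ℝ (G ∘ torusMk) x (Pi.single j 1)) 0 := by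
  have h1 : HasDerivAt (fun t : ℝ => x + t • (Pi.single j 1 : Fin N → ℝ)) (Pi.single j 1) 0 := by
    simpa using ((hasDerivAt_id (0 : ℝ)).smul_const (Pi.single j (1 : ℝ) : Fin N → ℝ)).const_add x
  have h2 : HasFDerivAt (G ∘ torusMk) (fderiv ℝ (G ∘ torusMk) x)
      (x + (0 : ℝ) • (Pi.single j 1 : Fin N → ℝ)) := by
    rw [zero_smul, add_zero]
    exact (hG x).hasFDerivAt
  have h3 := h2.comp_hasDerivAt (0 : ℝ) h1
  refine h3.congr_of_eventuallyEq (Eventually.of_forall fun t => ?_)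
  change G _ = G _
  rw [torusMk_add_single]

theorem torusDeriv_comp_torusMk {G : UnitAddTorus (Fin N) → ℂ}
    (hG : Differentiable ℝ (G ∘ torusMk)) (j : Fin N) :
    torusDeriv j G ∘ torusMk = fun x => fderiv ℝ (G ∘ torusMk) x (Pi.single j 1) :=
  funext fun x => (hasDerivAt_torus hG x j).deriv

theorem contDiff_torusDeriv {G : UnitAddTorus (Fin N) → ℂ} {s : ℕ}
    (hG : ContDiff ℝ (s + 1 : ℕ) (G ∘ torusMk)) (j : Fin N) :
    ContDiff ℝ s (torusDeriv j G ∘ torusMk) := by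
  rw [torusDeriv_comp_torusMk (hG.differentiable (by simp))]
  exact (hG.fderiv_right (m := (s : WithTop ℕ∞)) (by norm_cast)).clm_apply contDiff_const

theorem hasDerivAt_torus_translate {G : UnitAddTorus (Fin N) → ℂ}
    (hG : Differentiable ℝ (G ∘ torusMk)) (y : UnitAddTorus (Fin N)) (j : Fin N) (t : ℝ) :
    HasDerivAt (fun t : ℝ => G (y + Pi.single j (t : UnitAddCircle)))
      (torusDeriv j G (y + Pi.single j (t : UnitAddCircle))) t := by
  obtain ⟨x, hx⟩ := isOpenQuotientMap_torusMk.surjective (y + Pi.single j (t : UnitAddCircle))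
  have h := hasDerivAt_torus hG x j
  have h1 := congrFun (torusDeriv_comp_torusMk hG j) x
  simp only [Function.comp_apply] at h1
  rw [← h1, hx, ← sub_self t] at h
  have h2 := h.comp_sub_const t t
  refine h2.congr_of_eventuallyEq (Eventually.of_forall fun s => ?_)
  simp only
  rw [add_assoc, ← Pi.single_add]
  congr 3
  rw [← AddCircle.coe_add]
  congr 1
  ring

theorem mFourier_add_single (k : Fin N → ℤ) (y : UnitAddTorus (Fin N)) (j : Fin N) (t : ℝ) :
    mFourier k (y + Pi.single j (t : UnitAddCircle)) =
      Complex.exp (2 * Real.pi * Complex.I * k j * t) * mFourier k y := by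
  have h : ∀ i, fourier (k i) ((y + Pi.single j (t : UnitAddCircle) : UnitAddTorus (Fin N)) i) =
      (if i = j then Complex.exp (2 * Real.pi * Complex.I * k j * t) else 1) *
        fourier (k i) (y i) := by
    intro i
    rcases eq_or_ne i j with rfl | h
    · rw [if_pos rfl, Pi.add_apply, Pi.single_eq_same, fourier_apply, smul_add, AddCircle.toCircle_add,
        Circle.coe_mul, ← fourier_apply, ← fourier_apply, mul_comm, fourier_coe_apply]
      simp
    · rw [if_neg h, Pi.add_apply, Pi.single_eq_of_ne h, add_zero, one_mul]
  simp only [mFourier, ContinuousMap.coe_mk]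
  rw [Finset.prod_congr rfl fun i _ => h i, Finset.prod_mul_distrib]
  simp

theorem mFourierCoeff_translate (G : UnitAddTorus (Fin N) → ℂ) (k : Fin N → ℤ) (j : Fin N)
    (t : ℝ) :
    ∫ y, mFourier (-k) y • G (y + Pi.single j (t : UnitAddCircle)) =
      Complex.exp (2 * Real.pi * Complex.I * k j * t) * mFourierCoeff G k := by
  have h := integral_add_right_eq_self (μ := volume) (fun y => mFourier (-k) y • G y)
    (Pi.single j (t : UnitAddCircle) : UnitAddTorus (Fin N))
  rw [mFourierCoeff, ← h, ← integral_const_mul]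
  refine integral_congr_ae (Eventually.of_forall fun y => ?_)
  simp only
  rw [mFourier_add_single, smul_eq_mul, smul_eq_mul, ← mul_assoc, ← mul_assoc, ← Complex.exp_add]
  have : 2 * Real.pi * Complex.I * k j * t + 2 * Real.pi * Complex.I * ((-k) j : ℤ) * t = 0 := by
    rw [Pi.neg_apply]; push_cast; ring
  rw [this, Complex.exp_zero, one_mul]

/-- Instead of integrating by parts, the effect of a translation on the coefficient, multiplication
by `exp (2π i k_j t)`, is differentiated at `t = 0` under the integral. -/
theorem mFourierCoeff_torusDeriv {G : UnitAddTorus (Fin N) → ℂ}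
    (hG : ContDiff ℝ 1 (G ∘ torusMk)) (j : Fin N) (k : Fin N → ℤ) :
    mFourierCoeff (torusDeriv j G) k = 2 * Real.pi * Complex.I * k j * mFourierCoeff G k := by
  have hd := hG.differentiable one_ne_zero
  have hGc : Continuous G := continuous_of_comp_torusMk hG.continuous
  have hDc : Continuous (torusDeriv j G) :=
    continuous_of_comp_torusMk (contDiff_torusDeriv (s := 0) (by exact_mod_cast hG) j).continuous
  obtain ⟨C, hC⟩ : ∃ C, ∀ y, ‖torusDeriv j G y‖ ≤ C := by
    obtain ⟨C, hC⟩ := isCompact_univ.exists_bound_of_continuousOn hDc.continuousOn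
    exact ⟨C, fun y => hC y (Set.mem_univ y)⟩
  have hint : ∀ f : UnitAddTorus (Fin N) → ℂ, Continuous f → Integrable f volume := fun f hf =>
    integrableOn_univ.1 (hf.continuousOn.integrableOn_compact isCompact_univ)
  have hmain := (hasDerivAt_integral_of_dominated_loc_of_deriv_le (μ := volume) (s := Set.univ)
    (x₀ := (0 : ℝ)) (bound := fun _ => C)
    (F := fun (t : ℝ) y => mFourier (-k) y • G (y + Pi.single j (t : UnitAddCircle)))
    (F' := fun (t : ℝ) y => mFourier (-k) y • torusDeriv j G (y + Pi.single j (t : UnitAddCircle)))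
    univ_mem
    (Eventually.of_forall fun t => (hint _ (by fun_prop)).aestronglyMeasurable)
    (hint _ (by fun_prop)) (hint _ (by fun_prop)).aestronglyMeasurable
    (Eventually.of_forall fun y t _ => ?_) (integrable_const C)
    (Eventually.of_forall fun y t _ => ?_)).2
  · have h1 : (fun t : ℝ => ∫ y, mFourier (-k) y • G (y + Pi.single j (t : UnitAddCircle))) =
        fun t : ℝ => Complex.exp (2 * Real.pi * Complex.I * k j * t) * mFourierCoeff G k :=
      funext fun t => mFourierCoeff_translate G k j t
    have h2 : HasDerivAt (fun t : ℝ => Complex.exp (2 * Real.pi * Complex.I * k j * t) *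
        mFourierCoeff G k) (2 * Real.pi * Complex.I * k j * mFourierCoeff G k) 0 := by
      have h3 : HasDerivAt (fun t : ℝ => 2 * Real.pi * Complex.I * k j * (t : ℂ))
          (2 * Real.pi * Complex.I * k j) 0 := by
        simpa using (Complex.ofRealCLM.hasDerivAt (x := (0 : ℝ))).const_mul
          (2 * Real.pi * Complex.I * k j)
      simpa using h3.cexp.mul_const (mFourierCoeff G k)
    rw [h1] at hmain
    have h4 := hmain.unique h2
    rw [← h4, mFourierCoeff]
    simp
  · rw [norm_smul]
    have : ‖mFourier (-k) y‖ ≤ 1 := ((mFourier (-k)).norm_coe_le_norm y).trans mFourier_norm.le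
    calc _ ≤ 1 * C := by gcongr; exact hC _
      _ = C := one_mul C
  · exact (hasDerivAt_torus_translate hd y j t).const_smul (mFourier (-k) y)

theorem summable_sq_mFourierCoeff {G : UnitAddTorus (Fin N) → ℂ} (hG : Continuous G) :
    Summable fun k : Fin N → ℤ => ‖mFourierCoeff G k‖ ^ 2 := by
  have h := (hasSum_sq_mFourierCoeff
    (ContinuousMap.toLp 2 volume ℂ (⟨G, hG⟩ : C(UnitAddTorus (Fin N), ℂ)))).summable
  refine h.congr fun k => ?_
  rw [mFourierCoeff_toLp]
  rfl

/-- Square summability of the coefficients, applied to the `s`-th partial derivative in the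
direction `j`. -/
theorem summable_pow_mul_sq_mFourierCoeff {s : ℕ} {G : UnitAddTorus (Fin N) → ℂ}
    (hG : ContDiff ℝ s (G ∘ torusMk)) (j : Fin N) :
    Summable fun k : Fin N → ℤ => (|(k j : ℝ)| ^ s * ‖mFourierCoeff G k‖) ^ 2 := by
  induction s generalizing G with
  | zero =>
    simpa using summable_sq_mFourierCoeff (continuous_of_comp_torusMk hG.continuous)
  | succ s ih =>
    refine Summable.of_nonneg_of_le (fun k => sq_nonneg _) (fun k => ?_)
      (ih (contDiff_torusDeriv hG j))
    rw [mFourierCoeff_torusDeriv (hG.of_le (by norm_cast; omega)), norm_mul]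
    have h1 : |(k j : ℝ)| ≤ ‖2 * Real.pi * Complex.I * (k j : ℂ)‖ := by
      rw [norm_mul, norm_mul, norm_mul, Complex.norm_I, Complex.norm_real, Complex.norm_intCast]
      have := Real.pi_gt_three
      have h2 : |(k j : ℝ)| = 1 * |(k j : ℝ)| := (one_mul _).symm
      conv_lhs => rw [h2]
      gcongr
      rw [Real.norm_of_nonneg Real.pi_pos.le]
      norm_num
      linarith
    have h0 : 0 ≤ |(k j : ℝ)| ^ s := pow_nonneg (abs_nonneg _) s
    refine pow_le_pow_left₀ (mul_nonneg (pow_nonneg (abs_nonneg _) _) (norm_nonneg _)) ?_ 2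
    calc |(k j : ℝ)| ^ (s + 1) * ‖mFourierCoeff G k‖
        = |(k j : ℝ)| ^ s * (|(k j : ℝ)| * ‖mFourierCoeff G k‖) := by ring
      _ ≤ _ := mul_le_mul_of_nonneg_left (mul_le_mul_of_nonneg_right h1 (norm_nonneg _)) h0

end Fourier

theorem ENNReal.tsum_prod_pi (f : ℤ → ℝ≥0∞) (N : ℕ) :
    ∑' k : Fin N → ℤ, ∏ j, f (k j) = (∑' m, f m) ^ N := by
  induction N with
  | zero => simp
  | succ N ih =>
    rw [← (Fin.consEquiv fun _ => ℤ).tsum_eq, ENNReal.tsum_prod', pow_succ, ← ih, mul_comm,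
      ← ENNReal.tsum_mul_right]
    refine tsum_congr fun m => ?_
    rw [← ENNReal.tsum_mul_left]
    refine tsum_congr fun k => ?_
    rw [Fin.prod_univ_succ]
    rfl

/-- The size of a frequency vector. -/
def freqSize {N : ℕ} (k : Fin N → ℤ) : ℕ := ∑ j, (k j).natAbs + 1

/-! ### Absolute convergence with quadratic weights -/

section FourierSum

open UnitAddTorus

variable {N : ℕ}

/-- The power mean inequality for the `N + 1` numbers `1, |k_1|, …, |k_N|`. -/
theorem freqSize_pow_le (k : Fin N → ℤ) (p : ℕ) :
    (freqSize k : ℝ) ^ (p + 1) ≤ ((N : ℝ) + 1) ^ p * (1 + ∑ j, |(k j : ℝ)| ^ (p + 1)) := by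
  have h := pow_sum_div_card_le_sum_pow (s := Finset.univ)
    (f := (Fin.cons 1 fun j => |(k j : ℝ)| : Fin (N + 1) → ℝ))
    (fun i _ => by refine Fin.cases ?_ (fun j => ?_) i <;> simp) p
  rw [Finset.card_univ, Fintype.card_fin, div_le_iff₀ (by positivity)] at h
  simp only [Fin.sum_univ_succ, Fin.cons_zero, Fin.cons_succ, one_pow] at h
  rw [mul_comm]
  push_cast at h
  refine le_trans (le_of_eq ?_) h
  rw [freqSize]
  push_cast
  simp only [Nat.cast_natAbs, Int.cast_abs]
  rw [add_comm]

theorem summable_inv_one_add_abs_sq : Summable fun m : ℤ => ((1 + |(m : ℝ)|) ^ 2)⁻¹ := by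
  refine Summable.of_nonneg_of_le (fun m => by positivity) (fun m => ?_)
    ((Real.summable_one_div_int_pow (p := 2).2 (by norm_num)).add
      (hasSum_ite_eq (0 : ℤ) (1 : ℝ)).summable)
  rcases eq_or_ne m 0 with rfl | h
  · simp
  · simp only [h, if_false, add_zero, one_div]
    have h1 : (m : ℝ) ^ 2 = |(m : ℝ)| ^ 2 := (sq_abs _).symm
    have h2 : 0 < |(m : ℝ)| := by positivity
    rw [h1]
    gcongr
    linarith

/-- With `L = freqSize k`, split `|c| L² = (L^(N+2) |c|) * L^(-N)`. The squares of the first factor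
are summable because `G` has `N + 2` derivatives; those of the second are at most `∏ (1 +
|k_j|)^(-2)`, a product of summable series. -/
theorem tsum_freqSize_sq_mul_ne_top {G : UnitAddTorus (Fin N) → ℂ}
    (hG : ContDiff ℝ (N + 2 : ℕ) (G ∘ torusMk)) :
    ∑' k, ‖mFourierCoeff G k‖ₑ * (freqSize k : ℝ≥0∞) ^ 2 ≠ ⊤ := by
  set c := mFourierCoeff G
  set a : (Fin N → ℤ) → ℝ := fun k => ((freqSize k : ℝ) ^ (N + 2) * ‖c k‖) ^ 2 with ha
  have hsa : Summable a := by
    have h1 := summable_sq_mFourierCoeff (continuous_of_comp_torusMk hG.continuous)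
    have h2 : Summable fun k : Fin N → ℤ => ∑ j, (|(k j : ℝ)| ^ (N + 2) * ‖c k‖) ^ 2 :=
      summable_sum fun j _ => summable_pow_mul_sq_mFourierCoeff hG j
    refine Summable.of_nonneg_of_le (fun k => sq_nonneg _) (fun k => ?_)
      ((h1.add h2).mul_left (((N : ℝ) + 1) ^ (2 * N + 3)))
    -- The exponent `2 * N + 3 + 1` is twice `N + 2`.
    have h3 := freqSize_pow_le k (2 * N + 3)
    calc a k = (freqSize k : ℝ) ^ (2 * N + 3 + 1) * ‖c k‖ ^ 2 := by
          rw [ha]; simp only; rw [mul_pow, ← pow_mul]; ring_nf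
      _ ≤ ((N : ℝ) + 1) ^ (2 * N + 3) * (1 + ∑ j, |(k j : ℝ)| ^ (2 * N + 3 + 1)) * ‖c k‖ ^ 2 := by
          gcongr
      _ = _ := by
          rw [mul_assoc, add_mul, one_mul, Finset.sum_mul]
          congr 2
          refine Finset.sum_congr rfl fun j _ => ?_
          rw [mul_pow, ← pow_mul]
          ring_nf
  have hterm : ∀ k, ‖c k‖ₑ * (freqSize k : ℝ≥0∞) ^ 2 ≤
      ENNReal.ofReal (a k) + ∏ j, ENNReal.ofReal (((1 + |(k j : ℝ)|) ^ 2)⁻¹) := by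
    intro k
    have hL : 0 < (freqSize k : ℝ) := by exact_mod_cast Nat.succ_pos _
    have h1 : ‖c k‖ₑ * (freqSize k : ℝ≥0∞) ^ 2 = ENNReal.ofReal (‖c k‖ * (freqSize k : ℝ) ^ 2) := by
      rw [ENNReal.ofReal_mul (norm_nonneg _), ofReal_norm, ENNReal.ofReal_pow hL.le,
        ENNReal.ofReal_natCast]
    rw [h1, ← ENNReal.ofReal_prod_of_nonneg (fun j _ => by positivity),
      ← ENNReal.ofReal_add (sq_nonneg _) (Finset.prod_nonneg fun j _ => by positivity)]
    refine ENNReal.ofReal_le_ofReal ?_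
    have h2 : ((freqSize k : ℝ) ^ N)⁻¹ ^ 2 ≤ ∏ j, ((1 + |(k j : ℝ)|) ^ 2)⁻¹ := by
      calc ((freqSize k : ℝ) ^ N)⁻¹ ^ 2 = ∏ _j : Fin N, ((freqSize k : ℝ) ^ 2)⁻¹ := by
            rw [Finset.prod_const, Finset.card_univ, Fintype.card_fin, inv_pow, inv_pow, ← pow_mul,
              ← pow_mul, mul_comm]
        _ ≤ _ := by
            refine Finset.prod_le_prod (fun j _ => by positivity) fun j _ => ?_
            have h3 : 1 + |(k j : ℝ)| ≤ freqSize k := by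
              rw [freqSize]
              push_cast
              simp only [Nat.cast_natAbs, Int.cast_abs]
              have := Finset.single_le_sum (f := fun j => |(k j : ℝ)|) (fun i _ => abs_nonneg _)
                (Finset.mem_univ j)
              linarith
            gcongr
    refine le_trans ?_ (add_le_add_right h2 _)
    have h4 : ‖c k‖ * (freqSize k : ℝ) ^ 2 =
        ((freqSize k : ℝ) ^ (N + 2) * ‖c k‖) * ((freqSize k : ℝ) ^ N)⁻¹ := by
      rw [pow_add]
      field_simp
    rw [h4]
    nlinarith [sq_nonneg ((freqSize k : ℝ) ^ (N + 2) * ‖c k‖),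
      sq_nonneg (((freqSize k : ℝ) ^ N)⁻¹), sq_nonneg ((freqSize k : ℝ) ^ (N + 2) * ‖c k‖ -
        ((freqSize k : ℝ) ^ N)⁻¹)]
  refine ne_top_of_le_ne_top ?_ (ENNReal.tsum_le_tsum hterm)
  rw [ENNReal.tsum_add, ENNReal.tsum_prod_pi (fun m => ENNReal.ofReal (((1 + |(m : ℝ)|) ^ 2)⁻¹))]
  exact ENNReal.add_ne_top.2 ⟨hsa.tsum_ofReal_ne_top,
    ENNReal.pow_ne_top summable_inv_one_add_abs_sq.tsum_ofReal_ne_top⟩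

/-- The absolutely convergent Fourier expansion, with quadratic weights, of a periodic function
obtained from a function of sufficient smoothness. -/
theorem exists_fourier_expansion {F : (Fin N → ℝ) → ℂ} (hF : ContDiff ℝ (N + 2 : ℕ) F) :
    ∃ c : (Fin N → ℤ) → ℂ, ∑' k, ‖c k‖ₑ * (freqSize k : ℝ≥0∞) ^ 2 ≠ ⊤ ∧
      ∀ x : Fin N → ℝ, HasSum
        (fun k => c k * Complex.exp (∑ j, 2 * Real.pi * Complex.I * k j * x j))
        (F fun j => Real.sin (2 * Real.pi * x j)) := by
  have hfour : ∀ (m : ℤ) (x : ℝ), fourier m (x : UnitAddCircle) =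
      Complex.exp (2 * Real.pi * Complex.I * m * x) := fun m x => by
    rw [fourier_coe_apply]
    simp
  -- Precomposition with sines makes an arbitrary `F` periodic without any condition on its support.
  set G : UnitAddTorus (Fin N) → ℂ := fun y => F fun j => (fourier 1 (y j)).im with hG
  have hGF : ∀ x : Fin N → ℝ, G (torusMk x) = F fun j => Real.sin (2 * Real.pi * x j) := by
    intro x
    rw [hG]
    simp only [torusMk, hfour]
    congr 1
    ext j
    have : (2 * Real.pi * Complex.I * ((1 : ℤ) : ℂ) * x j : ℂ) =
        ((2 * Real.pi * x j : ℝ) : ℂ) * Complex.I := by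
      push_cast; ring
    rw [this, Complex.exp_ofReal_mul_I_im]
  have hcd : ContDiff ℝ (N + 2 : ℕ) (G ∘ torusMk) := by
    have : G ∘ torusMk = F ∘ fun x j => Real.sin (2 * Real.pi * x j) := funext hGF
    rw [this]
    refine hF.comp (contDiff_pi.2 fun j => ?_)
    exact Real.contDiff_sin.comp (contDiff_const.mul (contDiff_apply ℝ ℝ j))
  have hGc := continuous_of_comp_torusMk hcd.continuous
  have hne := tsum_freqSize_sq_mul_ne_top hcd
  refine ⟨mFourierCoeff G, hne, fun x => ?_⟩
  have hsum : Summable (mFourierCoeff G) := by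
    refine Summable.of_norm ?_
    have h1 : ∑' k, ‖mFourierCoeff G k‖ₑ ≠ ⊤ := by
      refine ne_top_of_le_ne_top hne (ENNReal.tsum_le_tsum fun k => ?_)
      have h2 : (1 : ℝ≥0∞) ≤ (freqSize k : ℝ≥0∞) ^ 2 :=
        one_le_pow₀ (by exact_mod_cast Nat.succ_le_succ (Nat.zero_le _))
      calc _ = ‖mFourierCoeff G k‖ₑ * 1 := (mul_one _).symm
        _ ≤ _ := by gcongr
    simpa using ENNReal.summable_toReal h1
  have h := hasSum_mFourier_series_apply_of_summable (f := (⟨G, hGc⟩ : C(UnitAddTorus (Fin N), ℂ)))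
    hsum (torusMk x)
  rw [ContinuousMap.coe_mk, hGF] at h
  refine h.congr_fun fun k => ?_
  rw [smul_eq_mul, mFourier, ContinuousMap.coe_mk, Complex.exp_sum]
  congr 1
  exact Finset.prod_congr rfl fun j _ => (hfour _ _).symm

end FourierSum

/-! ### Functional calculus in the smooth algebra -/

namespace JetGauge

theorem N_sum_le {A : Type*} [NormedRing A] [NormedAlgebra ℂ A] (W : JetGauge A) (i : ℕ)
    {ι : Type*} (s : Finset ι) (f : ι → A) : W.N i (∑ j ∈ s, f j) ≤ ∑ j ∈ s, W.N i (f j) :=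
  Finset.le_sum_of_subadditive (W.N i) (W.N_zero i).le (W.N_add_le i) s f

theorem _root_.ContinuousMap.exp_apply_eq {M : Type*} [TopologicalSpace M] [CompactSpace M]
    (a : C(M, ℂ)) (x : M) : NormedSpace.exp a x = Complex.exp (a x) := by
  have h := NormedSpace.map_exp (ContinuousMap.evalAlgHom ℂ ℂ x)
    (by exact ContinuousEvalConst.continuous_eval_const x) a
  rw [Complex.exp_eq_exp_ℂ]
  exact h

variable {M : Type*} [TopologicalSpace M] [CompactSpace M] (W : JetGauge C(M, ℂ))

theorem mem_smooth_of_hasSum {ι : Type*} [Encodable ι] {f : ι → C(M, ℂ)} {b : C(M, ℂ)}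
    (hN : ∀ i, ∑' k, W.N i (f k) ≠ ⊤) (hf : HasSum f b) : b ∈ W.smooth := by
  have hinj : Function.Injective (Encodable.encode : ι → ℕ) := Encodable.encode_injective
  refine W.mem_smooth_of_tendsto (a := Function.extend Encodable.encode f 0) (fun i => ?_)
    ((hasSum_extend_zero hinj).2 hf).tendsto_sum_nat
  have h : (fun m => W.N i (Function.extend Encodable.encode f 0 m)) =
      Function.extend Encodable.encode (fun k => W.N i (f k)) 0 := by
    ext m
    by_cases hm : ∃ k : ι, Encodable.encode k = m
    · obtain ⟨k, rfl⟩ := hm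
      rw [hinj.extend_apply, hinj.extend_apply]
    · rw [Function.extend_apply' _ _ _ hm, Function.extend_apply' _ _ _ hm]
      exact W.N_zero i
  rw [h, tsum_extend_zero hinj]
  exact hN i

/-- Smooth functions of finitely many real elements of the smooth subalgebra are smooth. -/
theorem mem_smooth_of_eq_sin {N : ℕ} {a : Fin N → C(M, ℂ)} (ha : ∀ j, a j ∈ W.smooth)
    (hr : ∀ j x, (a j x).im = 0) {F : (Fin N → ℝ) → ℂ} (hF : ContDiff ℝ (N + 2 : ℕ) F)
    {b : C(M, ℂ)} (hb : ∀ x, b x = F fun j => Real.sin (2 * Real.pi * (a j x).re)) :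
    b ∈ W.smooth := by
  obtain ⟨c, hc, hsum⟩ := exists_fourier_expansion hF
  -- The phase of the `k`-th Fourier mode divided by the size of `k`: its seminorms are bounded
  -- uniformly in `k`, and the mode itself is the `freqSize k`-th power of a unimodular exponential.
  set q : (Fin N → ℤ) → C(M, ℂ) := fun k =>
    ∑ j, (2 * Real.pi * Complex.I * k j / freqSize k : ℂ) • a j with hq
  have hL : ∀ k : Fin N → ℤ, (freqSize k : ℂ) ≠ 0 := fun k => by
    exact Nat.cast_ne_zero.2 (Nat.succ_ne_zero _)
  have hexp : ∀ k x, NormedSpace.exp ((freqSize k : ℂ) • q k) x =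
      Complex.exp (∑ j, 2 * Real.pi * Complex.I * k j * ((a j x).re : ℂ)) := by
    intro k x
    rw [ContinuousMap.exp_apply_eq, hq]
    congr 1
    simp only [ContinuousMap.smul_apply, ContinuousMap.sum_apply, smul_eq_mul, Finset.mul_sum]
    refine Finset.sum_congr rfl fun j _ => ?_
    have h1 : a j x = ((a j x).re : ℂ) := Complex.ext rfl (by simpa using hr j x)
    rw [← h1, ← mul_assoc, mul_div_cancel₀ _ (hL k)]
  have hphase : ∀ (k : Fin N → ℤ) (y : Fin N → ℝ) (s : ℝ),
      ‖Complex.exp (∑ j, (2 * Real.pi * Complex.I * k j / (s : ℂ)) * (y j : ℂ))‖ = 1 := by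
    intro k y s
    have : ∑ j, (2 * Real.pi * Complex.I * k j / (s : ℂ)) * (y j : ℂ) =
        ((∑ j, 2 * Real.pi * k j / s * y j : ℝ) : ℂ) * Complex.I := by
      push_cast
      rw [Finset.sum_mul]
      exact Finset.sum_congr rfl fun j _ => by ring
    rw [this, Complex.norm_exp_ofReal_mul_I]
  have hq1 : ∀ k, ‖NormedSpace.exp (q k)‖ ≤ 1 := by
    intro k
    refine (ContinuousMap.norm_le _ zero_le_one).2 fun x => ?_
    rw [ContinuousMap.exp_apply_eq, hq]
    simp only [ContinuousMap.smul_apply, ContinuousMap.sum_apply, smul_eq_mul]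
    have := hphase k (fun j => (a j x).re) (freqSize k)
    refine le_of_eq (Eq.trans ?_ this)
    congr 2
    refine Finset.sum_congr rfl fun j _ => ?_
    have h1 : a j x = ((a j x).re : ℂ) := Complex.ext rfl (by simpa using hr j x)
    rw [← h1]
    simp
  have hu1 : ∀ k, ‖NormedSpace.exp ((freqSize k : ℂ) • q k)‖ ≤ 1 := by
    intro k
    refine (ContinuousMap.norm_le _ zero_le_one).2 fun x => ?_
    rw [hexp]
    have := hphase k (fun j => (a j x).re) 1
    simp only [Complex.ofReal_one, div_one] at this
    exact this.le
  have hqs : ∀ k, q k ∈ W.smooth := fun k =>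
    W.smooth.sum_mem fun j _ => W.smooth.smul_mem (ha j) _
  have hqN : ∀ i k, W.N i (q k) ≤ ENNReal.ofReal (2 * Real.pi) * ∑ j, W.N i (a j) := by
    intro i k
    refine (W.N_sum_le i _ _).trans ?_
    rw [Finset.mul_sum]
    refine Finset.sum_le_sum fun j _ => (W.N_smul_le i _ _).trans ?_
    gcongr
    rw [← ofReal_norm]
    refine ENNReal.ofReal_le_ofReal ?_
    rw [norm_div, norm_mul, norm_mul, norm_mul, Complex.norm_I, Complex.norm_real,
      Complex.norm_intCast, Real.norm_of_nonneg Real.pi_pos.le, Complex.norm_natCast]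
    have h1 : |(k j : ℝ)| ≤ freqSize k := by
      rw [← Int.cast_abs, Int.abs_eq_natAbs]
      have : (k j).natAbs ≤ freqSize k :=
        (Finset.single_le_sum (f := fun j => (k j).natAbs) (fun _ _ => Nat.zero_le _)
          (Finset.mem_univ j)).trans (Nat.le_succ _)
      exact_mod_cast this
    have h2 : (0 : ℝ) < freqSize k := by exact_mod_cast Nat.succ_pos _
    rw [div_le_iff₀ h2]
    have := Real.pi_pos
    simp only [RCLike.norm_ofNat, mul_one]
    gcongr
  refine W.mem_smooth_of_hasSum (f := fun k => c k • NormedSpace.exp ((freqSize k : ℂ) • q k))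
    (fun i => ?_) ?_
  · have hS : ENNReal.ofReal (2 * Real.pi) * ∑ j, W.N i (a j) ≠ ⊤ :=
      ENNReal.mul_ne_top ENNReal.ofReal_ne_top
        (ENNReal.sum_ne_top.2 fun j _ => (W.mem_smooth.1 (ha j)) i)
    obtain ⟨C, hC, h⟩ := W.exists_N_exp_le i
      (ENNReal.toReal_nonneg (a := ENNReal.ofReal (2 * Real.pi) * ∑ j, W.N i (a j)))
    refine ne_top_of_le_ne_top (ENNReal.mul_ne_top hC hc) ?_
    rw [← ENNReal.tsum_mul_left]
    refine ENNReal.tsum_le_tsum fun k => (W.N_smul_le i _ _).trans ?_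
    -- Here `L + 1` is `freqSize k` by definition.
    have := h (∑ j, (k j).natAbs) (q k) (hqs k)
      (by rw [ENNReal.ofReal_toReal hS]; exact hqN i k) (hq1 k)
    calc _ ≤ ‖c k‖ₑ * (C * (freqSize k : ℝ≥0∞) ^ 2) := by gcongr; exact this
      _ = _ := by ring
  · have hsc : Summable fun k => ‖c k‖ := by
      have h1 : ∑' k, ‖c k‖ₑ ≠ ⊤ := by
        refine ne_top_of_le_ne_top hc (ENNReal.tsum_le_tsum fun k => ?_)
        have h2 : (1 : ℝ≥0∞) ≤ (freqSize k : ℝ≥0∞) ^ 2 :=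
          one_le_pow₀ (by exact_mod_cast Nat.succ_le_succ (Nat.zero_le _))
        calc _ = ‖c k‖ₑ * 1 := (mul_one _).symm
          _ ≤ _ := by gcongr
      simpa using ENNReal.summable_toReal h1
    have hs : Summable fun k => c k • NormedSpace.exp ((freqSize k : ℂ) • q k) := by
      refine Summable.of_norm_bounded hsc fun k => (norm_smul_le _ _).trans ?_
      exact mul_le_of_le_one_right (norm_nonneg _) (hu1 k)
    obtain ⟨t, ht⟩ := hs
    convert ht
    ext x
    rw [hb x]
    refine (hsum fun j => (a j x).re).unique ?_
    have := ContinuousMap.hasSum_apply ht x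
    refine this.congr_fun fun k => ?_
    rw [ContinuousMap.smul_apply, hexp, smul_eq_mul]

end JetGauge

/-! ### Local Hölder classes and composition with smooth maps -/

section IsClassAt

variable {E F G : Type} [NormedAddCommGroup E] [NormedSpace ℝ E]
  [NormedAddCommGroup F] [NormedSpace ℝ F] [NormedAddCommGroup G] [NormedSpace ℝ G]

/-- Hölder continuity of exponent `α` on some neighbourhood of a point. -/
def IsHolderNear {X Y : Type} [PseudoEMetricSpace X] [PseudoEMetricSpace Y]
    (α : ℝ≥0) (f : X → Y) (x : X) : Prop :=
  ∃ V ∈ 𝓝 x, ∃ C : ℝ≥0, HolderOnWith C α f V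

/-- The function `f` is of class `C^(m + α)` near `x`. -/
def IsClassAt (m : ℕ) (α : ℝ≥0) (f : E → F) (x : E) : Prop :=
  ContDiffAt ℝ m f x ∧ IsHolderNear α (iteratedFDeriv ℝ m f) x

theorem IsHolderNear.congr {X Y : Type} [PseudoEMetricSpace X] [PseudoEMetricSpace Y]
    {α : ℝ≥0} {f g : X → Y} {x : X} (h : IsHolderNear α f x) (hfg : f =ᶠ[𝓝 x] g) :
    IsHolderNear α g x := by
  obtain ⟨V, hV, C, hC⟩ := h
  refine ⟨V ∩ {y | f y = g y}, inter_mem hV hfg, C, fun y hy z hz => ?_⟩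
  rw [← hy.2, ← hz.2]
  exact hC y hy.1 z hz.1

theorem IsHolderNear.comp_left {X : Type} [PseudoEMetricSpace X]
    {α : ℝ≥0} {f : X → F} {x : X} (h : IsHolderNear α f x) (hc : ContinuousAt f x)
    {g : F → G} (hg : ∃ K : ℝ≥0, ∃ t ∈ 𝓝 (f x), LipschitzOnWith K g t) :
    IsHolderNear α (g ∘ f) x := by
  obtain ⟨V, hV, C, hC⟩ := h
  obtain ⟨K, t, ht, hK⟩ := hg
  have := (LipschitzOnWith.holderOnWith hK).comp (hC.mono (t := V ∩ f ⁻¹' t) fun y hy => hy.1)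
    fun y hy => hy.2
  rw [one_mul] at this
  exact ⟨_, inter_mem hV (hc ht), _, this⟩

theorem isHolderNear_of_lipschitz {X Y : Type} [PseudoMetricSpace X] [PseudoEMetricSpace Y]
    {α : ℝ≥0} (hα : α ≤ 1) {f : X → Y} {x : X} {K : ℝ≥0} {t : Set X} (ht : t ∈ 𝓝 x)
    (hK : LipschitzOnWith K f t) : IsHolderNear α f x := by
  refine ⟨t ∩ Metric.ball x 1, inter_mem ht (Metric.ball_mem_nhds x one_pos), _,
    ((LipschitzOnWith.holderOnWith hK).mono Set.inter_subset_left).of_le (D := 2)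
      (fun y hy z hz => ?_) hα⟩
  have h1 : dist y z ≤ 2 := by
    have := dist_triangle_right y z x
    have h2 := Metric.mem_ball.1 hy.2
    have h3 := Metric.mem_ball.1 hz.2
    linarith
  rw [edist_dist]
  exact (ENNReal.ofReal_le_ofReal h1).trans (by norm_num)

theorem isClassAt_zero {α : ℝ≥0} {f : E → F} {x : E} :
    IsClassAt 0 α f x ↔ ContDiffAt ℝ 0 f x ∧ IsHolderNear α f x := by
  refine and_congr (by norm_num) ?_
  have : ∀ (C : ℝ≥0) V, HolderOnWith C α (iteratedFDeriv ℝ 0 f) V ↔ HolderOnWith C α f V := by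
    intro C V
    rw [iteratedFDeriv_zero_eq_comp]
    simp only [HolderOnWith, Function.comp_apply, LinearIsometryEquiv.edist_map]
  simp only [IsHolderNear, this]

/-- Passage to the first derivative, which permits induction on the integral part of the order. -/
theorem isClassAt_succ {m : ℕ} {α : ℝ≥0} {f : E → F} {x : E} :
    IsClassAt (m + 1) α f x ↔
      (∀ᶠ y in 𝓝 x, DifferentiableAt ℝ f y) ∧ IsClassAt m α (fderiv ℝ f) x := by
  have : IsHolderNear α (iteratedFDeriv ℝ (m + 1) f) x ↔
      IsHolderNear α (iteratedFDeriv ℝ m (fderiv ℝ f)) x := by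
    have h : iteratedFDeriv ℝ (m + 1) f = (continuousMultilinearCurryRightEquiv' ℝ m E F).symm ∘
        iteratedFDeriv ℝ m (fderiv ℝ f) := funext fun y => iteratedFDeriv_succ_eq_comp_right
    rw [h]
    simp only [IsHolderNear, HolderOnWith, Function.comp_apply, LinearIsometryEquiv.edist_map]
  rw [IsClassAt, IsClassAt, this, ← and_assoc]
  refine and_congr_left fun _ => ?_
  push_cast
  constructor
  · intro h
    refine ⟨?_, h.fderiv_right_succ⟩
    filter_upwards [(h.of_le (by simp) : ContDiffAt ℝ 1 f x).eventually (by simp)] with y hy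
      using hy.differentiableAt one_ne_zero
  · rintro ⟨h1, h2⟩
    exact contDiffAt_succ_iff_hasFDerivAt.2
      ⟨fderiv ℝ f, ⟨_, h1, fun y hy => DifferentiableAt.hasFDerivAt hy⟩, h2⟩

theorem IsClassAt.congr {m : ℕ} {α : ℝ≥0} {f g : E → F} {x : E} (h : IsClassAt m α f x)
    (hfg : f =ᶠ[𝓝 x] g) : IsClassAt m α g x :=
  ⟨h.1.congr_of_eventuallyEq hfg.symm, h.2.congr (hfg.iteratedFDeriv ℝ m)⟩

theorem isClassAt_of_contDiffAt {m : ℕ} {α : ℝ≥0} (hα : α ≤ 1) {f : E → F} {x : E}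
    (h : ContDiffAt ℝ (m + 1 : ℕ) f x) : IsClassAt m α f x := by
  refine ⟨h.of_le (by norm_cast; omega), ?_⟩
  obtain ⟨K, t, ht, hK⟩ := (h.iteratedFDeriv_right (m := 1) (i := m)
    (by norm_cast; omega)).exists_lipschitzOnWith
  exact isHolderNear_of_lipschitz hα ht hK

theorem IsClassAt.of_succ {m : ℕ} {α : ℝ≥0} (hα : α ≤ 1) {f : E → F} {x : E}
    (h : IsClassAt (m + 1) α f x) : IsClassAt m α f x :=
  isClassAt_of_contDiffAt hα h.1

theorem IsHolderNear.prodMk {X Y Z : Type} [PseudoEMetricSpace X] [PseudoEMetricSpace Y]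
    [PseudoEMetricSpace Z] {α : ℝ≥0} {f : X → Y} {g : X → Z} {x : X} (hf : IsHolderNear α f x)
    (hg : IsHolderNear α g x) : IsHolderNear α (fun y => (f y, g y)) x := by
  obtain ⟨V, hV, C, hC⟩ := hf
  obtain ⟨V', hV', C', hC'⟩ := hg
  refine ⟨V ∩ V', inter_mem hV hV', max C C', fun y hy z hz => ?_⟩
  rw [Prod.edist_eq]
  exact max_le ((hC.mono_const (le_max_left _ _)) y hy.1 z hz.1)
    ((hC'.mono_const (le_max_right _ _)) y hy.2 z hz.2)

theorem IsClassAt.prodMk {m : ℕ} {α : ℝ≥0} {f : E → F} {g : E → G} {x : E}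
    (hf : IsClassAt m α f x) (hg : IsClassAt m α g x) :
    IsClassAt m α (fun y => (f y, g y)) x := by
  refine ⟨hf.1.prodMk hg.1, ?_⟩
  have h1 : (ContinuousMultilinearMap.prodL ℝ (fun _ : Fin m => E) F G) ∘
      (fun y => (iteratedFDeriv ℝ m f y, iteratedFDeriv ℝ m g y)) =ᶠ[𝓝 x]
      iteratedFDeriv ℝ m (fun y => (f y, g y)) := by
    filter_upwards [hf.1.eventually (by simp), hg.1.eventually (by simp)] with y hy hy'
    exact (iteratedFDeriv_prodMk hy hy' le_rfl).symm
  refine IsHolderNear.congr ?_ h1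
  have := hf.2.prodMk hg.2
  simpa only [IsHolderNear, HolderOnWith, Function.comp_apply, LinearIsometryEquiv.edist_map]
    using this

/-- Left composition with a smooth map preserves the class `C^(m + α)`. -/
theorem IsClassAt.contDiff_comp {m : ℕ} {α : ℝ≥0} (hα : α ≤ 1) {g : E → F} {x : E}
    (hg : IsClassAt m α g x) {η : F → G} (hη : ContDiff ℝ (⊤ : ℕ∞) η) :
    IsClassAt m α (η ∘ g) x := by
  induction m generalizing F G with
  | zero =>
    rw [isClassAt_zero] at hg ⊢
    refine ⟨(hη.of_le (by simp)).contDiffAt.comp x hg.1, hg.2.comp_left hg.1.continuousAt ?_⟩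
    exact (hη.of_le (by exact_mod_cast le_top) : ContDiff ℝ 1 η).contDiffAt.exists_lipschitzOnWith
  | succ m ih =>
    have hg' := isClassAt_succ.1 hg
    have hd : Differentiable ℝ η := hη.differentiable (by simp)
    refine isClassAt_succ.2 ⟨?_, ?_⟩
    · filter_upwards [hg'.1] with y hy
      exact (hd _).comp y hy
    · have hΦ : ContDiff ℝ (⊤ : ℕ∞) fun p : F × (E →L[ℝ] F) => (fderiv ℝ η p.1).comp p.2 :=
        ((hη.fderiv_right (m := (⊤ : ℕ∞)) (by simp)).comp contDiff_fst).clm_comp contDiff_snd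
      refine (ih ((hg.of_succ hα).prodMk hg'.2) hΦ).congr ?_
      filter_upwards [hg'.1] with y hy
      exact (fderiv_comp y (hd _) hy).symm

end IsClassAt

theorem isClassOn_iff_isClassAt {E F : Type} [NormedAddCommGroup E] [NormedSpace ℝ E]
    [NormedAddCommGroup F] [NormedSpace ℝ F] {r : ℝ≥0} {f : E → F} {U : Set E} (hU : IsOpen U) :
    IsClassOn r f U ↔ ∀ x ∈ U, IsClassAt ⌊r⌋₊ (r - (⌊r⌋₊ : ℝ≥0)) f x := by
  constructor
  · exact fun h x hx => ⟨h.1.contDiffAt (hU.mem_nhds hx), h.2 x hx⟩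
  · exact fun h => ⟨fun x hx => (h x hx).1.contDiffWithinAt, fun x hx => (h x hx).2⟩

theorem sub_floor_le_one (r : ℝ≥0) : r - (⌊r⌋₊ : ℝ≥0) ≤ 1 := by
  rw [tsub_le_iff_right, add_comm]
  exact (Nat.lt_floor_add_one r).le

/-! ### Functions supported in a chart -/

section Bump

variable {n : ℕ} {M : Type*} [TopologicalSpace M] [ChartedSpace (EuclideanSpace ℝ (Fin n)) M]

theorem one_mem_classFunctions (r : ℝ≥0) : (1 : C(M, ℂ)) ∈ classFunctions n r := by
  intro e he
  refine (isClassOn_iff_isClassAt e.open_target).2 fun x hx => ?_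
  exact isClassAt_of_contDiffAt (sub_floor_le_one r) contDiffAt_const

/-- A smooth function with compact support in the target of a chart, transported to the manifold
and extended by zero. -/
def chartExtend (e : OpenPartialHomeomorph M (EuclideanSpace ℝ (Fin n)))
    (η : EuclideanSpace ℝ (Fin n) → ℂ) (x : M) : ℂ :=
  open Classical in if x ∈ e.source then η (e x) else 0

theorem chartExtend_apply {e : OpenPartialHomeomorph M (EuclideanSpace ℝ (Fin n))}
    {η : EuclideanSpace ℝ (Fin n) → ℂ} {x : M} (hx : x ∈ e.source) :
    chartExtend e η x = η (e x) := if_pos hx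

theorem chartExtend_of_notMem {e : OpenPartialHomeomorph M (EuclideanSpace ℝ (Fin n))}
    {η : EuclideanSpace ℝ (Fin n) → ℂ} {x : M} (hx : x ∉ e.symm '' tsupport η) :
    chartExtend e η x = 0 := by
  unfold chartExtend
  split_ifs with h
  · by_contra h0
    exact hx ⟨e x, subset_tsupport η h0, e.left_inv h⟩
  · rfl

variable [T2Space M]

theorem isClosed_image_tsupport {e : OpenPartialHomeomorph M (EuclideanSpace ℝ (Fin n))}
    {η : EuclideanSpace ℝ (Fin n) → ℂ} (hc : HasCompactSupport η) (hs : tsupport η ⊆ e.target) :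
    IsClosed (e.symm '' tsupport η) :=
  (hc.isCompact.image_of_continuousOn (e.continuousOn_symm.mono hs)).isClosed

/-- The support has compact image in a Hausdorff space, hence closed, so the extension vanishes near
every point outside the chart. -/
theorem continuous_chartExtend {e : OpenPartialHomeomorph M (EuclideanSpace ℝ (Fin n))}
    {η : EuclideanSpace ℝ (Fin n) → ℂ} (hη : Continuous η) (hc : HasCompactSupport η)
    (hs : tsupport η ⊆ e.target) : Continuous (chartExtend e η) := by
  refine continuous_iff_continuousAt.2 fun x => ?_
  by_cases hx : x ∈ e.source
  · refine (hη.continuousAt.comp (e.continuousAt hx)).congr ?_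
    filter_upwards [e.open_source.mem_nhds hx] with y hy
    exact (chartExtend_apply hy).symm
  · have hx' : x ∉ e.symm '' tsupport η := by
      rintro ⟨y, hy, rfl⟩
      exact hx (e.map_target (hs hy))
    refine continuousAt_const.congr (f := fun _ => (0 : ℂ)) ?_
    filter_upwards [(isClosed_image_tsupport hc hs).isOpen_compl.mem_nhds hx'] with y hy
    exact (chartExtend_of_notMem hy).symm

/-- In another chart the function is locally either zero or `η` after a transition map. Only the
outer function `η` is smooth, and composition with such functions preserves `C^(r)`. -/
theorem chartExtend_mem_classFunctions {k : ℝ≥0∞} (hM : IsClassManifold n k M) {r : ℝ≥0}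
    (hr : (r : ℝ≥0∞) ≤ k) {e : OpenPartialHomeomorph M (EuclideanSpace ℝ (Fin n))}
    (he : e ∈ atlas (EuclideanSpace ℝ (Fin n)) M) {η : EuclideanSpace ℝ (Fin n) → ℂ}
    (hη : ContDiff ℝ (⊤ : ℕ∞) η) (hc : HasCompactSupport η) (hs : tsupport η ⊆ e.target) :
    (⟨chartExtend e η, continuous_chartExtend hη.continuous hc hs⟩ : C(M, ℂ)) ∈
      classFunctions n r := by
  intro e' he'
  refine (isClassOn_iff_isClassAt e'.open_target).2 fun x hx => ?_
  by_cases hxs : e'.symm x ∈ e.source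
  · have hx2 : x ∈ (e'.symm.trans e).source := by
      simp [hx, hxs]
    have h := (isClassOn_iff_isClassAt (e'.symm.trans e).open_source).1 (hM e' he' e he r hr) x hx2
    refine (h.contDiff_comp (sub_floor_le_one r) hη).congr ?_
    filter_upwards [(e'.symm.trans e).open_source.mem_nhds hx2] with y hy
    have : e'.symm y ∈ e.source := by
      simpa using (show y ∈ e'.symm.source ∩ e'.symm ⁻¹' e.source by simpa using hy).2
    exact (chartExtend_apply this).symm
  · have hx' : e'.symm x ∉ e.symm '' tsupport η := by
      rintro ⟨y, hy, h⟩
      exact hxs (h ▸ e.map_target (hs hy))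
    refine IsClassAt.congr (f := fun _ => (0 : ℂ))
      (isClassAt_of_contDiffAt (sub_floor_le_one r) contDiffAt_const) ?_
    filter_upwards [(e'.continuousAt_symm hx) ((isClosed_image_tsupport hc hs).isOpen_compl.mem_nhds
      hx')] with y hy
    exact (chartExtend_of_notMem hy).symm

end Bump

/-- Smooth bump functions equal to one near a point. -/
theorem exists_smooth_bump {V : Type} [NormedAddCommGroup V] [NormedSpace ℝ V]
    [FiniteDimensional ℝ V] {c : V} {U : Set V} (hU : U ∈ 𝓝 c) :
    ∃ ψ : V → ℝ, ContDiff ℝ (⊤ : ℕ∞) ψ ∧ HasCompactSupport ψ ∧ tsupport ψ ⊆ U ∧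
      ψ =ᶠ[𝓝 c] 1 := by
  obtain ⟨δ, hδ, hδU⟩ := Metric.nhds_basis_closedBall.mem_iff.1 hU
  let ψ : ContDiffBump c := ⟨δ / 2, δ, half_pos hδ, half_lt_self hδ⟩
  exact ⟨ψ, ψ.contDiff, ψ.hasCompactSupport, by rw [ψ.tsupport_eq]; exact hδU,
    ψ.eventuallyEq_one⟩

section RealPart

variable {M : Type*} [TopologicalSpace M]

/-- The pointwise real part of a complex continuous function. -/
def rePart (u : C(M, ℂ)) : C(M, ℂ) := (1 / 2 : ℂ) • (u + star u)

theorem rePart_apply (u : C(M, ℂ)) (x : M) : rePart u x = ((u x).re : ℂ) := by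
  have h : (starRingEnd ℂ) (u x) + u x = ((2 * (u x).re : ℝ) : ℂ) := by
    rw [add_comm, Complex.add_conj]
  simp only [rePart, ContinuousMap.smul_apply, ContinuousMap.add_apply, ContinuousMap.star_apply,
    RCLike.star_def, smul_eq_mul]
  rw [add_comm, h]
  push_cast
  ring

theorem rePart_mem [CompactSpace M] {A₀ : NonUnitalStarSubalgebra ℂ C(M, ℂ)} {u : C(M, ℂ)}
    (hu : u ∈ A₀) : rePart u ∈ A₀ :=
  SMulMemClass.smul_mem _ (add_mem hu (star_mem hu))

end RealPart

/-! ### Consequences of density -/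

section Convergence

variable {n : ℕ} {M : Type*} [TopologicalSpace M] [ChartedSpace (EuclideanSpace ℝ (Fin n)) M]

theorem ConvergesInCm.tendsto {m : ℕ} {u : ℕ → C(M, ℂ)} {f : C(M, ℂ)}
    (h : ConvergesInCm n m u f) : Tendsto u atTop (𝓝 f) := by
  refine ContinuousMap.tendsto_of_tendstoLocallyUniformly ?_
  rw [Metric.tendstoLocallyUniformly_iff]
  intro δ hδ x
  set e := chartAt (EuclideanSpace ℝ (Fin n)) x
  have hx : x ∈ e.source := mem_chart_source _ x
  obtain ⟨S, hS, hSe, hSc⟩ := local_compact_nhds (e.open_target.mem_nhds (e.map_source hx))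
  have h1 := Metric.tendstoUniformlyOn_iff.1
    (h e (chart_mem_atlas _ x) S hSe hSc 0 (Nat.zero_le m)) δ hδ
  refine ⟨e.source ∩ e ⁻¹' S, inter_mem (e.open_source.mem_nhds hx) (e.continuousAt hx hS), ?_⟩
  filter_upwards [h1] with i hi y hy
  have := hi (e y) hy.2
  simp only [iteratedFDeriv_zero_eq_comp, Function.comp_apply, LinearIsometryEquiv.dist_map,
    e.left_inv hy.1] at this
  exact this

theorem ConvergesInCm.tendsto_fderiv {m : ℕ} (hm : 1 ≤ m) {u : ℕ → C(M, ℂ)} {f : C(M, ℂ)}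
    (h : ConvergesInCm n m u f) {e : OpenPartialHomeomorph M (EuclideanSpace ℝ (Fin n))}
    (he : e ∈ atlas (EuclideanSpace ℝ (Fin n)) M) {y : EuclideanSpace ℝ (Fin n)}
    (hy : y ∈ e.target) :
    Tendsto (fun i => fderiv ℝ (u i ∘ e.symm) y) atTop (𝓝 (fderiv ℝ (f ∘ e.symm) y)) := by
  have h1 := (h e he {y} (by simpa using hy) isCompact_singleton 1 hm).tendsto_at rfl
  rw [Metric.tendsto_nhds] at h1 ⊢
  have h2 : ∀ g g' : EuclideanSpace ℝ (Fin n) → ℂ,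
      dist (iteratedFDeriv ℝ 1 g y) (iteratedFDeriv ℝ 1 g' y) =
        dist (fderiv ℝ g y) (fderiv ℝ g' y) := by
    intro g g'
    have h3 : ∀ g : EuclideanSpace ℝ (Fin n) → ℂ, iteratedFDeriv ℝ 1 g y = _ := fun g =>
      iteratedFDeriv_succ_eq_comp_right (n := 0)
    rw [h3, h3]
    simp only [iteratedFDeriv_zero_eq_comp, Function.comp_apply, LinearIsometryEquiv.dist_map]
  simpa only [h2] using h1

variable {r : ℝ≥0} {A₀ : NonUnitalStarSubalgebra ℂ C(M, ℂ)}

theorem IsDenseSubalgebra.exists_norm_sub_lt [CompactSpace M] (h : IsDenseSubalgebra n r A₀)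
    {f : C(M, ℂ)} (hf : f ∈ classFunctions n r) {δ : ℝ} (hδ : 0 < δ) :
    ∃ u ∈ A₀, ‖u - f‖ < δ := by
  obtain ⟨u, hu, hc⟩ := h.dense f hf
  obtain ⟨i, hi⟩ := ((Metric.tendsto_nhds.1 hc.tendsto) δ hδ).exists
  exact ⟨u i, hu i, by rwa [← dist_eq_norm]⟩

/-- A substitute for the unit: `e = star u * u` with `u` within `1/8` of `1`. Then `|u|² ≥ 49/64`
and `2 |u|⁴ ≥ 1`. The inverse `g` is taken in `C(M, ℂ)` and need not lie in `A₀`. -/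
theorem IsDenseSubalgebra.exists_invertible [CompactSpace M] (h : IsDenseSubalgebra n r A₀) :
    ∃ e ∈ A₀, ∃ g : C(M, ℂ), e * g = 1 ∧ g * e = 1 ∧
      star (1 : C(M, ℂ)) * 1 ≤ (2 : ℂ) • (star e * e) := by
  obtain ⟨u, hu, hd⟩ := h.exists_norm_sub_lt (one_mem_classFunctions r)
    (δ := 1 / 8) (by norm_num)
  have hx : ∀ x, 7 / 8 ≤ ‖u x‖ := by
    intro x
    have h1 := (ContinuousMap.norm_coe_le_norm (u - 1) x).trans hd.le
    have h2 := norm_sub_norm_le (1 : ℂ) (1 - u x)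
    rw [sub_sub_cancel, norm_one, norm_sub_rev] at h2
    simp only [ContinuousMap.sub_apply, ContinuousMap.one_apply] at h1
    linarith
  have hval : ∀ x, (star u * u) x = ((‖u x‖ ^ 2 : ℝ) : ℂ) := by
    intro x
    rw [ContinuousMap.mul_apply, ContinuousMap.star_apply, RCLike.star_def, Complex.conj_mul']
    push_cast
    rfl
  have hne : ∀ x, (star u * u) x ≠ 0 := by
    intro x
    rw [hval]
    have := hx x
    exact_mod_cast (by positivity : ‖u x‖ ^ 2 ≠ 0)
  obtain ⟨g, hg⟩ := (ContinuousMap.isUnit_iff_forall_ne_zero _).2 hne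
  refine ⟨star u * u, mul_mem (star_mem hu) hu, ↑g⁻¹, ?_, ?_, ?_⟩
  · rw [← hg, g.mul_inv]
  · rw [← hg, g.inv_mul]
  · rw [ContinuousMap.le_def]
    intro x
    have h1 := hx x
    simp only [ContinuousMap.mul_apply, ContinuousMap.star_apply, ContinuousMap.one_apply,
      ContinuousMap.smul_apply, star_one, mul_one, smul_eq_mul]
    have h2 := hval x
    simp only [ContinuousMap.mul_apply, ContinuousMap.star_apply] at h2
    rw [h2, RCLike.star_def, Complex.conj_ofReal]
    have h3 : (49 / 64 : ℝ) ≤ ‖u x‖ ^ 2 := by nlinarith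
    have : (1 : ℝ) ≤ 2 * (‖u x‖ ^ 2 * ‖u x‖ ^ 2) := by nlinarith
    exact_mod_cast this

end Convergence

theorem contDiff_smul_of_tsupport_subset {V F : Type} [NormedAddCommGroup V] [NormedSpace ℝ V]
    [NormedAddCommGroup F] [NormedSpace ℝ F] {s : WithTop ℕ∞} {ψ : V → ℝ} {G : V → F}
    (hψ : ContDiff ℝ s ψ) (hG : ∀ y ∈ tsupport ψ, ContDiffAt ℝ s G y) :
    ContDiff ℝ s fun y => ψ y • G y := by
  refine contDiff_iff_contDiffAt.2 fun y => ?_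
  by_cases hy : y ∈ tsupport ψ
  · exact hψ.contDiffAt.smul (hG y hy)
  · refine contDiffAt_const.congr_of_eventuallyEq (f := fun _ => (0 : F)) ?_
    filter_upwards [(isClosed_tsupport ψ).isOpen_compl.mem_nhds hy] with z hz
    rw [image_eq_zero_of_notMem_tsupport hz, zero_smul]

/-! ### Cut-off functions and localization -/

section Local

variable {n : ℕ} {M : Type*} [TopologicalSpace M] [ChartedSpace (EuclideanSpace ℝ (Fin n)) M]
  [T2Space M] [CompactSpace M] {k : ℝ≥0∞} {r : ℝ≥0} {A₀ : NonUnitalStarSubalgebra ℂ C(M, ℂ)}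

/-- Cut-off functions in the smooth subalgebra. -/
theorem IsDenseSubalgebra.exists_cutoff (h : IsDenseSubalgebra n r A₀)
    (hM : IsClassManifold n k M) (hr : (r : ℝ≥0∞) ≤ k) (W : JetGauge C(M, ℂ))
    (hW : ∀ a ∈ A₀, a ∈ W.smooth) {x₀ : M} {U : Set M} (hU : U ∈ 𝓝 x₀) :
    ∃ χ ∈ W.smooth, (∀ᶠ x in 𝓝 x₀, χ x = 1) ∧ ∀ x ∉ U, χ x = 0 := by
  set e := chartAt (EuclideanSpace ℝ (Fin n)) x₀
  have hx₀ : x₀ ∈ e.source := mem_chart_source _ x₀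
  have hp : e x₀ ∈ e.target := e.map_source hx₀
  have hnhds : e.target ∩ e.symm ⁻¹' U ∈ 𝓝 (e x₀) := by
    refine inter_mem (e.open_target.mem_nhds hp) (e.continuousAt_symm hp ?_)
    rwa [e.left_inv hx₀]
  obtain ⟨ψ, hψ, hψc, hψs, hψ1⟩ := exists_smooth_bump hnhds
  set η : EuclideanSpace ℝ (Fin n) → ℂ := fun y => (ψ y : ℂ) with hη
  have hηs : tsupport η ⊆ tsupport ψ := closure_mono fun y hy => by
    simpa [hη] using hy
  have hηd : ContDiff ℝ (⊤ : ℕ∞) η := Complex.ofRealCLM.contDiff.comp hψ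
  have hηc : HasCompactSupport η := hψc.of_isClosed_subset (isClosed_tsupport η) hηs
  have hηt : tsupport η ⊆ e.target := fun y hy => (hψs (hηs hy)).1
  obtain ⟨u, hu, hd⟩ := h.exists_norm_sub_lt
    (chartExtend_mem_classFunctions hM hr (chart_mem_atlas _ x₀) hηd hηc hηt)
    (δ := 1 / 8) (by norm_num)
  have hclose : ∀ x, |(u x).re - (chartExtend e η x).re| ≤ 1 / 8 := fun x => by
    have h1 := (ContinuousMap.norm_coe_le_norm _ x).trans hd.le
    rw [ContinuousMap.sub_apply] at h1
    rw [← Complex.sub_re]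
    exact (Complex.abs_re_le_norm _).trans h1
  have hone : ∀ᶠ x in 𝓝 x₀, (chartExtend e η x).re = 1 := by
    filter_upwards [e.open_source.mem_nhds hx₀, e.continuousAt hx₀ hψ1] with x hx hx1
    rw [chartExtend_apply hx]
    simpa [hη] using hx1
  have hzero : ∀ x ∉ U, (chartExtend e η x).re = 0 := by
    intro x hx
    rw [chartExtend_of_notMem, Complex.zero_re]
    rintro ⟨y, hy, rfl⟩
    exact hx (hψs (hηs hy)).2
  -- The approximant is at least `7/8` where the bump is `1` and at most `1/8` where it is `0`.
  -- Division by `8` brings the relevant arguments into the range where the sine increases, and a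
  -- smooth transition between `s₁` and `s₂` then restores the exact values `1` and `0`.
  set s₁ := Real.sin (2 * Real.pi * (1 / 64))
  set s₂ := Real.sin (2 * Real.pi * (7 / 64))
  have hpi := Real.pi_pos
  have hs : s₁ < s₂ := Real.sin_lt_sin_of_lt_of_le_pi_div_two (by linarith) (by linarith)
    (by linarith)
  set F : (Fin 1 → ℝ) → ℂ := fun y => (Real.smoothTransition ((y 0 - s₁) / (s₂ - s₁)) : ℂ) with hF
  have hFd : ContDiff ℝ (1 + 2 : ℕ) F := by
    refine Complex.ofRealCLM.contDiff.comp ?_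
    have h1 : ContDiff ℝ (1 + 2 : ℕ) Real.smoothTransition := Real.smoothTransition.contDiff
    exact h1.comp (((contDiff_apply ℝ ℝ (0 : Fin 1)).sub contDiff_const).div_const _)
  set a : Fin 1 → C(M, ℂ) := fun _ => (1 / 8 : ℂ) • rePart u with ha
  have hare : ∀ x j, (a j x).re = (u x).re / 8 := by
    intro x j
    have : (1 / 8 : ℂ) = ((1 / 8 : ℝ) : ℂ) := by norm_num
    rw [ha]
    simp only [ContinuousMap.smul_apply, rePart_apply, smul_eq_mul]
    rw [this, ← Complex.ofReal_mul, Complex.ofReal_re]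
    ring
  have haim : ∀ j x, (a j x).im = 0 := by
    intro j x
    have : (1 / 8 : ℂ) = ((1 / 8 : ℝ) : ℂ) := by norm_num
    rw [ha]
    simp only [ContinuousMap.smul_apply, rePart_apply, smul_eq_mul]
    rw [this, ← Complex.ofReal_mul, Complex.ofReal_im]
  let χ : C(M, ℂ) := ⟨fun x => F fun j => Real.sin (2 * Real.pi * (a j x).re), by
    refine hFd.continuous.comp (continuous_pi fun j => Real.continuous_sin.comp
      (continuous_const.mul (Complex.continuous_re.comp (a j).continuous)))⟩
  refine ⟨χ, W.mem_smooth_of_eq_sin (fun j => W.smooth.smul_mem (hW _ (rePart_mem hu)) _) haim hFd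
    fun x => rfl, ?_, fun x hx => ?_⟩
  · filter_upwards [hone] with x hx
    have h1 := abs_le.1 (hclose x)
    have h2 : s₂ ≤ Real.sin (2 * Real.pi * (a 0 x).re) := by
      rw [hare x 0]
      refine Real.sin_le_sin_of_le_of_le_pi_div_two (by nlinarith) ?_ ?_ <;> nlinarith
    change ((Real.smoothTransition _ : ℝ) : ℂ) = 1
    rw [Real.smoothTransition.one_of_one_le, Complex.ofReal_one]
    rw [le_div_iff₀ (by linarith)]
    linarith
  · have h1 := abs_le.1 (hclose x)
    have h3 := hzero x hx
    have h2 : Real.sin (2 * Real.pi * (a 0 x).re) ≤ s₁ := by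
      rw [hare x 0]
      refine Real.sin_le_sin_of_le_of_le_pi_div_two ?_ (by linarith) ?_ <;> nlinarith
    change ((Real.smoothTransition _ : ℝ) : ℂ) = 0
    rw [Real.smoothTransition.zero_of_nonpos, Complex.ofReal_zero]
    exact div_nonpos_of_nonpos_of_nonneg (by linarith) (by linarith)

/-- A function that is locally equal to elements of the smooth subalgebra belongs to it. -/
theorem IsDenseSubalgebra.mem_smooth_of_locally (h : IsDenseSubalgebra n r A₀)
    (hM : IsClassManifold n k M) (hr : (r : ℝ≥0∞) ≤ k) (W : JetGauge C(M, ℂ))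
    (hW : ∀ a ∈ A₀, a ∈ W.smooth) {f : C(M, ℂ)}
    (hf : ∀ x₀, ∃ b ∈ W.smooth, ∀ᶠ x in 𝓝 x₀, f x = b x) : f ∈ W.smooth := by
  choose b hb hfb using hf
  choose χ hχ hχ1 hχ0 using fun x₀ => h.exists_cutoff hM hr W hW (hfb x₀)
  obtain ⟨s, -, hs⟩ := isCompact_univ.elim_nhds_subcover (fun x₀ => {x | χ x₀ x = 1})
    fun x₀ _ => hχ1 x₀
  -- The functions `1 - ∏ (1 - χ y)` replace a partition of unity: adding a point to `s` changes the
  -- product with `f` only by a term in `f * χ y = b y * χ y`. For a covering family the product of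
  -- the `1 - χ y` vanishes.
  have hind : ∀ s : Finset M, (∏ y ∈ s, (1 - χ y)) ∈ W.smooth ∧
      f * (1 - ∏ y ∈ s, (1 - χ y)) ∈ W.smooth := by
    intro s
    classical
    induction s using Finset.induction_on with
    | empty => simp
    | insert y s hy ih =>
      rw [Finset.prod_insert hy]
      refine ⟨mul_mem (sub_mem W.smooth.one_mem (hχ y)) ih.1, ?_⟩
      have h1 : f * χ y = b y * χ y := by
        ext x
        by_cases hx : f x = b y x
        · simp only [ContinuousMap.mul_apply, hx]
        · simp only [ContinuousMap.mul_apply, hχ0 y x hx, mul_zero]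
      have h2 : f * (1 - (1 - χ y) * ∏ y ∈ s, (1 - χ y)) =
          f * (1 - ∏ y ∈ s, (1 - χ y)) + b y * χ y * ∏ y ∈ s, (1 - χ y) := by
        rw [← h1]; ring
      rw [h2]
      exact add_mem ih.2 (mul_mem (mul_mem (hb y) (hχ y)) ih.1)
  have h0 : ∏ y ∈ s, (1 - χ y) = 0 := by
    ext x
    obtain ⟨y, hy, hxy⟩ := Set.mem_iUnion₂.1 (hs (Set.mem_univ x))
    rw [ContinuousMap.coe_prod, Finset.prod_apply]
    refine Finset.prod_eq_zero hy ?_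
    have : χ y x = 1 := hxy
    simp [this]
  simpa [h0] using (hind s).2

end Local

theorem continuous_clm_pi {ι V : Type*} [Fintype ι] [NormedAddCommGroup V] [NormedSpace ℝ V] :
    Continuous fun T : ι → V →L[ℝ] ℝ => ContinuousLinearMap.pi T := by
  classical
  have h : (fun T : ι → V →L[ℝ] ℝ => ContinuousLinearMap.pi T) = fun T =>
      ∑ j, (ContinuousLinearMap.single ℝ (fun _ : ι => ℝ) j) ∘L T j := by
    ext T y i
    simp [Finset.sum_apply, Pi.single_apply]
  rw [h]
  exact continuous_finsetSum _ fun j _ =>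
    (ContinuousLinearMap.compL ℝ V ℝ (ι → ℝ) _).continuous.comp (continuous_apply j)

/-! ### Local coordinates from the dense subalgebra -/

section Coordinates

variable {n : ℕ} {M : Type*} [TopologicalSpace M] [ChartedSpace (EuclideanSpace ℝ (Fin n)) M]
  [T2Space M] [CompactSpace M] {k : ℝ≥0∞} {r : ℝ≥0} {A₀ : NonUnitalStarSubalgebra ℂ C(M, ℂ)}

/-- Elements of a dense subalgebra whose differential at a point is close to a coordinate. -/
theorem IsDenseSubalgebra.exists_fderiv_tendsto (h : IsDenseSubalgebra n r A₀)
    (hM : IsClassManifold n k M) (hr : (r : ℝ≥0∞) ≤ k) (hr1 : 1 ≤ r)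
    {e : OpenPartialHomeomorph M (EuclideanSpace ℝ (Fin n))}
    (he : e ∈ atlas (EuclideanSpace ℝ (Fin n)) M) {p : EuclideanSpace ℝ (Fin n)}
    (hp : p ∈ e.target) (T : EuclideanSpace ℝ (Fin n) →L[ℝ] ℝ) :
    ∃ u : ℕ → C(M, ℂ), (∀ i, u i ∈ A₀) ∧
      Tendsto (fun i => Complex.reCLM ∘L fderiv ℝ (u i ∘ e.symm) p) atTop (𝓝 T) := by
  obtain ⟨ψ, hψ, hψc, hψs, hψ1⟩ := exists_smooth_bump (e.open_target.mem_nhds hp)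
  set η : EuclideanSpace ℝ (Fin n) → ℂ := fun y => ((ψ y * T y : ℝ) : ℂ) with hη
  have hηs : tsupport η ⊆ tsupport ψ := closure_mono fun y hy => by
    intro h0
    exact hy (by simp [hη, h0])
  have hηd : ContDiff ℝ (⊤ : ℕ∞) η := Complex.ofRealCLM.contDiff.comp (hψ.mul T.contDiff)
  have hηc : HasCompactSupport η := hψc.of_isClosed_subset (isClosed_tsupport η) hηs
  have hηt : tsupport η ⊆ e.target := hηs.trans hψs
  set q : C(M, ℂ) := ⟨chartExtend e η, continuous_chartExtend hηd.continuous hηc hηt⟩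
  have hq : q ∈ classFunctions n r := chartExtend_mem_classFunctions hM hr he hηd hηc hηt
  obtain ⟨u, hu, hc⟩ := h.dense q hq
  refine ⟨u, hu, ?_⟩
  have h1 := hc.tendsto_fderiv (Nat.le_floor (by exact_mod_cast hr1)) he hp
  have h2 : HasFDerivAt (chartExtend e η ∘ e.symm) (Complex.ofRealCLM ∘L T) p := by
    refine (Complex.ofRealCLM ∘L T).hasFDerivAt.congr_of_eventuallyEq ?_
    filter_upwards [hψ1, e.open_target.mem_nhds hp] with y hy hyt
    rw [Function.comp_apply, chartExtend_apply (e.map_target hyt), e.right_inv hyt]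
    simp [hη, hy]
  have h3 : Complex.reCLM ∘L (Complex.ofRealCLM ∘L T) = T := by
    ext y
    simp
  have h4 : fderiv ℝ (q ∘ e.symm) p = Complex.ofRealCLM ∘L T := h2.fderiv
  rw [h4] at h1
  have h5 := ((ContinuousLinearMap.compL ℝ (EuclideanSpace ℝ (Fin n)) ℂ ℝ
    Complex.reCLM).continuous.tendsto _).comp h1
  simpa only [ContinuousLinearMap.compL_apply, h3, Function.comp_def] using h5

/-- Local coordinates from a dense subalgebra. -/
theorem IsDenseSubalgebra.exists_coordinates (h : IsDenseSubalgebra n r A₀)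
    (hM : IsClassManifold n k M) (hr : (r : ℝ≥0∞) ≤ k) (hr1 : 1 ≤ r)
    {e : OpenPartialHomeomorph M (EuclideanSpace ℝ (Fin n))}
    (he : e ∈ atlas (EuclideanSpace ℝ (Fin n)) M) {p : EuclideanSpace ℝ (Fin n)}
    (hp : p ∈ e.target) :
    ∃ (g : Fin n → C(M, ℂ)) (T : EuclideanSpace ℝ (Fin n) ≃L[ℝ] (Fin n → ℝ)),
      (∀ j, g j ∈ A₀) ∧
      (T : EuclideanSpace ℝ (Fin n) →L[ℝ] (Fin n → ℝ)) = ContinuousLinearMap.pi fun j =>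
        (2 * Real.pi) • (Complex.reCLM ∘L fderiv ℝ (g j ∘ e.symm) p) := by
  set L := EuclideanSpace.equiv (Fin n) ℝ with hL
  -- The factor `(2π)⁻¹` compensates the derivative of `sin (2π t)` at `t = 0`.
  choose u hu hlim using fun j => h.exists_fderiv_tendsto hM hr hr1 he hp
    ((2 * Real.pi)⁻¹ • (ContinuousLinearMap.proj j ∘L
      (L : EuclideanSpace ℝ (Fin n) →L[ℝ] (Fin n → ℝ))))
  have h1 : Tendsto (fun i => ContinuousLinearMap.pi fun j =>
      (2 * Real.pi) • (Complex.reCLM ∘L fderiv ℝ (u j i ∘ e.symm) p)) atTop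
      (𝓝 (L : EuclideanSpace ℝ (Fin n) →L[ℝ] (Fin n → ℝ))) := by
    have h2 : (L : EuclideanSpace ℝ (Fin n) →L[ℝ] (Fin n → ℝ)) = ContinuousLinearMap.pi fun j =>
        (2 * Real.pi) • ((2 * Real.pi)⁻¹ • (ContinuousLinearMap.proj j ∘L
          (L : EuclideanSpace ℝ (Fin n) →L[ℝ] (Fin n → ℝ)))) := by
      ext y j
      have := Real.pi_ne_zero
      simp
      field_simp
    rw [h2]
    have h3 := tendsto_pi_nhds.2 fun j => (hlim j).const_smul (2 * Real.pi)
    exact (continuous_clm_pi.tendsto _).comp h3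
  -- Invertible linear maps form an open set, so sufficiently good approximations of the coordinates
  -- have an invertible differential.
  obtain ⟨i, T, hT⟩ := (h1.eventually L.nhds).exists
  exact ⟨fun j => u j i, T, fun j => hu j i, hT⟩

/-- Near each point a function of class `C^(r)` is a smooth function of finitely many elements of a
dense subalgebra. -/
theorem IsDenseSubalgebra.exists_mem_smooth_eventuallyEq (h : IsDenseSubalgebra n r A₀)
    (hM : IsClassManifold n k M) (hr : (r : ℝ≥0∞) ≤ k) (hrn : ((n + 2 : ℕ) : ℝ≥0) ≤ r)
    (W : JetGauge C(M, ℂ)) (hW : ∀ a ∈ A₀, a ∈ W.smooth) {f : C(M, ℂ)}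
    (hf : f ∈ classFunctions n r) (x₀ : M) :
    ∃ b ∈ W.smooth, ∀ᶠ x in 𝓝 x₀, f x = b x := by
  set e := chartAt (EuclideanSpace ℝ (Fin n)) x₀
  have he : e ∈ atlas (EuclideanSpace ℝ (Fin n)) M := chart_mem_atlas _ x₀
  have hx₀ : x₀ ∈ e.source := mem_chart_source _ x₀
  set p := e x₀ with hpdef
  have hp : p ∈ e.target := e.map_source hx₀
  have hfloor : n + 2 ≤ ⌊r⌋₊ := Nat.le_floor hrn
  have hr1 : 1 ≤ r := le_trans (by exact_mod_cast (by omega : 1 ≤ n + 2)) hrn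
  have hcd : ∀ {q : C(M, ℂ)}, q ∈ classFunctions n r →
      ContDiffAt ℝ (n + 2 : ℕ) (q ∘ e.symm) p := fun hq =>
    ((hq e he).1.contDiffAt (e.open_target.mem_nhds hp)).of_le (by exact_mod_cast hfloor)
  obtain ⟨g, T, hg, hT⟩ := h.exists_coordinates hM hr hr1 he hp
  have hgd : ∀ j, ContDiffAt ℝ (n + 2 : ℕ) (g j ∘ e.symm) p := fun j => hcd (h.subset (hg j))
  -- Centred at `x₀`, so that the sines vanish there and their differentials are `2π` times those of
  -- the real parts of `g j`.
  set a : Fin n → C(M, ℂ) := fun j => rePart (g j) - ((g j x₀).re : ℂ) • 1 with ha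
  have hare : ∀ j x, (a j x).re = (g j x).re - (g j x₀).re := by
    intro j x
    simp [ha, rePart_apply]
  have haim : ∀ j x, (a j x).im = 0 := by
    intro j x
    simp [ha, rePart_apply]
  have has : ∀ j, a j ∈ W.smooth := fun j =>
    sub_mem (hW _ (rePart_mem (hg j))) (W.smooth.smul_mem W.smooth.one_mem _)
  set Θ : EuclideanSpace ℝ (Fin n) → Fin n → ℝ := fun y j =>
    Real.sin (2 * Real.pi * ((g j (e.symm y)).re - (g j x₀).re)) with hΘ
  have hΘd : ContDiffAt ℝ (n + 2 : ℕ) Θ p := by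
    refine contDiffAt_pi.2 fun j => ?_
    refine Real.contDiff_sin.contDiffAt.comp p (contDiffAt_const.mul (ContDiffAt.sub ?_
      contDiffAt_const))
    exact Complex.reCLM.contDiff.contDiffAt.comp p (hgd j)
  have hΘp : Θ p = 0 := by
    ext j
    simp [hΘ, hpdef, e.left_inv hx₀]
  have hΘf : HasFDerivAt Θ (T : EuclideanSpace ℝ (Fin n) →L[ℝ] (Fin n → ℝ)) p := by
    rw [hT]
    refine hasFDerivAt_pi.2 fun j => ?_
    have h1 : HasFDerivAt (fun y => 2 * Real.pi * ((g j (e.symm y)).re - (g j x₀).re))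
        ((2 * Real.pi) • (Complex.reCLM ∘L fderiv ℝ (g j ∘ e.symm) p)) p := by
      have h2 := ((hgd j).differentiableAt (by simp)).hasFDerivAt
      exact ((Complex.reCLM.hasFDerivAt.comp p h2).sub_const _).const_mul _
    have h3 := h1.sin
    have h4 : (g j (e.symm p)).re - (g j x₀).re = 0 := by
      rw [hpdef, e.left_inv hx₀, sub_self]
    rw [h4] at h3
    simpa using h3
  have hne : ((n + 2 : ℕ) : WithTop ℕ∞) ≠ 0 := by simp
  -- Near `p` the function `f ∘ e.symm` is `((f ∘ e.symm) ∘ Ψ) ∘ Θ`. A bump function supported where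
  -- the outer factor is of class `C^(n+2)` makes that factor globally defined, as the functional
  -- calculus requires.
  set Ψ := hΘd.localInverse hΘf hne with hΨ
  have hΨd : ContDiffAt ℝ (n + 2 : ℕ) Ψ 0 := hΘp ▸ hΘd.to_localInverse hΘf hne
  have hΨ0 : Ψ 0 = p := hΘp ▸ hΘd.localInverse_apply_image hΘf hne
  have hΨl : ∀ᶠ y in 𝓝 p, Ψ (Θ y) = y :=
    (hΘd.hasStrictFDerivAt' hΘf hne).eventually_left_inverse
  have hGd : ContDiffAt ℝ (n + 2 : ℕ) ((f ∘ e.symm) ∘ Ψ) 0 :=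
    ContDiffAt.comp 0 (hΨ0 ▸ hcd hf) hΨd
  obtain ⟨ψ, hψ, -, hψs, hψ1⟩ := exists_smooth_bump (hGd.eventually fun h =>
    ENat.natCast_ne_top (n + 2) (WithTop.coe_inj.1 h))
  set F : (Fin n → ℝ) → ℂ := fun y => ψ y • ((f ∘ e.symm) ∘ Ψ) y with hF
  have hFd : ContDiff ℝ (n + 2 : ℕ) F :=
    contDiff_smul_of_tsupport_subset (contDiff_infty.1 hψ (n + 2)) fun y hy => hψs hy
  let b : C(M, ℂ) := ⟨fun x => F fun j => Real.sin (2 * Real.pi * (a j x).re), by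
    refine hFd.continuous.comp (continuous_pi fun j => Real.continuous_sin.comp
      (continuous_const.mul (Complex.continuous_re.comp (a j).continuous)))⟩
  refine ⟨b, W.mem_smooth_of_eq_sin has haim hFd fun x => rfl, ?_⟩
  have hΘt : Tendsto Θ (𝓝 p) (𝓝 0) := hΘp ▸ hΘd.continuousAt
  filter_upwards [e.open_source.mem_nhds hx₀, e.continuousAt hx₀ hΨl,
    e.continuousAt hx₀ (hΘt hψ1)] with x hx hx1 hx2
  have h1 : b x = F (Θ (e x)) := by
    change F _ = F _
    congr 1
    ext j
    rw [hare, hΘ]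
    simp only [e.left_inv hx]
  have hx1' : Ψ (Θ (e x)) = e x := hx1
  have hx2' : ψ (Θ (e x)) = 1 := hx2
  rw [h1, hF]
  simp only [Function.comp_apply, hx1', hx2', one_smul, e.left_inv hx]

theorem IsDenseSubalgebra.classFunctions_subset_smooth (h : IsDenseSubalgebra n r A₀)
    (hM : IsClassManifold n k M) (hr : (r : ℝ≥0∞) ≤ k) (hrn : ((n + 2 : ℕ) : ℝ≥0) ≤ r)
    (W : JetGauge C(M, ℂ)) (hW : ∀ a ∈ A₀, a ∈ W.smooth) {f : C(M, ℂ)}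
    (hf : f ∈ classFunctions n r) : f ∈ W.smooth :=
  h.mem_smooth_of_locally hM hr W hW (h.exists_mem_smooth_eventuallyEq hM hr hrn W hW hf)

end Coordinates

end SmoothExt

end

theorem theorem3
    (n : ℕ) (ε : ℝ≥0) (hε : 0 < ε) (k : ℝ≥0∞) (hk : ((n + 2 + ε : ℝ≥0) : ℝ≥0∞) ≤ k)
    (M : Type*) [TopologicalSpace M] [T2Space M] [CompactSpace M]
    [ChartedSpace (EuclideanSpace ℝ (Fin n)) M] (hM : SmoothExt.IsClassManifold n k M)
    (H : Type*) [NormedAddCommGroup H] [InnerProductSpace ℂ H] [CompleteSpace H]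
    (K : SmoothExt.FrechetOperatorIdeal H)
    (X : SmoothExt.SmoothExtension K (SmoothExt.classFunctions (M := M) n (n + 2 + ε)))
    (φ : C(M, ℂ) →CP (H →L[ℂ] H)) (hφ : ∀ a : C(M, ℂ), φ a = X.P * X.π a * X.P)
    (A₀ : NonUnitalStarSubalgebra ℂ C(M, ℂ))
    (hA₀ : SmoothExt.IsDenseSubalgebra n (n + 2 + ε) A₀) :
    SmoothExt.IsTauSmooth K (SmoothExt.classFunctions n (n + 2 + ε)) (A₀ : Set C(M, ℂ)) φ := by
  intro φ₀ hφ₀ f hf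
  obtain ⟨E, _, _, _, V, hV⟩ := SmoothExt.CompletelyPositiveMap.exists_kolmogorov φ₀
  let D : SmoothExt.DilatedPair C(M, ℂ) H E :=
    { V := V
      φ := { toFun := φ₀, map_add' := map_add φ₀, map_smul' := map_smul φ₀ }
      adjoint_comp := hV
      π := X.π
      P := X.P
      isStarProjection := X.isStarProjection }
  obtain ⟨e, he, g, heg, hge, hle⟩ := hA₀.exists_invertible
  have hD : D.AgreesOn K A₀ e g :=
    { commutator_mem := fun a ha => X.commutator_mem a (hA₀.subset ha)
      -- The constant `1` belongs to `C^(n+2+ε)(M)` even when it is not in `A₀`.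
      commutator_one_mem := X.commutator_mem 1 (SmoothExt.one_mem_classFunctions _)
      sub_mem := fun a ha => by
        have := hφ₀ a ha
        rwa [hφ] at this
      mem := he
      mul_inv := heg
      inv_mul := hge
      le := hle }
  rw [hφ]
  refine hD.compression_sub_mem_of_mem_smooth (X.commutator_mem f hf) ?_
  refine hA₀.classFunctions_subset_smooth hM hk ?_ hD.jetGauge (fun a ha => hD.mem_smooth ha) hf
  push_cast
  exact le_self_add
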